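/- Let $k$ be a field, $\mathcal A=k[[\epsilon]]$, $K=k((\epsilon))$, and let $V$ be a $2$-dimensional $K$-vector space with a fixed volume element $0\ne\omega\in\wedge^2_KV$; put $\mathbf G=SL(V)$. Let $X$ be the set of $\mathcal A$-lattices in $V$ that have an $\mathcal A$-basis $e_1,e_2$ with $e_1\wedge e_2=\omega$. For $\mathcal L\in X$, the vector space $\mathcal L/\epsilon\mathcal L$ carries the volume element induced by $\omega$ (the class of $e_1\wedge e_2$ for such a basis). Fix $\mathcal L\in X$ and let $P=\{g\in\mathbf G: g\mathcal L=\mathcal L\}$. *Definitions.* An Iwahori subgroup is the stabilizer in $\mathbf G$ of a pair of lattices $M\supsetneq N\supsetneq\epsilon M$ with $M\in X$; a parahoric subgroup is a subgroup $Q\ne\mathbf G$ that contains an Iwahori subgroup; $U_Q$ is its prounipotent radical, the group of $g\in Q$ acting trivially on the successive quotients of the chain of $Q$-stable lattices. Let $W'$ be the set of $\mathbf G$-orbits on pairs of Iwahori subgroups, $\mathrm{pos}(B,B')\in W'$ the orbit of $(B,B')$, $l(\mathrm{pos}(B,B'))=\dim B/(B\cap B')$, and $I=\{w\in W': l(w)=1\}$.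 The type of a parahoric subgroup $Q$ is the set $J\subset I$ of those $s\in I$ with $s=\mathrm{pos}(B,B')$ for some Iwahori subgroups $B,B'\subset Q$. With $W'$ made into a Coxeter group as in (1) below, $\mathrm{pos}(Q,Q')$, for parahoric $Q,Q'$, is the smallest element, in the Bruhat order, among the $\mathrm{pos}(B,B')$ with $B\subset Q$, $B'\subset Q'$. Put $Q^{Q'}=(Q\cap Q')U_Q$. For $J\subset I$ let $W'_J$ be the subgroup generated by $J$ and let $\mathcal T(J)$ be the set of sequences $(J_n,w_n)_{n\ge0}$ with $J_n\subset I$, $w_n\in W'$, $J_0=J$, $J_{n+1}=J_n\cap w_nJ_nw_n^{-1}$, $w_n$ of minimal length in $W'_{J_n}w_nW'_{J_n}$, and $w_{n+1}\in w_nW'_{J_n}$. For $g\in\mathbf G$ put $P^0=P$, $P'^n=gP^ng^{-1}$, $P^{n+1}=g^{-1}(P'^n)^{P^n}g$. From now on let $J$ be the type of $P$. For $\mathbf t=(J_n,w_n)\in\mathcal T(J)$, the piece ${}^{\mathbf t}\mathbf G/U_P$ is the set of $gU_P\in\mathbf G/U_P$ such that $w_n=\mathrm{pos}(P'^n,P^n)$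 for all $n\geq 0$. Let $Y$ be the set of pairs $(\mathcal L',g)$ with $\mathcal L'\in X$ and $g:\mathcal L/\epsilon\mathcal L\to\mathcal L'/\epsilon\mathcal L'$ a $k$-linear isomorphism that preserves the induced volume elements. Let $Y_n=\{(\mathcal L',g)\in Y:\dim_k\mathcal L/(\mathcal L\cap\mathcal L')=n\}$. For $n>0$ and $(\mathcal L',g)\in Y_n$ let $\mathcal L_1$ be the unique lattice with $\mathcal L\cap\mathcal L'\subset\mathcal L_1\subset\mathcal L$, $\dim_k\mathcal L/\mathcal L_1=1$, and $\mathcal L_2$ the unique lattice with $\mathcal L\cap\mathcal L'\subset\mathcal L_2\subset\mathcal L'$, $\dim_k\mathcal L'/\mathcal L_2=1$. Let $Y'_n$ (resp. $Y''_n$) be the set of $(\mathcal L',g)\in Y_n$ with $g(\mathcal L_1/\epsilon\mathcal L)=\mathcal L_2/\epsilon\mathcal L'$ (resp. $\ne$). *Theorem.* (1) $\mathbf G$ is equal to its derived group and $P$ is a parahoric subgroup of it. There is exactly one group structure on $W'$ such that the elements of $I$ have order $2$, such that $\mathrm{pos}(B,B'')=\mathrm{pos}(B,B')\,\mathrm{pos}(B',B'')$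 whenever $l(\mathrm{pos}(B,B')\,\mathrm{pos}(B',B''))=l(\mathrm{pos}(B,B'))+l(\mathrm{pos}(B',B''))$, and such that $(W',I)$ is a Coxeter group with length function $l$. (2) The map $gU_P\mapsto(g\mathcal L,\ \bar g:\mathcal L/\epsilon\mathcal L\to g\mathcal L/\epsilon g\mathcal L)$, where $\bar g$ is induced by $g$, is a well-defined bijection $\mathbf G/U_P\to Y$. (3) The sets $Y_0$, $Y'_n$ $(n>0)$, $Y''_n$ $(n>0)$ form a partition of $Y$ into non-empty subsets. They are precisely the pieces: under the bijection (2), $\mathbf t\mapsto{}^{\mathbf t}\mathbf G/U_P$ is a bijection from $\mathcal T(J)$ onto the collection $\{Y_0\}\cup\{Y'_n: n>0\}\cup\{Y''_n: n>0\}$. (4) If $k$ is a finite field with $q$ elements, then $Y_0$, $Y'_n$, $Y''_n$ $(n>0)$ are finite sets of cardinality $q(q^2-1)$, $q^{2n}(q^2-1)$, $q^{2n+1}(q^2-1)$ respectively. -/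

import Mathlib

namespace LoopSL2

set_option linter.unusedSectionVars false

section

variable {k : Type*} [Field k] {V : Type*} [AddCommGroup V] [Module k V]
  [Module (PowerSeries k) V] [Module (LaurentSeries k) V]
  [IsScalarTower k (PowerSeries k) V] [IsScalarTower (PowerSeries k) (LaurentSeries k) V]

/-! ### Lattices -/

/-- The translate `gM` of a `k[[ε]]`-submodule `M` of `V` by `g ∈ SL(V)`. -/
noncomputable def translate (g : SpecialLinearGroup (LaurentSeries k) V)
    (M : Submodule (PowerSeries k) V) : Submodule (PowerSeries k) V :=
  M.map ((g.1 : V →ₗ[LaurentSeries k] V).restrictScalars (PowerSeries k))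

theorem mem_translate {g : SpecialLinearGroup (LaurentSeries k) V}
    {M : Submodule (PowerSeries k) V} {x : V} :
    x ∈ translate g M ↔ ∃ y ∈ M, g.1 y = x := Iff.rfl

theorem translate_one (M : Submodule (PowerSeries k) V) :
    translate (1 : SpecialLinearGroup (LaurentSeries k) V) M = M := by
  ext x
  rw [mem_translate]
  exact ⟨by rintro ⟨y, hy, rfl⟩; exact hy, fun hx => ⟨x, hx, rfl⟩⟩

theorem translate_mul (g h : SpecialLinearGroup (LaurentSeries k) V)
    (M : Submodule (PowerSeries k) V) :
    translate (g * h) M = translate g (translate h M) := by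
  ext x
  simp only [mem_translate]
  constructor
  · rintro ⟨y, hy, rfl⟩
    exact ⟨h.1 y, ⟨y, hy, rfl⟩, rfl⟩
  · rintro ⟨_, ⟨y, hy, rfl⟩, rfl⟩
    exact ⟨y, hy, rfl⟩

/-- The stabilizer of `M` in `SL(V)`. -/
noncomputable def stab (M : Submodule (PowerSeries k) V) :
    Subgroup (SpecialLinearGroup (LaurentSeries k) V) where
  carrier := {g | translate g M = M}
  one_mem' := translate_one M
  mul_mem' := by
    intro g h hg hh
    change translate (g * h) M = M
    rw [translate_mul, show translate h M = M from hh, show translate g M = M from hg]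
  inv_mem' := by
    intro g hg
    change translate g⁻¹ M = M
    conv_lhs => rw [← show translate g M = M from hg]
    rw [← translate_mul, inv_mul_cancel, translate_one]

/-- `εM`. -/
noncomputable def epsMul (M : Submodule (PowerSeries k) V) : Submodule (PowerSeries k) V :=
  M.map (LinearMap.lsmul (PowerSeries k) V PowerSeries.X)

/-- `M / εM`. -/
abbrev Red (M : Submodule (PowerSeries k) V) : Type _ :=
  M ⧸ (epsMul M).submoduleOf M

/-- `dim_k M / (M ∩ N)`. -/
noncomputable def codim (M N : Submodule (PowerSeries k) V) : ℕ :=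
  Module.finrank k (M ⧸ (M ⊓ N).submoduleOf M)

/-- The set of lattices `M` that have a `k[[ε]]`-basis `e₁, e₂` with `e₁ ∧ e₂ = ω`. -/
def unimodularLattices (ω : ⋀[LaurentSeries k]^2 V) : Set (Submodule (PowerSeries k) V) :=
  {M | ∃ e : Module.Basis (Fin 2) (PowerSeries k) M,
    exteriorPower.ιMulti (LaurentSeries k) 2 (fun i => (e i : V)) = ω}

/-- `η` is the volume element of `M / εM` induced by `ω`: the class of `e₁ ∧ e₂`, where
`e₁, e₂` is a basis of `M` with `e₁ ∧ e₂ = ω`. -/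
def IsInducedVolume (ω : ⋀[LaurentSeries k]^2 V) (M : Submodule (PowerSeries k) V)
    (η : ⋀[k]^2 (Red M)) : Prop :=
  ∃ e : Module.Basis (Fin 2) (PowerSeries k) M,
    exteriorPower.ιMulti (LaurentSeries k) 2 (fun i => (e i : V)) = ω ∧
    η = exteriorPower.ιMulti k 2 (fun i => (Submodule.Quotient.mk (e i) : Red M))

/-! ### Iwahori and parahoric subgroups -/

/-- Iwahori subgroups: for a lattice `M` with a basis of volume `ω` (so that `stab M` is a
conjugate of `SL₂(k[[ε]])`), the preimage in `stab M` of the Borel subgroup of `SL(M / εM)` that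
fixes the line `N / εM`. -/
def IsIwahori (ω : ⋀[LaurentSeries k]^2 V)
    (B : Subgroup (SpecialLinearGroup (LaurentSeries k) V)) : Prop :=
  ∃ M ∈ unimodularLattices ω, ∃ N : Submodule (PowerSeries k) V,
    epsMul M < N ∧ N < M ∧ B = stab M ⊓ stab N

/-- Parahoric subgroups. -/
def IsParahoric (ω : ⋀[LaurentSeries k]^2 V)
    (Q : Subgroup (SpecialLinearGroup (LaurentSeries k) V)) : Prop :=
  (∃ B, IsIwahori ω B ∧ B ≤ Q) ∧ Q ≠ ⊤

/-- `M` is a `Q`-stable lattice. -/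
def IsStableLattice (Q : Subgroup (SpecialLinearGroup (LaurentSeries k) V))
    (M : Submodule (PowerSeries k) V) : Prop :=
  Submodule.IsLattice (LaurentSeries k) M ∧ ∀ g ∈ Q, translate g M = M

/-- `N ⊂ M` are `Q`-stable lattices with no `Q`-stable lattice strictly between them. -/
def IsStableStep (Q : Subgroup (SpecialLinearGroup (LaurentSeries k) V))
    (N M : Submodule (PowerSeries k) V) : Prop :=
  IsStableLattice Q N ∧ IsStableLattice Q M ∧ N < M ∧
    ∀ M', IsStableLattice Q M' → N ≤ M' → M' ≤ M → M' = N ∨ M' = M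

/-- The prounipotent radical `U_Q` of a parahoric subgroup `Q`: the elements of `Q` that act
trivially on the successive quotients of the chain of all `Q`-stable lattices. -/
noncomputable def radical (Q : Subgroup (SpecialLinearGroup (LaurentSeries k) V)) :
    Subgroup (SpecialLinearGroup (LaurentSeries k) V) where
  carrier := {g | g ∈ Q ∧ ∀ N M, IsStableStep Q N M → ∀ x ∈ M, g.1 x - x ∈ N}
  one_mem' := ⟨Q.one_mem, fun N M _ x _ => by
    change x - x ∈ N
    rw [sub_self]
    exact N.zero_mem⟩
  mul_mem' := by
    rintro g h ⟨hgQ, hg⟩ ⟨hhQ, hh⟩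
    refine ⟨Q.mul_mem hgQ hhQ, fun N M hNM x hx => ?_⟩
    have h1 : g.1 (h.1 x - x) ∈ translate g N := ⟨_, hh N M hNM x hx, rfl⟩
    rw [hNM.1.2 g hgQ] at h1
    have h2 : (g * h).1 x - x = g.1 (h.1 x - x) + (g.1 x - x) := by
      change g.1 (h.1 x) - x = g.1 (h.1 x - x) + (g.1 x - x)
      rw [map_sub]
      abel
    rw [h2]
    exact N.add_mem h1 (hg N M hNM x hx)
  inv_mem' := by
    rintro g ⟨hgQ, hg⟩
    refine ⟨Q.inv_mem hgQ, fun N M hNM x hx => ?_⟩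
    have h1 : (g⁻¹).1 (g.1 x - x) ∈ translate g⁻¹ N := ⟨_, hg N M hNM x hx, rfl⟩
    rw [hNM.1.2 g⁻¹ (Q.inv_mem hgQ)] at h1
    have h3 : (g⁻¹).1 (g.1 x) = x := g.1.symm_apply_apply x
    have h2 : (g⁻¹).1 x - x = - (g⁻¹).1 (g.1 x - x) := by
      rw [map_sub, h3]
      abel
    rw [h2]
    exact N.neg_mem h1

/-- `gQg⁻¹`. -/
noncomputable def conj (g : SpecialLinearGroup (LaurentSeries k) V)
    (Q : Subgroup (SpecialLinearGroup (LaurentSeries k) V)) :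
    Subgroup (SpecialLinearGroup (LaurentSeries k) V) :=
  Q.map (MulAut.conj g).toMonoidHom

/-- `P^Q = (P ∩ Q) U_P`. -/
noncomputable def proj (P Q : Subgroup (SpecialLinearGroup (LaurentSeries k) V)) :
    Subgroup (SpecialLinearGroup (LaurentSeries k) V) :=
  (P ⊓ Q) ⊔ radical P

/-! ### The affine Weyl group -/

/-- The set of Iwahori subgroups. -/
abbrev Iwahori (ω : ⋀[LaurentSeries k]^2 V) : Type _ :=
  {B : Subgroup (SpecialLinearGroup (LaurentSeries k) V) // IsIwahori ω B}

theorem conj_one (Q : Subgroup (SpecialLinearGroup (LaurentSeries k) V)) : conj 1 Q = Q := by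
  ext x
  simp [conj]

theorem conj_mul (g h : SpecialLinearGroup (LaurentSeries k) V)
    (Q : Subgroup (SpecialLinearGroup (LaurentSeries k) V)) :
    conj (g * h) Q = conj g (conj h Q) := by
  simp only [conj, Subgroup.map_map]
  congr 1

/-- Simultaneous conjugacy of pairs of Iwahori subgroups. -/
def pairSetoid (ω : ⋀[LaurentSeries k]^2 V) : Setoid (Iwahori ω × Iwahori ω) where
  r p q := ∃ g, conj g p.1.1 = q.1.1 ∧ conj g p.2.1 = q.2.1
  iseqv :=
    { refl := fun p => ⟨1, conj_one _, conj_one _⟩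
      symm := by
        rintro p q ⟨g, h1, h2⟩
        refine ⟨g⁻¹, ?_, ?_⟩
        · rw [← h1, ← conj_mul, inv_mul_cancel, conj_one]
        · rw [← h2, ← conj_mul, inv_mul_cancel, conj_one]
      trans := by
        rintro p q r ⟨g, h1, h2⟩ ⟨h, h3, h4⟩
        refine ⟨h * g, ?_, ?_⟩
        · rw [conj_mul, h1, h3]
        · rw [conj_mul, h2, h4] }

/-- The set `W'` of `SL(V)`-orbits on pairs of Iwahori subgroups. -/
def Weyl (ω : ⋀[LaurentSeries k]^2 V) : Type _ := Quotient (pairSetoid ω)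

/-- The orbit of a pair of Iwahori subgroups. -/
def pos {ω : ⋀[LaurentSeries k]^2 V} (B B' : Iwahori ω) : Weyl ω :=
  Quotient.mk (pairSetoid ω) (B, B')

instance smulCommClass : SMulCommClass (LaurentSeries k) k V where
  smul_comm a c x := by
    rw [← IsScalarTower.algebraMap_smul (PowerSeries k) c x,
      ← IsScalarTower.algebraMap_smul (PowerSeries k) c (a • x), smul_comm]

/-- The Lie algebra of an Iwahori subgroup `B`: the trace zero endomorphisms of `V` that map
every `B`-stable lattice into itself. -/
noncomputable def lie (B : Subgroup (SpecialLinearGroup (LaurentSeries k) V)) :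
    Submodule k (V →ₗ[LaurentSeries k] V) where
  carrier := {a | LinearMap.trace (LaurentSeries k) V a = 0 ∧
    ∀ M, IsStableLattice B M → ∀ x ∈ M, a x ∈ M}
  zero_mem' := ⟨map_zero _, fun M _ x _ => M.zero_mem⟩
  add_mem' := by
    rintro a b ⟨ha, ha'⟩ ⟨hb, hb'⟩
    exact ⟨by rw [map_add, ha, hb, add_zero],
      fun M hM x hx => M.add_mem (ha' M hM x hx) (hb' M hM x hx)⟩
  smul_mem' := by
    rintro c a ⟨ha, ha'⟩
    refine ⟨?_, fun M hM x hx => ?_⟩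
    · have : c • a = (algebraMap (PowerSeries k) (LaurentSeries k) (algebraMap k _ c)) • a := by
        ext x
        rw [LinearMap.smul_apply, LinearMap.smul_apply, algebraMap_smul, algebraMap_smul]
      rw [this, map_smul, ha, smul_zero]
    · have h1 : (c • a) x = (algebraMap k (PowerSeries k) c) • a x := by
        rw [LinearMap.smul_apply, algebraMap_smul]
      rw [h1]
      exact M.smul_mem _ (ha' M hM x hx)

/-- The dimension of `B / (B ∩ B')`, computed on its tangent space
`Lie B / (Lie B ∩ Lie B')`. -/
noncomputable def relDim (B B' : Subgroup (SpecialLinearGroup (LaurentSeries k) V)) : ℕ :=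
  Module.finrank k (lie B ⧸ (lie B ⊓ lie B').submoduleOf (lie B))

theorem isLattice_translate (g : SpecialLinearGroup (LaurentSeries k) V)
    {M : Submodule (PowerSeries k) V} (hM : Submodule.IsLattice (LaurentSeries k) M) :
    Submodule.IsLattice (LaurentSeries k) (translate g M) where
  fg := hM.fg.map _
  span_eq_top := by
    have h : ((translate g M : Submodule (PowerSeries k) V) : Set V)
        = (g.1 : V →ₗ[LaurentSeries k] V) '' (M : Set V) := rfl
    rw [h, Submodule.span_image, hM.span_eq_top, Submodule.map_top, LinearMap.range_eq_top]
    exact g.1.surjective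

theorem isStableLattice_conj (g : SpecialLinearGroup (LaurentSeries k) V)
    {B : Subgroup (SpecialLinearGroup (LaurentSeries k) V)} {M : Submodule (PowerSeries k) V}
    (hM : IsStableLattice B M) : IsStableLattice (conj g B) (translate g M) := by
  refine ⟨isLattice_translate g hM.1, ?_⟩
  rintro _ ⟨b, hb, rfl⟩
  change translate (g * b * g⁻¹) (translate g M) = translate g M
  rw [← translate_mul, inv_mul_cancel_right, translate_mul, hM.2 b hb]

theorem mem_lie_conj (g : SpecialLinearGroup (LaurentSeries k) V)
    {B : Subgroup (SpecialLinearGroup (LaurentSeries k) V)} {a : V →ₗ[LaurentSeries k] V}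
    (ha : a ∈ lie B) : g.1.conj a ∈ lie (conj g B) := by
  refine ⟨by rw [LinearMap.trace_conj']; exact ha.1, fun M hM x hx => ?_⟩
  have h := isStableLattice_conj g⁻¹ hM
  rw [← conj_mul, inv_mul_cancel, conj_one] at h
  have h1 : a (g.1.symm x) ∈ translate g⁻¹ M := ha.2 _ h _ ⟨x, hx, rfl⟩
  have h2 : g.1 (a (g.1.symm x)) ∈ translate g (translate g⁻¹ M) := ⟨_, h1, rfl⟩
  rw [← translate_mul, mul_inv_cancel, translate_one] at h2
  exact h2

theorem relDim_conj (g : SpecialLinearGroup (LaurentSeries k) V)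
    (B B' : Subgroup (SpecialLinearGroup (LaurentSeries k) V)) :
    relDim (conj g B) (conj g B') = relDim B B' := by
  have key : ∀ (C : Subgroup (SpecialLinearGroup (LaurentSeries k) V))
      (a : V →ₗ[LaurentSeries k] V), g.1.conj a ∈ lie (conj g C) ↔ a ∈ lie C := by
    intro C a
    refine ⟨fun h => ?_, mem_lie_conj g⟩
    have h1 := mem_lie_conj g⁻¹ h
    rw [← conj_mul, inv_mul_cancel, conj_one] at h1
    have h2 : (g⁻¹).1.conj (g.1.conj a) = a := by
      ext x
      change g.1.symm (g.1 (a (g.1.symm (g.1 x)))) = a x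
      simp
    rwa [h2] at h1
  let φ : (V →ₗ[LaurentSeries k] V) ≃ₗ[k] (V →ₗ[LaurentSeries k] V) :=
    { g.1.conj with
      map_smul' := by
        intro c a
        ext x
        change g.1 (c • a (g.1.symm x)) = c • g.1 (a (g.1.symm x))
        rw [← IsScalarTower.algebraMap_smul (PowerSeries k) c (a (g.1.symm x)),
          ← IsScalarTower.algebraMap_smul (PowerSeries k) c (g.1 (a (g.1.symm x))),
          ← IsScalarTower.algebraMap_smul (LaurentSeries k) _ (a (g.1.symm x)),
          ← IsScalarTower.algebraMap_smul (LaurentSeries k) _ (g.1 (a (g.1.symm x))), map_smul] }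
  have hφ : (lie B).map (φ : (V →ₗ[LaurentSeries k] V) →ₗ[k] (V →ₗ[LaurentSeries k] V))
      = lie (conj g B) := by
    ext a
    constructor
    · rintro ⟨b, hb, rfl⟩
      exact (key B b).2 hb
    · intro ha
      refine ⟨φ.symm a, (key B _).1 ?_, φ.apply_symm_apply a⟩
      change φ (φ.symm a) ∈ _
      rwa [φ.apply_symm_apply]
  let ψ : lie B ≃ₗ[k] lie (conj g B) := φ.submoduleMap (lie B) |>.trans (LinearEquiv.ofEq _ _ hφ)
  refine (LinearEquiv.finrank_eq (Submodule.Quotient.equiv _ _ ψ ?_)).symm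
  ext a
  constructor
  · rintro ⟨b, hb, rfl⟩
    exact ⟨(key B _).2 hb.1, (key B' _).2 hb.2⟩
  · intro ha
    refine ⟨ψ.symm a, ⟨(ψ.symm a).2, (key B' _).1 ?_⟩, ψ.apply_symm_apply a⟩
    change ((ψ (ψ.symm a) : lie (conj g B)) : V →ₗ[LaurentSeries k] V) ∈ _
    rw [ψ.apply_symm_apply]
    exact ha.2

/-- The length of `w ∈ W'`: the dimension of `B / (B ∩ B')` for any pair `(B, B')` in `w`. -/
noncomputable def len {ω : ⋀[LaurentSeries k]^2 V} (w : Weyl ω) : ℕ :=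
  Quotient.lift (s := pairSetoid ω) (fun p => relDim p.1.1 p.2.1)
    (by
      rintro p q ⟨g, h1, h2⟩
      rw [← h1, ← h2, relDim_conj]) w

/-- The set `I` of elements of `W'` of length one. -/
def simples (ω : ⋀[LaurentSeries k]^2 V) : Set (Weyl ω) := {w | len w = 1}

/-- The group structure on `W'`: the elements of `I` have order two, positions multiply whenever
lengths add, and `(W', I)` is a Coxeter group with length function `len`. -/
structure IsWeylGroup (ω : ⋀[LaurentSeries k]^2 V) (grp : Group (Weyl ω)) : Prop where
  orderOf_simple : ∀ s ∈ simples ω, orderOf s = 2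
  pos_mul : ∀ B B' B'' : Iwahori ω,
    len (pos B B' * pos B' B'') = len (pos B B') + len (pos B' B'') →
      pos B B'' = pos B B' * pos B' B''
  coxeter : ∃ (m : CoxeterMatrix (simples ω)) (cs : CoxeterSystem m (Weyl ω)),
    (∀ s, cs.simple s = s) ∧ ∀ w, cs.length w = len w

/-- The standard (Bruhat) partial order on `W'`. -/
def BruhatLE {ω : ⋀[LaurentSeries k]^2 V} [Group (Weyl ω)] (u w : Weyl ω) : Prop :=
  Relation.ReflTransGen
    (fun a b => len a < len b ∧ ∃ x, ∃ s ∈ simples ω, b = a * (x * s * x⁻¹)) u w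

/-- The set of minimal length representatives of the double cosets `W'_J \ W' / W'_K`. -/
def minReps {ω : ⋀[LaurentSeries k]^2 V} [Group (Weyl ω)] (J K : Set (Weyl ω)) :
    Set (Weyl ω) :=
  {w | (∀ s ∈ J, len w < len (s * w)) ∧ ∀ s ∈ K, len w < len (w * s)}

/-- The type `J ⊂ I` of a parahoric subgroup `Q`. -/
def type (ω : ⋀[LaurentSeries k]^2 V)
    (Q : Subgroup (SpecialLinearGroup (LaurentSeries k) V)) : Set (Weyl ω) :=
  {s ∈ simples ω | ∃ B B' : Iwahori ω, B.1 ≤ Q ∧ B'.1 ≤ Q ∧ pos B B' = s}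

/-- `pos(P, Q) = u` for parahoric subgroups `P`, `Q`: `u` is the smallest of the positions of
Iwahori subgroups `B ⊂ P`, `B' ⊂ Q`. -/
def IsPos {ω : ⋀[LaurentSeries k]^2 V} [Group (Weyl ω)]
    (P Q : Subgroup (SpecialLinearGroup (LaurentSeries k) V)) (u : Weyl ω) : Prop :=
  (∀ B B' : Iwahori ω, B.1 ≤ P → B'.1 ≤ Q → BruhatLE u (pos B B')) ∧
    ∃ B B' : Iwahori ω, B.1 ≤ P ∧ B'.1 ≤ Q ∧ pos B B' = u

/-! ### The pieces of `SL(V) / U_P` -/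

/-- `Ad(w)J = wJw⁻¹`. -/
def ad {ω : ⋀[LaurentSeries k]^2 V} [Group (Weyl ω)] (w : Weyl ω) (J : Set (Weyl ω)) :
    Set (Weyl ω) :=
  (fun s => w * s * w⁻¹) '' J

/-- The set `𝒯(J)` of sequences `(Jₙ, wₙ)`. -/
def sequences {ω : ⋀[LaurentSeries k]^2 V} [Group (Weyl ω)] (J : Set (Weyl ω)) :
    Set (ℕ → Set (Weyl ω) × Weyl ω) :=
  {t | (t 0).1 = J ∧
    (∀ n, (t (n + 1)).1 = (t n).1 ∩ ad (t n).2 (t n).1) ∧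
    (∀ n, (t n).2 ∈ minReps (t n).1 (t n).1) ∧
    ∀ n, ∃ y ∈ Subgroup.closure (t n).1, (t (n + 1)).2 = (t n).2 * y}

/-- The sequence `P⁰ = P`, `Pⁿ⁺¹ = g⁻¹ ((gPⁿg⁻¹)^{Pⁿ}) g`. -/
noncomputable def parahoricSeq (P : Subgroup (SpecialLinearGroup (LaurentSeries k) V))
    (g : SpecialLinearGroup (LaurentSeries k) V) :
    ℕ → Subgroup (SpecialLinearGroup (LaurentSeries k) V)
  | 0 => P
  | n + 1 => conj g⁻¹ (proj (conj g (parahoricSeq P g n)) (parahoricSeq P g n))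

/-- The sequence `t` is the one attached to `(P, gPg⁻¹, gU_P)`: `J₀` is the type of `P`,
`wₙ = pos(P'ⁿ, Pⁿ)` with `P'ⁿ = gPⁿg⁻¹`, and `Jₙ₊₁ = Jₙ ∩ Ad(wₙ)Jₙ`. -/
def HasSequence {ω : ⋀[LaurentSeries k]^2 V} [Group (Weyl ω)]
    (P : Subgroup (SpecialLinearGroup (LaurentSeries k) V))
    (g : SpecialLinearGroup (LaurentSeries k) V) (t : ℕ → Set (Weyl ω) × Weyl ω) : Prop :=
  (t 0).1 = type ω P ∧
    (∀ n, (t (n + 1)).1 = (t n).1 ∩ ad (t n).2 (t n).1) ∧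
    ∀ n, IsPos (conj g (parahoricSeq P g n)) (parahoricSeq P g n) (t n).2

/-- The piece of `SL(V) / U_P` indexed by `t`. -/
def piece {ω : ⋀[LaurentSeries k]^2 V} [Group (Weyl ω)]
    (P : Subgroup (SpecialLinearGroup (LaurentSeries k) V))
    (t : ℕ → Set (Weyl ω) × Weyl ω) :
    Set (SpecialLinearGroup (LaurentSeries k) V ⧸ radical P) :=
  {x | ∃ g : SpecialLinearGroup (LaurentSeries k) V, (g : _ ⧸ radical P) = x ∧ HasSequence P g t}

/-! ### Pairs of a lattice and a volume preserving isomorphism -/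

/-- The set `Y` of pairs `(L', g)`, where `L'` is a lattice with a basis of volume `ω` and `g` is
a volume preserving isomorphism `L / εL ≃ L' / εL'`. -/
structure LatticePair (ω : ⋀[LaurentSeries k]^2 V) (L : Submodule (PowerSeries k) V) where
  lat : Submodule (PowerSeries k) V
  lat_mem : lat ∈ unimodularLattices ω
  iso : Red L ≃ₗ[k] Red lat
  map_volume : ∀ η, IsInducedVolume ω L η →
    IsInducedVolume ω lat (exteriorPower.map 2 (iso : Red L →ₗ[k] Red lat) η)

/-- `Yₙ`. -/
def layer (ω : ⋀[LaurentSeries k]^2 V) (L : Submodule (PowerSeries k) V) (n : ℕ) :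
    Set (LatticePair ω L) :=
  {y | codim L y.lat = n}

/-- `M₁` is a lattice with `M ∩ M' ⊂ M₁ ⊂ M` and `dim M / M₁ = 1`. -/
def IsFirstStep (M M' M₁ : Submodule (PowerSeries k) V) : Prop :=
  Submodule.IsLattice (LaurentSeries k) M₁ ∧ M ⊓ M' ≤ M₁ ∧ M₁ ≤ M ∧ codim M M₁ = 1

/-- The image in `M / εM` of a sublattice `M₁ ⊂ M`. -/
def lineOf (M M₁ : Submodule (PowerSeries k) V) : Set (Red M) :=
  {ξ | ∃ x : M, (x : V) ∈ M₁ ∧ Submodule.Quotient.mk x = ξ}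

/-- `Y'ₙ`. -/
def layerEq (ω : ⋀[LaurentSeries k]^2 V) (L : Submodule (PowerSeries k) V) (n : ℕ) :
    Set (LatticePair ω L) :=
  {y ∈ layer ω L n | ∃ L₁ L₂, IsFirstStep L y.lat L₁ ∧ IsFirstStep y.lat L L₂ ∧
    y.iso '' lineOf L L₁ = lineOf y.lat L₂}

/-- `Y''ₙ`. -/
def layerNe (ω : ⋀[LaurentSeries k]^2 V) (L : Submodule (PowerSeries k) V) (n : ℕ) :
    Set (LatticePair ω L) :=
  {y ∈ layer ω L n | ∃ L₁ L₂, IsFirstStep L y.lat L₁ ∧ IsFirstStep y.lat L L₂ ∧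
    y.iso '' lineOf L L₁ ≠ lineOf y.lat L₂}

end

end LoopSL2

/-!
Everything is expressed through the bases `b` of `V` of volume `ω` (`UBasis`), on which `SL(V)` acts
transitively, and through the lattices `b.lat m n` spanned by `ε^m e₀` and `ε^n e₁`. Such a basis
defines an apartment of the tree of `SL(V)`: a line whose vertices and chambers are indexed by `ℤ`.
The even vertices are those that lie in `X`, and the chamber `i` is the Iwahori subgroup that fixes
the vertices `i` and `i + 1`.

**The affine Weyl group.** By the Cartan decomposition (`exists_cartan`) and a choice of lines
(`exists_apartment`), any two Iwahori subgroups lie in a common apartment. Hence every element of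
`W'` is the position `w i` of the chamber `i` relative to the chamber `0` (`w_surjective`), and its
length is `|i|` (`len_w`). The elements `w i` and `w (-i)` are different, because the unimodular
vertex of the chamber `0` is at different distances from the chambers `i` and `-i` (`w_injective`).
So `W'` is `ℤ` as a set. The group law `wmul`, that of the infinite dihedral group acting simply
transitively on the chambers of an apartment, has the required properties: three Iwahori subgroups
whose positions have additive lengths lie in one apartment (`exists_iw_triple`). Conversely the
required properties determine all products with simple elements by induction on the length
(`mul_eq_of_isWeylGroup`). This gives `existsUnique_isWeylGroup`.

**The index set.** The type of `P` is `J = {w (-1)}`, one simple reflection. For a sequence in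
`𝒯(J)` the element `w₀` is either `1`, and then the sequence is constant, or it is `w (2n - 1)` with
`n > 0`; then `J₁ = ∅`, and `w₁ = w₂ = …` is one of `w₀ = w (2n - 1)` and `w₀ w (-1) = w (2n)`
(`mem_sequences_iff`).

**The bijection with `Y`.** Since `U_P` consists of the elements that fix `L` and act trivially on
`L / εL` (`inv_mul_mem_radical_iff`), the class `gU_P` is determined by the pair `(gL, ḡ)`. Every
pair in `Y` arises, because a matrix of determinant one over `k` is also one over `k[[ε]]`
(`Represents.exists`, `exists_equiv`).

**The pieces.** If `gL = L`, all the subgroups `Pⁿ` are equal to `P`, and the sequence is constant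
(`hasSequence_zero`). Otherwise `L` and `gL` are vertices at distance `2n > 0` of an apartment. Then
`P'¹` is the Iwahori subgroup of the line in `gL / εgL` that points towards `L` (`proj_stab`), and
all further steps are trivial, because `B^{B'} = B` for Iwahori subgroups. The position of `P'¹` and
`P¹ = g⁻¹P'¹g` is `w (2n - 1)` if the line of `P¹` in `L / εL` points towards `gL`, and `w (2n)` if
it does not (`hasSequence_pos`). The line of `P¹` is mapped to that of `P'¹` by `g`, so this
distinction is the one between `Y'ₙ` and `Y''ₙ` (`Represents.mem_layers_iff`). Therefore the pieces
are the sets `Y₀`, `Y'ₙ`, `Y''ₙ` (`bijOn_pieces`), which form a partition (`isPartition_strata`).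

**Counting.** A lattice in `X` at distance `n > 0` from `L` is given by a primitive vector of `L`
modulo `ε^(2n)` up to units, that is, by a polynomial of degree less than `2n`, or by one with
vanishing constant term (`direction`). Thus there are `q^(2n) + q^(2n-1)` of them. Over each lattice
lies one copy of `SL₂(k)` (`exists_layer_coordinates`), in which `Y'ₙ` is given by the vanishing of
an entry of the matrix. There are `q(q - 1)` such matrices (`ncard_sl_zero`), and `q²(q - 1)` others
(`ncard_sl_ne`).

Finally `SL(V)` is its own derived group because `k((ε))` contains the element `ε`, which is not `0`
and whose square is not `1` (`commutator_eq_top`).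
-/

open scoped LaurentSeries PowerSeries

namespace LoopSL2

set_option linter.unusedSectionVars false

/-! ### Fractional ideals of `k[[ε]]` -/

section Series

variable {k : Type*} [Field k]

instance isScalarTower_laurentSeries : IsScalarTower k k⟦X⟧ k⸨X⸩ where
  smul_assoc c p x := by
    rw [PowerSeries.smul_eq_C_mul, Algebra.smul_def, Algebra.smul_def,
      LaurentSeries.coe_algebraMap, map_mul, HahnSeries.ofPowerSeries_C, mul_assoc,
      HahnSeries.C_mul_eq_smul]

/-- The fractional ideal `ε^m k[[ε]]` of `k((ε))`. -/
def fil (k : Type*) [Field k] (m : ℤ) : Submodule k⟦X⟧ k⸨X⸩ where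
  carrier := {c | (m : WithTop ℤ) ≤ c.orderTop}
  zero_mem' := by simp
  add_mem' := by
    intro a b ha hb
    have ha' : (m : WithTop ℤ) ≤ a.orderTop := ha
    have hb' : (m : WithTop ℤ) ≤ b.orderTop := hb
    exact (le_min ha' hb').trans HahnSeries.min_orderTop_le_orderTop_add
  smul_mem' := by
    intro c x hx
    have h0 : (0 : WithTop ℤ) ≤ (HahnSeries.ofPowerSeries ℤ k c).orderTop := by
      rw [HahnSeries.le_orderTop_iff_forall]
      intro j hj
      have hj' : j < 0 := by exact_mod_cast hj
      rw [HahnSeries.ofPowerSeries_apply, HahnSeries.embDomain_of_notMem_range]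
      rintro ⟨n, hn⟩
      have : (n : ℤ) = j := hn
      omega
    change (m : WithTop ℤ) ≤ (c • x).orderTop
    rw [Algebra.smul_def, LaurentSeries.coe_algebraMap, HahnSeries.orderTop_mul]
    exact le_add_of_nonneg_of_le h0 hx

theorem mem_fil_iff {m : ℤ} {c : k⸨X⸩} : c ∈ fil k m ↔ ∀ i < m, c.coeff i = 0 := by
  change (m : WithTop ℤ) ≤ c.orderTop ↔ _
  rw [HahnSeries.le_orderTop_iff_forall]
  simp

theorem mem_fil_iff_orderTop {m : ℤ} {c : k⸨X⸩} :
    c ∈ fil k m ↔ (m : WithTop ℤ) ≤ c.orderTop := Iff.rfl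

theorem fil_mono {m n : ℤ} (h : m ≤ n) {c : k⸨X⸩} (hc : c ∈ fil k n) : c ∈ fil k m := by
  rw [mem_fil_iff] at *
  exact fun i hi => hc i (hi.trans_le h)

theorem mul_mem_fil {m n l : ℤ} {c d : k⸨X⸩} (hc : c ∈ fil k m) (hd : d ∈ fil k n)
    (h : l ≤ m + n) : c * d ∈ fil k l := by
  refine fil_mono h ?_
  rw [mem_fil_iff_orderTop] at *
  rw [HahnSeries.orderTop_mul]
  push_cast
  exact add_le_add hc hd

theorem one_mem_fil {m : ℤ} : (1 : k⸨X⸩) ∈ fil k m ↔ m ≤ 0 := by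
  rw [mem_fil_iff_orderTop, HahnSeries.orderTop_one]
  exact_mod_cast Iff.rfl

/-- The fractional ideal `ε^0 k[[ε]]` is the ring of power series. -/
theorem mem_fil_zero_iff {c : k⸨X⸩} :
    c ∈ fil k 0 ↔ ∃ p : k⟦X⟧, algebraMap k⟦X⟧ k⸨X⸩ p = c := by
  constructor
  · intro hc
    refine ⟨PowerSeries.mk fun n => c.coeff n, ?_⟩
    ext j
    rw [LaurentSeries.coe_algebraMap]
    rcases lt_or_ge j 0 with hj | hj
    · rw [mem_fil_iff.1 hc j hj, HahnSeries.ofPowerSeries_apply,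
        HahnSeries.embDomain_of_notMem_range]
      rintro ⟨n, hn⟩
      have : (n : ℤ) = j := hn
      omega
    · lift j to ℕ using hj
      rw [HahnSeries.ofPowerSeries_apply_coeff, PowerSeries.coeff_mk]
  · rintro ⟨p, rfl⟩
    have := (fil k 0).smul_mem p (one_mem_fil.2 le_rfl)
    rwa [Algebra.smul_def, mul_one] at this

/-- The power `ε^m`. -/
noncomputable def tpow (k : Type*) [Field k] (m : ℤ) : k⸨X⸩ := HahnSeries.single m 1

theorem tpow_add (m n : ℤ) : tpow k (m + n) = tpow k m * tpow k n := by
  simp [tpow, HahnSeries.single_mul_single]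

theorem tpow_zero : tpow k 0 = 1 := rfl

theorem tpow_mul_neg (m : ℤ) : tpow k m * tpow k (-m) = 1 := by
  rw [← tpow_add, add_neg_cancel, tpow_zero]

theorem tpow_ne_zero (m : ℤ) : tpow k m ≠ 0 := by
  intro h
  have := tpow_mul_neg (k := k) m
  rw [h, zero_mul] at this
  exact zero_ne_one this

theorem tpow_mem_fil {m n : ℤ} : tpow k m ∈ fil k n ↔ n ≤ m := by
  rw [mem_fil_iff_orderTop, tpow, HahnSeries.orderTop_single one_ne_zero]
  exact_mod_cast Iff.rfl

theorem tpow_mul_mem_fil {m n : ℤ} {c : k⸨X⸩} :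
    tpow k m * c ∈ fil k n ↔ c ∈ fil k (n - m) := by
  constructor
  · intro h
    have h2 := mul_mem_fil (l := n - m) (tpow_mem_fil (k := k) (m := -m).2 le_rfl) h (by omega)
    rwa [← mul_assoc, mul_comm (tpow k (-m)), tpow_mul_neg, one_mul] at h2
  · intro h
    exact mul_mem_fil (tpow_mem_fil.2 le_rfl) h (by omega)

theorem algebraMap_X : algebraMap k⟦X⟧ k⸨X⸩ PowerSeries.X = tpow k 1 :=
  HahnSeries.ofPowerSeries_X

theorem C_mem_fil (a : k) : HahnSeries.C a ∈ fil k 0 := by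
  rw [mem_fil_iff]
  intro i hi
  rw [HahnSeries.C_apply, HahnSeries.coeff_single_of_ne hi.ne]

/-- Every nonzero Laurent series has a well-defined order. -/
theorem exists_order {c : k⸨X⸩} (hc : c ≠ 0) : ∃ m, ∀ j, ((c ∈ fil k j ↔ j ≤ m) ∧
    (c⁻¹ ∈ fil k j ↔ j ≤ -m)) := by
  refine ⟨c.order, fun j => ?_⟩
  have h1 : c.orderTop = (c.order : WithTop ℤ) := (HahnSeries.order_eq_orderTop_of_ne_zero hc).symm
  have h2 : c⁻¹.orderTop = ((c⁻¹).order : WithTop ℤ) :=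
    (HahnSeries.order_eq_orderTop_of_ne_zero (inv_ne_zero hc)).symm
  have h3 : c.orderTop + c⁻¹.orderTop = 0 := by
    rw [← HahnSeries.orderTop_mul, mul_inv_cancel₀ hc, HahnSeries.orderTop_one]
  rw [h1, h2] at h3
  have h4 : c.order + (c⁻¹).order = 0 := by exact_mod_cast h3
  rw [mem_fil_iff_orderTop, mem_fil_iff_orderTop, h1, h2]
  constructor
  · exact_mod_cast Iff.rfl
  · rw [show -c.order = (c⁻¹).order by omega]
    exact_mod_cast Iff.rfl

theorem mem_fil_succ_iff {m : ℤ} {c : k⸨X⸩} :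
    c ∈ fil k (m + 1) ↔ c ∈ fil k m ∧ c.coeff m = 0 := by
  simp only [mem_fil_iff]
  constructor
  · exact fun h => ⟨fun i hi => h i (by omega), h m (by omega)⟩
  · rintro ⟨h1, h2⟩ i hi
    rcases eq_or_lt_of_le (Int.lt_add_one_iff.1 hi) with rfl | h
    exacts [h2, h1 i h]

theorem mem_fil_one_iff {c : k⸨X⸩} : c ∈ fil k 1 ↔ c ∈ fil k 0 ∧ c.coeff 0 = 0 :=
  mem_fil_succ_iff (m := 0)

/-- An integral element outside the maximal ideal is a unit. -/
theorem inv_mem_fil_of_not_mem {m : ℤ} {c : k⸨X⸩} (h1 : c ∉ fil k (m + 1)) :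
    c⁻¹ ∈ fil k (-m) := by
  have hc : c ≠ 0 := by rintro rfl; exact h1 (zero_mem _)
  obtain ⟨n, hn⟩ := exists_order hc
  rw [(hn _).1] at h1
  rw [(hn _).2]
  omega

theorem coeff_zero_mul {c d : k⸨X⸩} (hc : c ∈ fil k 0) (hd : d ∈ fil k 0) :
    (c * d).coeff 0 = c.coeff 0 * d.coeff 0 := by
  obtain ⟨p, rfl⟩ := mem_fil_zero_iff.1 hc
  obtain ⟨q, rfl⟩ := mem_fil_zero_iff.1 hd
  rw [← map_mul]
  have h : ∀ p : k⟦X⟧, (algebraMap k⟦X⟧ k⸨X⸩ p).coeff 0 = PowerSeries.coeff 0 p := fun p =>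
    HahnSeries.ofPowerSeries_apply_coeff p 0
  rw [h, h, h]
  simp

/-- The Laurent polynomial `∑ᵢ uᵢ ε^{a+i}`. -/
noncomputable def ofFun (a : ℤ) {n : ℕ} (u : Fin n → k) : k⸨X⸩ :=
  ∑ i : Fin n, HahnSeries.single (a + (i : ℕ)) (u i)

theorem coeff_ofFun (a : ℤ) {n : ℕ} (u : Fin n → k) (i : Fin n) :
    (ofFun a u).coeff (a + (i : ℕ)) = u i := by
  rw [ofFun, HahnSeries.coeff_sum, Finset.sum_eq_single i]
  · simp
  · intro j _ hj
    rw [HahnSeries.coeff_single_of_ne]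
    intro h
    exact hj (Fin.ext (by omega))
  · simp

theorem ofFun_mem_fil (a : ℤ) {n : ℕ} (u : Fin n → k) : ofFun a u ∈ fil k a := by
  refine Submodule.sum_mem _ fun i _ => ?_
  rw [mem_fil_iff]
  intro j hj
  rw [HahnSeries.coeff_single_of_ne (by omega)]

/-- Truncation: the coefficients of index `a, …, a + n - 1`. -/
def window (a : ℤ) (n : ℕ) : k⸨X⸩ →ₗ[k] (Fin n → k) where
  toFun c i := c.coeff (a + (i : ℕ))
  map_add' _ _ := rfl
  map_smul' _ _ := rfl

theorem window_ofFun (a : ℤ) {n : ℕ} (u : Fin n → k) : window a n (ofFun a u) = u :=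
  funext fun i => coeff_ofFun a u i

theorem window_eq_zero_iff {a : ℤ} {n : ℕ} {c : k⸨X⸩} (hc : c ∈ fil k a) :
    window a n c = 0 ↔ c ∈ fil k (a + n) := by
  rw [mem_fil_iff] at *
  constructor
  · intro h i hi
    rcases lt_or_ge i a with h1 | h1
    · exact hc i h1
    · have := congrFun h ⟨(i - a).toNat, by omega⟩
      simpa [window, show a + max (i - a) 0 = i by omega] using this
  · intro h
    ext i
    exact h _ (by have := i.2; omega)

/-- A quotient cut out by `n` consecutive coefficients has dimension `n`. -/
theorem finrank_quotient_of_fil {E : Type*} [AddCommGroup E] [Module k E] (S : Submodule k E)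
    (f : E →ₗ[k] k⸨X⸩) (a : ℤ) (n : ℕ) (hf : ∀ x, f x ∈ fil k a)
    (hs : ∀ c ∈ fil k a, ∃ x, f x = c) (hS : ∀ x, x ∈ S ↔ f x ∈ fil k (a + n)) :
    Module.finrank k (E ⧸ S) = n := by
  have hker : LinearMap.ker ((window a n).comp f) = S := by
    ext x
    rw [LinearMap.mem_ker, LinearMap.comp_apply, window_eq_zero_iff (hf x), hS]
  have hsurj : Function.Surjective ((window a n).comp f) := by
    intro u
    obtain ⟨x, hx⟩ := hs _ (ofFun_mem_fil a u)
    exact ⟨x, by rw [LinearMap.comp_apply, hx, window_ofFun]⟩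
  rw [← hker, (LinearMap.quotKerEquivOfSurjective _ hsurj).finrank_eq, Module.finrank_fin_fun]

end Series

/-! ### Exterior squares -/

section Wedge

variable {R M : Type*} [CommRing R] [AddCommGroup M] [Module R M]

theorem iMulti_pair (x y : M) (v : Fin 2 → M) (h0 : v 0 = x) (h1 : v 1 = y) :
    exteriorPower.ιMulti R 2 v = exteriorPower.ιMulti R 2 ![x, y] := by
  congr 1
  ext i
  fin_cases i
  · exact h0
  · exact h1

theorem wedge_swap (x y : M) :
    exteriorPower.ιMulti R 2 ![y, x] = - exteriorPower.ιMulti R 2 ![x, y] := by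
  have := (exteriorPower.ιMulti R 2 (M := M)).map_swap ![x, y] (i := 0) (j := 1) (by decide)
  rw [← this]
  congr 1
  ext i
  fin_cases i <;> rfl

theorem wedge_self (x : M) : exteriorPower.ιMulti R 2 ![x, x] = 0 :=
  (exteriorPower.ιMulti R 2 (M := M)).map_eq_zero_of_eq ![x, x] (i := 0) (j := 1) rfl (by decide)

theorem update_pair (x y z : M) : Function.update ![x, y] 0 z = ![z, y] := by
  ext i
  fin_cases i <;> simp

theorem wedge_add_left (x x' y : M) : exteriorPower.ιMulti R 2 ![x + x', y] =
    exteriorPower.ιMulti R 2 ![x, y] + exteriorPower.ιMulti R 2 ![x', y] := by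
  have := (exteriorPower.ιMulti R 2 (M := M)).map_update_add ![0, y] 0 x x'
  rwa [update_pair, update_pair, update_pair] at this

theorem wedge_smul_left (a : R) (x y : M) : exteriorPower.ιMulti R 2 ![a • x, y] =
    a • exteriorPower.ιMulti R 2 ![x, y] := by
  have := (exteriorPower.ιMulti R 2 (M := M)).map_update_smul ![0, y] 0 a x
  rwa [update_pair, update_pair] at this

/-- The wedge product of two combinations of `x` and `y` is a multiple of `x ∧ y` by the determinant
of the coefficients. -/
theorem wedge_comb (x y : M) (p q r s : R) :
    exteriorPower.ιMulti R 2 ![p • x + q • y, r • x + s • y] =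
      (p * s - q * r) • exteriorPower.ιMulti R 2 ![x, y] := by
  have h1 : ∀ z : M, exteriorPower.ιMulti R 2 ![z, r • x + s • y] =
      r • exteriorPower.ιMulti R 2 ![z, x] + s • exteriorPower.ιMulti R 2 ![z, y] := by
    intro z
    rw [wedge_swap, wedge_add_left, wedge_smul_left, wedge_smul_left, wedge_swap z x,
      wedge_swap z y]
    module
  rw [wedge_add_left, wedge_smul_left, wedge_smul_left, h1, h1, wedge_self, wedge_self,
    wedge_swap x y]
  module

/-- The wedge product of the two vectors of a basis is nonzero. -/
theorem wedge_basis_smul_eq [Nontrivial R] (b : Module.Basis (Fin 2) R M) {a c : R}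
    (h : a • exteriorPower.ιMulti R 2 (fun i => b i) = c • exteriorPower.ιMulti R 2 (fun i => b i)) :
    a = c := by
  have h2 := congrArg (exteriorPower.alternatingMapLinearEquiv b.det) h
  rw [map_smul, map_smul, exteriorPower.alternatingMapLinearEquiv_apply_ιMulti] at h2
  have h3 : b.det (fun i => b i) = 1 := b.det_self
  rw [h3] at h2
  simpa using h2

end Wedge

/-! ### Bases of volume `ω` and the lattices they span -/

section

variable {k : Type*} [Field k] {V : Type*} [AddCommGroup V] [Module k V]
  [Module (PowerSeries k) V] [Module (LaurentSeries k) V]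
  [IsScalarTower k (PowerSeries k) V] [IsScalarTower (PowerSeries k) (LaurentSeries k) V]

instance isScalarTower_field : IsScalarTower k k⸨X⸩ V where
  smul_assoc c x v := by
    rw [← IsScalarTower.algebraMap_smul k⟦X⟧ c x, ← IsScalarTower.algebraMap_smul k⟦X⟧ c (x • v),
      smul_assoc]

theorem field_smul_eq (c : k) (v : V) : c • v = (HahnSeries.C c : k⸨X⸩) • v := by
  rw [← one_smul k⸨X⸩ v, ← smul_assoc, smul_smul, mul_one, ← HahnSeries.C_mul_eq_smul, mul_one]

/-- A basis of `V` over `k((ε))` whose two vectors have wedge product `ω`. -/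
structure UBasis (ω : ⋀[LaurentSeries k]^2 V) where
  toBasis : Module.Basis (Fin 2) k⸨X⸩ V
  vol : exteriorPower.ιMulti k⸨X⸩ 2 (fun i => toBasis i) = ω

namespace UBasis

variable {ω : ⋀[LaurentSeries k]^2 V}

/-- The first basis vector. -/
noncomputable def e0 (b : UBasis ω) : V := b.toBasis 0
/-- The second basis vector. -/
noncomputable def e1 (b : UBasis ω) : V := b.toBasis 1
/-- The first coordinate. -/
noncomputable def x (b : UBasis ω) : V →ₗ[k⸨X⸩] k⸨X⸩ := b.toBasis.coord 0
/-- The second coordinate. -/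
noncomputable def y (b : UBasis ω) : V →ₗ[k⸨X⸩] k⸨X⸩ := b.toBasis.coord 1

variable (b c : UBasis ω)

@[simp] theorem x_e0 : b.x b.e0 = 1 := by simp [x, e0]
@[simp] theorem x_e1 : b.x b.e1 = 0 := by simp [x, e1]
@[simp] theorem y_e0 : b.y b.e0 = 0 := by simp [y, e0]
@[simp] theorem y_e1 : b.y b.e1 = 1 := by simp [y, e1]

theorem eta (v : V) : b.x v • b.e0 + b.y v • b.e1 = v := by
  conv_rhs => rw [← b.toBasis.sum_repr v, Fin.sum_univ_two]
  rfl

theorem ext_coord {v w : V} (hx : b.x v = b.x w) (hy : b.y v = b.y w) : v = w := by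
  rw [← b.eta v, ← b.eta w, hx, hy]

theorem vol' : exteriorPower.ιMulti k⸨X⸩ 2 ![b.e0, b.e1] = ω := by
  rw [← iMulti_pair b.e0 b.e1 _ rfl rfl]
  exact b.vol

theorem smul_vol (b : UBasis ω) {a a' : k⸨X⸩} (h : a • ω = a' • ω) : a = a' := by
  refine wedge_basis_smul_eq b.toBasis ?_
  rw [b.vol]
  exact h

theorem wedge_eq (v w : V) :
    exteriorPower.ιMulti k⸨X⸩ 2 ![v, w] = (b.x v * b.y w - b.y v * b.x w) • ω := by
  conv_lhs => rw [← b.eta v, ← b.eta w, wedge_comb, b.vol']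

/-- The change of basis between two bases of volume `ω` has determinant one. -/
theorem det_eq : b.x c.e0 * b.y c.e1 - b.y c.e0 * b.x c.e1 = 1 := by
  refine b.smul_vol ?_
  rw [← b.wedge_eq, c.vol', one_smul]

/-- Change of coordinates: since the change of basis from `b` to `c` has determinant one, its
inverse is the adjugate. -/
theorem x_change (v : V) : c.x v = b.y c.e1 * b.x v - b.x c.e1 * b.y v := by
  have hd := b.det_eq c
  have h1 := congrArg b.x (c.eta v)
  have h2 := congrArg b.y (c.eta v)
  simp only [map_add, map_smul, smul_eq_mul] at h1 h2
  rw [← h1, ← h2]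
  linear_combination (-c.x v) * hd

theorem y_change (v : V) : c.y v = b.x c.e0 * b.y v - b.y c.e0 * b.x v := by
  have hd := b.det_eq c
  have h1 := congrArg b.x (c.eta v)
  have h2 := congrArg b.y (c.eta v)
  simp only [map_add, map_smul, smul_eq_mul] at h1 h2
  rw [← h1, ← h2]
  linear_combination (-c.y v) * hd

/-- Two vectors with wedge product `ω` are the vectors of a basis. -/
theorem exists_of_wedge (hV : Module.finrank k⸨X⸩ V = 2) (hω : ω ≠ 0) (v w : V)
    (h : exteriorPower.ιMulti k⸨X⸩ 2 ![v, w] = ω) : ∃ c : UBasis ω, c.e0 = v ∧ c.e1 = w := by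
  have hli : LinearIndependent k⸨X⸩ ![v, w] := by
    by_contra hn
    exact hω (h ▸ AlternatingMap.map_linearDependent _ _ hn)
  refine ⟨⟨basisOfLinearIndependentOfCardEqFinrank hli (by simp [hV]), ?_⟩, ?_, ?_⟩
  · simp only [coe_basisOfLinearIndependentOfCardEqFinrank]
    exact h
  · simp [e0]
  · simp [e1]

theorem finrank_eq (b : UBasis ω) : Module.finrank k⸨X⸩ V = 2 := by
  rw [Module.finrank_eq_card_basis b.toBasis, Fintype.card_fin]

theorem vol_ne_zero (b : UBasis ω) : ω ≠ 0 := by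
  intro h
  have := b.smul_vol (a := 1) (a' := 0) (by rw [h, smul_zero, smul_zero])
  exact one_ne_zero this

theorem exists_of_coeffs (p q r s : k⸨X⸩) (h : p * s - q * r = 1) : ∃ c : UBasis ω,
    c.e0 = p • b.e0 + q • b.e1 ∧ c.e1 = r • b.e0 + s • b.e1 :=
  exists_of_wedge b.finrank_eq b.vol_ne_zero _ _ (by rw [wedge_comb, h, one_smul, b.vol'])

/-- The basis with the given coordinates in terms of `b`. -/
noncomputable def ofCoeffs (p q r s : k⸨X⸩) (h : p * s - q * r = 1) : UBasis ω :=
  (b.exists_of_coeffs p q r s h).choose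

section
variable {p q r s : k⸨X⸩} {h : p * s - q * r = 1}
theorem ofCoeffs_e0 : (b.ofCoeffs p q r s h).e0 = p • b.e0 + q • b.e1 :=
  (b.exists_of_coeffs p q r s h).choose_spec.1
theorem ofCoeffs_e1 : (b.ofCoeffs p q r s h).e1 = r • b.e0 + s • b.e1 :=
  (b.exists_of_coeffs p q r s h).choose_spec.2
@[simp] theorem x_ofCoeffs_e0 : b.x (b.ofCoeffs p q r s h).e0 = p := by simp [ofCoeffs_e0]
@[simp] theorem y_ofCoeffs_e0 : b.y (b.ofCoeffs p q r s h).e0 = q := by simp [ofCoeffs_e0]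
@[simp] theorem x_ofCoeffs_e1 : b.x (b.ofCoeffs p q r s h).e1 = r := by simp [ofCoeffs_e1]
@[simp] theorem y_ofCoeffs_e1 : b.y (b.ofCoeffs p q r s h).e1 = s := by simp [ofCoeffs_e1]
end

theorem ext_vec {b c : UBasis ω} (h0 : b.e0 = c.e0) (h1 : b.e1 = c.e1) : b = c := by
  have : b.toBasis = c.toBasis := by
    refine Module.Basis.eq_of_apply_eq fun i => ?_
    fin_cases i
    · exact h0
    · exact h1
  cases b
  cases c
  simp only at this
  subst this
  rfl

theorem det_eq_coeffs (g : V →ₗ[k⸨X⸩] V) :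
    LinearMap.det g = b.x (g b.e0) * b.y (g b.e1) - b.y (g b.e0) * b.x (g b.e1) := by
  rw [← LinearMap.det_toMatrix b.toBasis, Matrix.det_fin_two]
  simp only [LinearMap.toMatrix_apply]
  change b.x (g b.e0) * b.y (g b.e1) - b.x (g b.e1) * b.y (g b.e0) = _
  ring

/-- `SL(V)` preserves wedge products of pairs of vectors. -/
theorem wedge_map (b : UBasis ω) (g : SpecialLinearGroup k⸨X⸩ V) (v w : V) :
    exteriorPower.ιMulti k⸨X⸩ 2 ![g.1 v, g.1 w] = exteriorPower.ιMulti k⸨X⸩ 2 ![v, w] := by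
  have hd := b.det_eq_coeffs (g.1 : V →ₗ[k⸨X⸩] V)
  rw [g.det_eq_one] at hd
  simp only [LinearEquiv.coe_coe] at hd
  have h : ∀ v, g.1 v = b.x v • g.1 b.e0 + b.y v • g.1 b.e1 := fun v => by
    conv_lhs => rw [← b.eta v, map_add, map_smul, map_smul]
  rw [h v, h w, wedge_comb, b.wedge_eq, ← hd, one_smul, b.wedge_eq]

/-- The translate of a basis by an element of `SL(V)`. -/
noncomputable def map (g : SpecialLinearGroup k⸨X⸩ V) : UBasis ω where
  toBasis := b.toBasis.map g.1
  vol := by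
    rw [iMulti_pair (g.1 b.e0) (g.1 b.e1) _ (by simp [e0]) (by simp [e1]), b.wedge_map, b.vol']

@[simp] theorem map_e0 (g : SpecialLinearGroup k⸨X⸩ V) : (b.map g).e0 = g.1 b.e0 := by
  simp [map, e0]
@[simp] theorem map_e1 (g : SpecialLinearGroup k⸨X⸩ V) : (b.map g).e1 = g.1 b.e1 := by
  simp [map, e1]
@[simp] theorem map_x (g : SpecialLinearGroup k⸨X⸩ V) (v : V) : (b.map g).x (g.1 v) = b.x v := by
  simp [map, x]
@[simp] theorem map_y (g : SpecialLinearGroup k⸨X⸩ V) (v : V) : (b.map g).y (g.1 v) = b.y v := by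
  simp [map, y]

/-- `SL(V)` acts transitively on the bases of volume `ω`. -/
theorem exists_map_eq : ∃ g : SpecialLinearGroup k⸨X⸩ V, b.map g = c := by
  let g : V ≃ₗ[k⸨X⸩] V := b.toBasis.equiv c.toBasis (Equiv.refl _)
  have h0 : g b.e0 = c.e0 := by simp [g, e0]
  have h1 : g b.e1 = c.e1 := by simp [g, e1]
  have hg : LinearEquiv.det g = 1 := by
    rw [← Units.val_inj, LinearEquiv.coe_det, b.det_eq_coeffs]
    simp only [LinearEquiv.coe_coe, h0, h1]
    exact b.det_eq c
  exact ⟨⟨g, hg⟩, ext_vec (by rw [map_e0]; exact h0) (by rw [map_e1]; exact h1)⟩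

/-- The lattice spanned by `ε^m e₀` and `ε^n e₁`, described by the orders of the coordinates. -/
noncomputable def lat (m n : ℤ) : Submodule k⟦X⟧ V :=
  (fil k m).comap (b.x.restrictScalars k⟦X⟧) ⊓ (fil k n).comap (b.y.restrictScalars k⟦X⟧)

variable {b c} {m n m' n' : ℤ}

theorem mem_lat {v : V} : v ∈ b.lat m n ↔ b.x v ∈ fil k m ∧ b.y v ∈ fil k n := Iff.rfl

theorem tpow_e0_mem : tpow k m • b.e0 ∈ b.lat m n := by
  simp [mem_lat, tpow_mem_fil]

theorem tpow_e1_mem : tpow k n • b.e1 ∈ b.lat m n := by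
  simp [mem_lat, tpow_mem_fil]

theorem lat_le_iff : c.lat m n ≤ b.lat m' n' ↔
    (b.x c.e0 ∈ fil k (m' - m) ∧ b.y c.e0 ∈ fil k (n' - m)) ∧
    (b.x c.e1 ∈ fil k (m' - n) ∧ b.y c.e1 ∈ fil k (n' - n)) := by
  constructor
  · intro h
    have h0 := h (tpow_e0_mem (b := c) (m := m) (n := n))
    have h1 := h (tpow_e1_mem (b := c) (m := m) (n := n))
    simpa [mem_lat, tpow_mul_mem_fil] using And.intro h0 h1
  · rintro ⟨⟨h1, h2⟩, h3, h4⟩ v ⟨hx, hy⟩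
    have hx : c.x v ∈ fil k m := hx
    have hy : c.y v ∈ fil k n := hy
    rw [mem_lat, ← c.eta v]
    simp only [map_add, map_smul, smul_eq_mul]
    exact ⟨add_mem (mul_mem_fil hx h1 (by omega)) (mul_mem_fil hy h3 (by omega)),
      add_mem (mul_mem_fil hx h2 (by omega)) (mul_mem_fil hy h4 (by omega))⟩

/-- An inclusion of lattices of the same volume is an equality. -/
theorem lat_eq_iff (hs : m + n = m' + n') : c.lat m n = b.lat m' n' ↔
    (b.x c.e0 ∈ fil k (m' - m) ∧ b.y c.e0 ∈ fil k (n' - m)) ∧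
    (b.x c.e1 ∈ fil k (m' - n) ∧ b.y c.e1 ∈ fil k (n' - n)) := by
  rw [← lat_le_iff]
  refine ⟨fun h => h.le, fun h => le_antisymm h ?_⟩
  obtain ⟨⟨h1, h2⟩, h3, h4⟩ := lat_le_iff.1 h
  rw [lat_le_iff, b.x_change c, b.y_change c, b.x_change c, b.y_change c]
  simp only [x_e0, y_e0, x_e1, y_e1, mul_one, mul_zero, sub_zero, zero_sub]
  exact ⟨⟨fil_mono (by omega) h4, neg_mem (fil_mono (by omega) h2)⟩,
    neg_mem (fil_mono (by omega) h3), fil_mono (by omega) h1⟩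

theorem lat_le_lat_iff : b.lat m n ≤ b.lat m' n' ↔ m' ≤ m ∧ n' ≤ n := by
  rw [lat_le_iff]
  simp [one_mem_fil, zero_mem]

theorem lat_inj : b.lat m n = b.lat m' n' ↔ m = m' ∧ n = n' := by
  constructor
  · intro h
    have h1 := lat_le_lat_iff.1 h.le
    have h2 := lat_le_lat_iff.1 h.ge
    omega
  · rintro ⟨rfl, rfl⟩
    rfl

theorem lat_inf : b.lat m n ⊓ b.lat m' n' = b.lat (max m m') (max n n') := by
  have key : ∀ (i j : ℤ) (c : k⸨X⸩), c ∈ fil k (max i j) ↔ c ∈ fil k i ∧ c ∈ fil k j := by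
    intro i j c
    constructor
    · exact fun h => ⟨fil_mono (le_max_left _ _) h, fil_mono (le_max_right _ _) h⟩
    · rintro ⟨h1, h2⟩
      rcases max_choice i j with h | h <;> rw [h] <;> assumption
  ext v
  simp only [Submodule.mem_inf, mem_lat, key]
  tauto

theorem translate_lat (g : SpecialLinearGroup k⸨X⸩ V) :
    translate g (b.lat m n) = (b.map g).lat m n := by
  ext v
  rw [mem_translate]
  constructor
  · rintro ⟨w, hw, rfl⟩
    rw [mem_lat, map_x, map_y]
    exact hw
  · intro hv
    obtain ⟨w, rfl⟩ := g.1.surjective v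
    rw [mem_lat, map_x, map_y] at hv
    exact ⟨w, hv, rfl⟩

theorem mem_stab_lat {g : SpecialLinearGroup k⸨X⸩ V} : g ∈ stab (b.lat m n) ↔
    (b.x (g.1 b.e0) ∈ fil k 0 ∧ b.y (g.1 b.e0) ∈ fil k (n - m)) ∧
    (b.x (g.1 b.e1) ∈ fil k (m - n) ∧ b.y (g.1 b.e1) ∈ fil k 0) := by
  change translate g (b.lat m n) = b.lat m n ↔ _
  rw [translate_lat, lat_eq_iff rfl, map_e0, map_e1, sub_self, sub_self]

theorem epsMul_lat : epsMul (b.lat m n) = b.lat (m + 1) (n + 1) := by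
  ext v
  constructor
  · rintro ⟨w, hw, rfl⟩
    have hw : w ∈ b.lat m n := hw
    change (PowerSeries.X : k⟦X⟧) • w ∈ _
    rw [← IsScalarTower.algebraMap_smul k⸨X⸩, algebraMap_X]
    rw [mem_lat, map_smul, map_smul, smul_eq_mul, smul_eq_mul, tpow_mul_mem_fil, tpow_mul_mem_fil,
      add_sub_cancel_right, add_sub_cancel_right]
    exact hw
  · intro hv
    refine ⟨tpow k (-1) • v, ?_, ?_⟩
    · change _ ∈ b.lat m n
      rw [mem_lat, map_smul, map_smul, smul_eq_mul, smul_eq_mul, tpow_mul_mem_fil,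
        tpow_mul_mem_fil]
      exact hv
    · change (PowerSeries.X : k⟦X⟧) • tpow k (-1) • v = v
      rw [← IsScalarTower.algebraMap_smul k⸨X⸩, algebraMap_X, smul_smul, tpow_mul_neg, one_smul]

end UBasis

end

/-! ### Lattices and coordinates -/

section

variable {k : Type*} [Field k]

/-- Every nonzero fractional ideal of `k[[ε]]` is a power of `ε`. -/
theorem exists_eq_fil (I : Submodule k⟦X⟧ k⸨X⸩) (N : ℤ) (hI : I ≤ fil k N)
    (hne : ∃ c ∈ I, c ≠ 0) : ∃ p, I = fil k p := by
  -- an element of order at most `m` in `I` divides everything in `ε^m k[[ε]]`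
  have key : ∀ c ∈ I, ∀ m, c ∉ fil k (m + 1) → fil k m ≤ I := by
    intro c hc m hm d hd
    obtain ⟨p, hp⟩ := mem_fil_zero_iff.1
      (mul_mem_fil (l := 0) hd (inv_mem_fil_of_not_mem hm) (by omega))
    have hc0 : c ≠ 0 := by rintro rfl; exact hm (zero_mem _)
    have h1 := I.smul_mem p hc
    rwa [Algebra.smul_def, hp, inv_mul_cancel_right₀ hc0] at h1
  obtain ⟨c₀, hc₀, hc₀'⟩ := hne
  obtain ⟨m₀, hm₀⟩ := exists_order hc₀'
  obtain ⟨p, ⟨c, hcI, hcp⟩, hmin⟩ := Int.exists_least_of_bdd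
    (P := fun m => ∃ c ∈ I, c ∉ fil k (m + 1))
    ⟨N, fun z ⟨c, hc, hcz⟩ => by
      by_contra hlt
      exact hcz (fil_mono (by omega) (hI hc))⟩
    ⟨m₀, c₀, hc₀, by rw [(hm₀ _).1]; omega⟩
  refine ⟨p, le_antisymm (fun d hd => ?_) (key c hcI p hcp)⟩
  by_contra hdp
  have := hmin (p - 1) ⟨d, hd, by rwa [sub_add_cancel]⟩
  omega

variable {V : Type*} [AddCommGroup V] [Module k V]
  [Module (PowerSeries k) V] [Module (LaurentSeries k) V]
  [IsScalarTower k (PowerSeries k) V] [IsScalarTower (PowerSeries k) (LaurentSeries k) V]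
  {ω : ⋀[LaurentSeries k]^2 V}

namespace UBasis

variable (b c : UBasis ω)

/-- The element of `SL(V)` with the given matrix in the basis `b`. -/
noncomputable def elt (p q r s : k⸨X⸩) (h : p * s - q * r = 1) : SpecialLinearGroup k⸨X⸩ V :=
  (b.exists_map_eq (b.ofCoeffs p q r s h)).choose

section
variable {p q r s : k⸨X⸩} {h : p * s - q * r = 1}
@[simp] theorem elt_e0 : (b.elt p q r s h).1 b.e0 = p • b.e0 + q • b.e1 := by
  rw [← map_e0, elt, (b.exists_map_eq (b.ofCoeffs p q r s h)).choose_spec, ofCoeffs_e0]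
@[simp] theorem elt_e1 : (b.elt p q r s h).1 b.e1 = r • b.e0 + s • b.e1 := by
  rw [← map_e1, elt, (b.exists_map_eq (b.ofCoeffs p q r s h)).choose_spec, ofCoeffs_e1]
end

variable {b c} {m n m' n' : ℤ}

/-- Inclusions of lattices do not increase the volume, by multiplicativity of the determinant. -/
theorem add_le_of_lat_le (h : c.lat m n ≤ b.lat m' n') : m' + n' ≤ m + n := by
  obtain ⟨⟨h1, h2⟩, h3, h4⟩ := lat_le_iff.1 h
  have h5 := sub_mem (mul_mem_fil (l := m' + n' - m - n) h1 h4 (by omega))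
    (mul_mem_fil (l := m' + n' - m - n) h2 h3 (by omega))
  rw [b.det_eq, one_mem_fil] at h5
  omega

theorem add_eq_of_lat_eq (h : c.lat m n = b.lat m' n') : m + n = m' + n' :=
  le_antisymm (add_le_of_lat_le h.ge) (add_le_of_lat_le h.le)

theorem lat_le_of_mem {M : Submodule k⟦X⟧ V} (h0 : tpow k m • b.e0 ∈ M)
    (h1 : tpow k n • b.e1 ∈ M) : b.lat m n ≤ M := by
  have key : ∀ (i : ℤ) (d : k⸨X⸩) (e : V), d ∈ fil k i → tpow k i • e ∈ M → d • e ∈ M := by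
    intro i d e hd he
    obtain ⟨p, hp⟩ := mem_fil_zero_iff.1
      (mul_mem_fil (l := 0) hd (tpow_mem_fil (m := -i).2 le_rfl) (by omega))
    have := M.smul_mem p he
    rwa [← IsScalarTower.algebraMap_smul k⸨X⸩, hp, smul_smul, mul_assoc,
      mul_comm (tpow k (-i)), tpow_mul_neg, mul_one] at this
  intro v hv
  rw [← b.eta v]
  exact M.add_mem (key m _ _ hv.1 h0) (key n _ _ hv.2 h1)

theorem isLattice_lat : Submodule.IsLattice k⸨X⸩ (b.lat m n) where
  fg := by
    have : b.lat m n = Submodule.span k⟦X⟧ {tpow k m • b.e0, tpow k n • b.e1} := by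
      refine le_antisymm (lat_le_of_mem (Submodule.subset_span (by simp))
        (Submodule.subset_span (by simp))) ?_
      rw [Submodule.span_le, Set.insert_subset_iff, Set.singleton_subset_iff]
      exact ⟨tpow_e0_mem, tpow_e1_mem⟩
    rw [this]
    exact Submodule.fg_span (Set.toFinite _)
  span_eq_top := by
    rw [eq_top_iff]
    intro v _
    have key : ∀ (i : ℤ) (d : k⸨X⸩) (e : V), tpow k i • e ∈ b.lat m n →
        d • e ∈ Submodule.span k⸨X⸩ (b.lat m n : Set V) := by
      intro i d e he
      have := Submodule.smul_mem _ (d * tpow k (-i)) (Submodule.subset_span (R := k⸨X⸩) he)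
      rwa [smul_smul, mul_assoc, mul_comm (tpow k (-i)), tpow_mul_neg, mul_one] at this
    rw [← b.eta v]
    exact add_mem (key m _ _ tpow_e0_mem) (key n _ _ tpow_e1_mem)

/-- A lattice is contained in a multiple of the lattice spanned by `b`, and it contains a multiple
of every vector. -/
theorem exists_lat_le {M : Submodule k⟦X⟧ V} (hM : Submodule.IsLattice k⸨X⸩ M) :
    (∃ N, M ≤ b.lat N N) ∧ ∀ v, ∃ N, tpow k N • v ∈ M := by
  have hord : ∀ d : k⸨X⸩, ∃ N, ∀ N' ≤ N, d ∈ fil k N' := by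
    intro d
    rcases eq_or_ne d 0 with rfl | hd
    · exact ⟨0, fun _ _ => zero_mem _⟩
    · obtain ⟨m, hm⟩ := exists_order hd
      exact ⟨m, fun N hN => (hm N).1.2 hN⟩
  constructor
  · classical
    obtain ⟨S, hS⟩ := hM.fg
    rw [← hS]
    clear hS
    induction S using Finset.induction_on with
    | empty => exact ⟨0, by simp⟩
    | insert v S _ ih =>
      obtain ⟨N, hN⟩ := ih
      obtain ⟨N1, h1⟩ := hord (b.x v)
      obtain ⟨N2, h2⟩ := hord (b.y v)
      refine ⟨min N (min N1 N2), ?_⟩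
      rw [Finset.coe_insert, Submodule.span_insert, sup_le_iff, Submodule.span_singleton_le_iff_mem]
      exact ⟨⟨h1 _ (by omega), h2 _ (by omega)⟩,
        hN.trans (lat_le_lat_iff.2 ⟨by omega, by omega⟩)⟩
  · have hup : ∀ (v : V) (i j : ℤ), i ≤ j → tpow k i • v ∈ M → tpow k j • v ∈ M := by
      intro v i j hij hv
      obtain ⟨p, hp⟩ := mem_fil_zero_iff.1 (tpow_mem_fil (k := k) (m := j - i).2 (sub_nonneg.2 hij))
      have := M.smul_mem p hv
      rwa [← IsScalarTower.algebraMap_smul k⸨X⸩, hp, smul_smul, ← tpow_add,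
        sub_add_cancel] at this
    intro v
    have hv : v ∈ Submodule.span k⸨X⸩ (M : Set V) := hM.span_eq_top ▸ Submodule.mem_top
    induction hv using Submodule.span_induction with
    | mem v hv => exact ⟨0, by rwa [tpow_zero, one_smul]⟩
    | zero => exact ⟨0, by simp⟩
    | add v w _ _ h1 h2 =>
      obtain ⟨i, hi⟩ := h1
      obtain ⟨j, hj⟩ := h2
      refine ⟨max i j, ?_⟩
      rw [smul_add]
      exact M.add_mem (hup _ _ _ (le_max_left _ _) hi) (hup _ _ _ (le_max_right _ _) hj)
    | smul d v _ h1 =>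
      obtain ⟨i, hi⟩ := h1
      obtain ⟨j, hj⟩ := hord d
      refine ⟨i - j, ?_⟩
      obtain ⟨p, hp⟩ := mem_fil_zero_iff.1 (tpow_mul_mem_fil (m := -j) (n := 0).2
        (hj _ (by omega) : d ∈ _))
      have := M.smul_mem p hi
      rw [← IsScalarTower.algebraMap_smul k⸨X⸩, hp, smul_smul] at this
      rw [smul_smul]
      convert this using 2
      rw [show i - j = i + -j by omega, tpow_add]
      ring

/-- The multiples of a vector `e` that lie in a lattice form a fractional ideal; the condition on a
coordinate of `e` bounds it. -/
theorem exists_coord_fil {M : Submodule k⟦X⟧ V} (hM : Submodule.IsLattice k⸨X⸩ M)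
    (b : UBasis ω) (e : V) (he : b.x e = 1 ∨ b.y e = 1) :
    ∃ p, ∀ d : k⸨X⸩, d • e ∈ M ↔ d ∈ fil k p := by
  obtain ⟨⟨N, hN⟩, h2⟩ := exists_lat_le (b := b) hM
  let I : Submodule k⟦X⟧ k⸨X⸩ :=
    M.comap ((LinearMap.toSpanSingleton k⸨X⸩ V e).restrictScalars k⟦X⟧)
  obtain ⟨j, hj⟩ := h2 e
  obtain ⟨p, hp⟩ := exists_eq_fil I N (fun d hd => by
    have hd' := hN (show d • e ∈ M from hd)
    rw [mem_lat, map_smul, map_smul, smul_eq_mul, smul_eq_mul] at hd'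
    rcases he with he | he
    · simpa [he] using hd'.1
    · simpa [he] using hd'.2) ⟨_, hj, tpow_ne_zero j⟩
  refine ⟨p, fun d => ?_⟩
  rw [← hp]
  rfl

end UBasis

end

section

variable {k : Type*} [Field k] {V : Type*} [AddCommGroup V] [Module k V]
  [Module (PowerSeries k) V] [Module (LaurentSeries k) V]
  [IsScalarTower k (PowerSeries k) V] [IsScalarTower (PowerSeries k) (LaurentSeries k) V]
  {ω : ⋀[LaurentSeries k]^2 V}

namespace UBasis

section Apartments

variable {b c : UBasis ω} {m n m' n' : ℤ}

/-! ### Unimodular lattices -/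

theorem algebraMap_injective : Function.Injective (algebraMap k⟦X⟧ k⸨X⸩) :=
  IsFractionRing.injective _ _

/-- The vectors of `b` as a `k[[ε]]`-basis of the lattice they span. -/
theorem exists_latBasis (b : UBasis ω) : ∃ e : Module.Basis (Fin 2) k⟦X⟧ (b.lat 0 0),
    (e 0 : V) = b.e0 ∧ (e 1 : V) = b.e1 := by
  have h0 : b.e0 ∈ b.lat 0 0 := by simpa [tpow_zero] using tpow_e0_mem (b := b) (m := 0) (n := 0)
  have h1 : b.e1 ∈ b.lat 0 0 := by simpa [tpow_zero] using tpow_e1_mem (b := b) (m := 0) (n := 0)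
  have hli : LinearIndependent k⟦X⟧ (![⟨b.e0, h0⟩, ⟨b.e1, h1⟩] : Fin 2 → b.lat 0 0) := by
    rw [LinearIndependent.pair_iff]
    intro p q hpq
    have h2 : (algebraMap k⟦X⟧ k⸨X⸩ p) • b.e0 + (algebraMap k⟦X⟧ k⸨X⸩ q) • b.e1 = 0 := by
      rw [algebraMap_smul, algebraMap_smul]
      exact congrArg Subtype.val hpq
    have h3 := congrArg b.x h2
    have h4 := congrArg b.y h2
    simp only [map_add, map_smul, x_e0, x_e1, y_e0, y_e1, smul_eq_mul, mul_one, mul_zero, add_zero,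
      zero_add, map_zero] at h3 h4
    exact ⟨(map_eq_zero_iff _ algebraMap_injective).1 h3,
      (map_eq_zero_iff _ algebraMap_injective).1 h4⟩
  refine ⟨Module.Basis.mk hli ?_, by rw [Module.Basis.mk_apply]; rfl,
    by rw [Module.Basis.mk_apply]; rfl⟩
  rintro ⟨v, hv⟩ -
  obtain ⟨p, hp⟩ := mem_fil_zero_iff.1 hv.1
  obtain ⟨q, hq⟩ := mem_fil_zero_iff.1 hv.2
  have : (⟨v, hv⟩ : b.lat 0 0) = p • ⟨b.e0, h0⟩ + q • ⟨b.e1, h1⟩ := by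
    apply Subtype.ext
    change v = p • b.e0 + q • b.e1
    rw [← algebraMap_smul k⸨X⸩ p, ← algebraMap_smul k⸨X⸩ q, hp, hq]
    exact (b.eta v).symm
  rw [this]
  exact add_mem (Submodule.smul_mem _ _ (Submodule.subset_span ⟨0, rfl⟩))
    (Submodule.smul_mem _ _ (Submodule.subset_span ⟨1, rfl⟩))

theorem lat_mem_unimodular (b : UBasis ω) : b.lat 0 0 ∈ unimodularLattices ω := by
  obtain ⟨e, h0, h1⟩ := b.exists_latBasis
  exact ⟨e, by rw [iMulti_pair b.e0 b.e1 _ h0 h1, b.vol']⟩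

/-- A `k[[ε]]`-basis of volume `ω` of a lattice is a basis of `V`. -/
theorem exists_of_latBasis (hV : Module.finrank k⸨X⸩ V = 2) (hω : ω ≠ 0)
    {M : Submodule k⟦X⟧ V} (e : Module.Basis (Fin 2) k⟦X⟧ M)
    (he : exteriorPower.ιMulti k⸨X⸩ 2 (fun i => (e i : V)) = ω) :
    ∃ b : UBasis ω, M = b.lat 0 0 ∧ (e 0 : V) = b.e0 ∧ (e 1 : V) = b.e1 := by
  obtain ⟨b, h0, h1⟩ := exists_of_wedge hV hω (e 0 : V) (e 1 : V)
    (by rwa [← iMulti_pair (e 0 : V) (e 1 : V) (fun i => (e i : V)) rfl rfl])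
  refine ⟨b, le_antisymm (fun v hv => ?_) (lat_le_of_mem ?_ ?_), h0.symm, h1.symm⟩
  · have h2 := congrArg Subtype.val (e.sum_repr ⟨v, hv⟩)
    rw [Fin.sum_univ_two] at h2
    have h3 : algebraMap k⟦X⟧ k⸨X⸩ (e.repr ⟨v, hv⟩ 0) • b.e0 +
        algebraMap k⟦X⟧ k⸨X⸩ (e.repr ⟨v, hv⟩ 1) • b.e1 = v := by
      rw [algebraMap_smul, algebraMap_smul, h0, h1]
      exact h2
    rw [← h3, mem_lat]
    constructor
    · simpa using mem_fil_zero_iff.2 ⟨_, rfl⟩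
    · simpa using mem_fil_zero_iff.2 ⟨_, rfl⟩
  · rw [tpow_zero, one_smul, h0]
    exact (e 0).2
  · rw [tpow_zero, one_smul, h1]
    exact (e 1).2

theorem mem_unimodular_iff (b : UBasis ω) {M : Submodule k⟦X⟧ V} :
    M ∈ unimodularLattices ω ↔ ∃ c : UBasis ω, M = c.lat 0 0 := by
  constructor
  · rintro ⟨e, he⟩
    obtain ⟨c, hc, -⟩ := exists_of_latBasis b.finrank_eq b.vol_ne_zero e he
    exact ⟨c, hc⟩
  · rintro ⟨c, rfl⟩
    exact c.lat_mem_unimodular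

/-! ### The apartment of a basis -/

/-- The vertices of the apartment of `b`. Those of even index are the unimodular ones. -/
noncomputable def vert (b : UBasis ω) (i : ℤ) : Submodule k⟦X⟧ V := b.lat (-(i / 2)) ((i + 1) / 2)

/-- The chambers of the apartment of `b`: `chamber i` fixes the vertices `i` and `i + 1`. -/
noncomputable def chamber (b : UBasis ω) (i : ℤ) : Subgroup (SpecialLinearGroup k⸨X⸩ V) :=
  stab (b.vert i) ⊓ stab (b.vert (i + 1))

theorem vert_zero : b.vert 0 = b.lat 0 0 := rfl
theorem vert_one : b.vert 1 = b.lat 0 1 := rfl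

theorem vert_even (j : ℤ) : b.vert (2 * j) = b.lat (-j) j := by
  rw [vert]
  congr 1 <;> omega

theorem vert_odd (j : ℤ) : b.vert (2 * j + 1) = b.lat (-j) (j + 1) := by
  rw [vert]
  congr 1 <;> omega

/-- In the basis `b` the matrices in the Iwahori subgroup `chamber i` are those with integral
diagonal whose lower left and upper right entries are divisible by `ε^(i+1)` and `ε^(-i)`. -/
theorem mem_chamber {i : ℤ} {g : SpecialLinearGroup k⸨X⸩ V} : g ∈ b.chamber i ↔
    b.x (g.1 b.e0) ∈ fil k 0 ∧ b.y (g.1 b.e0) ∈ fil k (i + 1) ∧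
    b.x (g.1 b.e1) ∈ fil k (-i) ∧ b.y (g.1 b.e1) ∈ fil k 0 := by
  rw [chamber, Subgroup.mem_inf, vert, vert, mem_stab_lat, mem_stab_lat,
    show (i + 1) / 2 - -(i / 2) = i by omega, show -(i / 2) - (i + 1) / 2 = -i by omega,
    show (i + 1 + 1) / 2 - -((i + 1) / 2) = i + 1 by omega,
    show -((i + 1) / 2) - (i + 1 + 1) / 2 = -i - 1 by omega]
  constructor
  · rintro ⟨⟨⟨h1, _⟩, h2, h3⟩, ⟨_, h4⟩, _⟩
    exact ⟨h1, h4, h2, h3⟩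
  · rintro ⟨h1, h4, h2, h3⟩
    exact ⟨⟨⟨h1, fil_mono (by omega) h4⟩, h2, h3⟩, ⟨h1, h4⟩, fil_mono (by omega) h2, h3⟩

theorem translate_vert (g : SpecialLinearGroup k⸨X⸩ V) (i : ℤ) :
    translate g (b.vert i) = (b.map g).vert i := translate_lat g

theorem conj_stab (g : SpecialLinearGroup k⸨X⸩ V) (M : Submodule k⟦X⟧ V) :
    conj g (stab M) = stab (translate g M) := by
  ext h
  constructor
  · rintro ⟨u, hu, rfl⟩
    have hu : translate u M = M := hu
    change translate (g * u * g⁻¹) (translate g M) = translate g M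
    rw [← translate_mul, inv_mul_cancel_right, translate_mul, hu]
  · intro hh
    have hh : translate h (translate g M) = translate g M := hh
    refine ⟨g⁻¹ * h * g, ?_, ?_⟩
    · change translate (g⁻¹ * h * g) M = M
      rw [mul_assoc, translate_mul, translate_mul, hh, ← translate_mul, inv_mul_cancel,
        translate_one]
    · change g * (g⁻¹ * h * g) * g⁻¹ = h
      group

theorem conj_inf (g : SpecialLinearGroup k⸨X⸩ V) (Q Q' : Subgroup (SpecialLinearGroup k⸨X⸩ V)) :
    conj g (Q ⊓ Q') = conj g Q ⊓ conj g Q' :=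
  Subgroup.map_inf _ _ _ (MulAut.conj g).injective

theorem conj_chamber (g : SpecialLinearGroup k⸨X⸩ V) (i : ℤ) :
    conj g (b.chamber i) = (b.map g).chamber i := by
  rw [chamber, conj_inf, conj_stab, conj_stab, translate_vert, translate_vert, chamber]

/-- The simply transitive action of the affine Weyl group on the chambers of an apartment,
transported to the index set `ℤ`. -/
def wmul (i j : ℤ) : ℤ := if Even i then i + j else i - j

/-- The basis of the same apartment whose chamber `0` is the chamber `i` of `b`. -/
noncomputable def apt (b : UBasis ω) (i : ℤ) : UBasis ω :=
  if Even i then b.ofCoeffs (tpow k (-(i / 2))) 0 0 (tpow k (i / 2))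
    (by rw [mul_comm, tpow_mul_neg, mul_zero, sub_zero])
  else b.ofCoeffs 0 (tpow k ((i + 1) / 2)) (-tpow k (-((i + 1) / 2))) 0
    (by rw [mul_neg, tpow_mul_neg, mul_zero, zero_sub, neg_neg])

theorem vert_apt_even {i : ℤ} (hi : Even i) (j : ℤ) : (b.apt i).vert j = b.vert (i + j) := by
  obtain ⟨l, rfl⟩ := hi
  rw [apt, if_pos ⟨l, rfl⟩, vert, vert, lat_eq_iff (by omega)]
  simp only [x_ofCoeffs_e0, y_ofCoeffs_e0, x_ofCoeffs_e1, y_ofCoeffs_e1, tpow_mem_fil, zero_mem,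
    true_and, and_true]
  omega

theorem vert_apt_odd {i : ℤ} (hi : ¬ Even i) (j : ℤ) : (b.apt i).vert j = b.vert (i + 1 - j) := by
  rw [apt, if_neg hi]
  obtain ⟨l, rfl⟩ := Int.not_even_iff_odd.1 hi
  rw [vert, vert, lat_eq_iff (by omega)]
  simp only [x_ofCoeffs_e0, y_ofCoeffs_e0, x_ofCoeffs_e1, y_ofCoeffs_e1, tpow_mem_fil, zero_mem,
    true_and, and_true, neg_mem_iff]
  omega

/-- The left action of `i` on the apartment: a translation for even `i`, a reflection for odd `i`.
-/
theorem chamber_apt (i j : ℤ) : (b.apt i).chamber j = b.chamber (wmul i j) := by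
  unfold chamber wmul
  split_ifs with h
  · rw [vert_apt_even h, vert_apt_even h, add_assoc]
  · rw [vert_apt_odd h, vert_apt_odd h, inf_comm]
    congr 3 <;> omega

/-! ### Stable lattices -/

theorem tpow_smul_lat {v : V} {l : ℤ} :
    tpow k l • v ∈ b.lat m n ↔ v ∈ b.lat (m - l) (n - l) := by
  simp only [mem_lat, map_smul, smul_eq_mul, tpow_mul_mem_fil]

/-- The lattices stable under an Iwahori subgroup are the multiples of its two vertices: two
unipotent elements bound the two coordinates of the vectors of a stable lattice. -/
theorem stable_chamber {M : Submodule k⟦X⟧ V} (hM : IsStableLattice (b.chamber 0) M) :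
    ∃ i, M = b.lat i i ∨ M = b.lat i (i + 1) := by
  obtain ⟨hM, hst⟩ := hM
  have hg : ∀ g ∈ b.chamber 0, ∀ v ∈ M, g.1 v - v ∈ M := by
    intro g hg v hv
    refine M.sub_mem ?_ hv
    rw [← hst g hg]
    exact ⟨v, hv, rfl⟩
  obtain ⟨p, hp⟩ := exists_coord_fil hM b b.e0 (Or.inl b.x_e0)
  obtain ⟨q, hq⟩ := exists_coord_fil hM b b.e1 (Or.inr b.y_e1)
  have hu : ∀ v ∈ M, b.y v ∈ fil k p := by
    intro v hv
    have h := hg (b.elt 1 0 1 1 (by ring)) (by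
      rw [mem_chamber]
      simp [one_mem_fil, zero_mem]) v hv
    rw [← hp]
    convert h using 1
    apply b.ext_coord <;> rw [← b.eta v] <;> simp
  have hl : ∀ v ∈ M, b.x v ∈ fil k (q - 1) := by
    intro v hv
    have h := hg (b.elt 1 (tpow k 1) 0 1 (by ring)) (by
      rw [mem_chamber]
      simp [one_mem_fil, zero_mem, tpow_mem_fil]) v hv
    rw [← tpow_mul_mem_fil, ← hq]
    convert h using 1
    apply b.ext_coord <;> rw [← b.eta v] <;> simp [mul_comm]
  have hqp : p ≤ q := by
    have := hu _ ((hq _).2 (tpow_mem_fil.2 le_rfl))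
    simpa [tpow_mem_fil] using this
  have hpq : q - 1 ≤ p := by
    have := hl _ ((hp _).2 (tpow_mem_fil.2 le_rfl))
    simpa [tpow_mem_fil] using this
  have key : M = b.lat p q := by
    refine le_antisymm (fun v hv => ?_) (lat_le_of_mem ((hp _).2 (tpow_mem_fil.2 le_rfl))
      ((hq _).2 (tpow_mem_fil.2 le_rfl)))
    have hx := hl v hv
    have hy := hu v hv
    rcases eq_or_ne p q with rfl | hne
    · refine ⟨?_, hy⟩
      have h1 := M.sub_mem hv ((hq _).2 hy)
      have h2 : v - b.y v • b.e1 = b.x v • b.e0 := by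
        rw [sub_eq_iff_eq_add, b.eta]
      rw [h2, hp] at h1
      exact h1
    · have hp1 : p = q - 1 := by omega
      subst hp1
      refine ⟨hx, ?_⟩
      have h1 := M.sub_mem hv ((hp _).2 hx)
      have h2 : v - b.x v • b.e0 = b.y v • b.e1 := by
        rw [sub_eq_iff_eq_add, add_comm, b.eta]
      rw [h2, hq] at h1
      exact h1
  rcases eq_or_ne p q with rfl | hne
  · exact ⟨p, Or.inl key⟩
  · exact ⟨p, Or.inr (by rw [key]; congr 1; omega)⟩

theorem chamber_zero_le_stab : b.chamber 0 ≤ stab (b.lat 0 0) := inf_le_left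

/-- The multiples of a unimodular lattice are the only lattices stable under its stabilizer. -/
theorem stable_stab {M : Submodule k⟦X⟧ V} (hM : IsStableLattice (stab (b.lat 0 0)) M) :
    ∃ i, M = b.lat i i := by
  obtain ⟨i, h | h⟩ := stable_chamber (b := b) ⟨hM.1, fun g hg => hM.2 g (chamber_zero_le_stab hg)⟩
  · exact ⟨i, h⟩
  · exfalso
    have h2 : b.elt 0 1 (-1) 0 (by ring) ∈ stab M := hM.2 _ (by
      rw [mem_stab_lat]
      simp [one_mem_fil, zero_mem])
    rw [h, mem_stab_lat] at h2
    simp only [elt_e0, map_add, map_smul, y_e0, y_e1, smul_eq_mul, mul_one, zero_add, mul_zero,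
      one_mem_fil] at h2
    omega

theorem isStable_stab (i : ℤ) : IsStableLattice (stab (b.lat 0 0)) (b.lat i i) := by
  refine ⟨isLattice_lat, fun g hg => ?_⟩
  change g ∈ stab (b.lat i i)
  rw [mem_stab_lat] at hg ⊢
  simpa using hg

theorem isStable_chamber_left (i : ℤ) : IsStableLattice (b.chamber 0) (b.lat i i) :=
  ⟨isLattice_lat, fun g hg => (isStable_stab i).2 g hg.1⟩

theorem isStable_chamber_right (i : ℤ) : IsStableLattice (b.chamber 0) (b.lat i (i + 1)) := by
  refine ⟨isLattice_lat, fun g hg => ?_⟩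
  have hg : g ∈ stab (b.lat 0 1) := hg.2
  change g ∈ stab (b.lat i (i + 1))
  rw [mem_stab_lat] at hg ⊢
  simpa using hg

/-- An Iwahori subgroup lies in the stabilizer of only one unimodular lattice. -/
theorem lat_eq_of_chamber_le (h : b.chamber 0 ≤ stab (c.lat 0 0)) : c.lat 0 0 = b.lat 0 0 := by
  obtain ⟨i, hi | hi⟩ := stable_chamber (b := b) (M := c.lat 0 0)
    ⟨isLattice_lat, fun g hg => h hg⟩
  · have := add_eq_of_lat_eq hi
    obtain rfl : i = 0 := by omega
    exact hi
  · have := add_eq_of_lat_eq hi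
    omega

theorem vert_eq_of_chamber_le (h : b.chamber 0 ≤ c.chamber 0) :
    c.lat 0 0 = b.lat 0 0 ∧ c.lat 0 1 = b.lat 0 1 := by
  refine ⟨lat_eq_of_chamber_le (h.trans chamber_zero_le_stab), ?_⟩
  obtain ⟨i, hi | hi⟩ := stable_chamber (b := b) (M := c.lat 0 1)
    ⟨isLattice_lat, fun g hg => (h hg).2⟩
  · have := add_eq_of_lat_eq hi
    omega
  · have := add_eq_of_lat_eq hi
    obtain rfl : i = 0 := by omega
    exact hi

theorem chamber_eq_of_vert (h0 : c.lat 0 0 = b.lat 0 0) (h1 : c.lat 0 1 = b.lat 0 1) :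
    c.chamber 0 = b.chamber 0 := by
  rw [chamber, chamber, zero_add, vert_zero, vert_one, vert_zero, vert_one, h0, h1]

/-- There are no proper inclusions between Iwahori subgroups. -/
theorem chamber_eq_of_le (h : b.chamber 0 ≤ c.chamber 0) : b.chamber 0 = c.chamber 0 :=
  (chamber_eq_of_vert (vert_eq_of_chamber_le h).1 (vert_eq_of_chamber_le h).2).symm

/-! ### Cartan decomposition -/

/-- The basis `e₁, -e₀`. -/
noncomputable def swap (b : UBasis ω) : UBasis ω := b.ofCoeffs 0 1 (-1) 0 (by ring)

theorem x_swap (v : V) : b.swap.x v = b.y v := by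
  rw [b.x_change, swap]
  simp

theorem y_swap (v : V) : b.swap.y v = -b.x v := by
  rw [b.y_change, swap]
  simp

theorem swap_e0 : b.swap.e0 = b.e1 := by
  rw [swap, ofCoeffs_e0]
  simp

theorem swap_e1 : b.swap.e1 = -b.e0 := by
  rw [swap, ofCoeffs_e1]
  simp

theorem lat_swap : b.swap.lat m n = b.lat n m := by
  ext v
  rw [mem_lat, mem_lat, x_swap, y_swap, neg_mem_iff, and_comm]

/-- Column and row reduction when the first entry divides the others. -/
theorem exists_cartan_of_dvd (hp : b.x c.e0 ≠ 0) (h1 : b.y c.e0 * (b.x c.e0)⁻¹ ∈ fil k 0)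
    (h2 : b.x c.e1 * (b.x c.e0)⁻¹ ∈ fil k 0) :
    ∃ (a : UBasis ω) (n : ℤ), b.lat 0 0 = a.lat 0 0 ∧ c.lat 0 0 = a.lat n (-n) := by
  obtain ⟨m, hm⟩ := exists_order hp
  have hp1 : tpow k (-m) * b.x c.e0 ∈ fil k 0 := by
    rw [tpow_mul_mem_fil, (hm _).1]
    omega
  have hdet := b.det_eq c
  set p := b.x c.e0
  set q := b.y c.e0
  set r := b.x c.e1
  set s := b.y c.e1
  have hm1 := tpow_mul_neg (k := k) m
  let a := b.ofCoeffs (tpow k (-m) * p) (tpow k (-m) * q) 0 (tpow k m * p⁻¹) (by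
    field_simp
    linear_combination hm1)
  have hx : ∀ v, a.x v = tpow k m * p⁻¹ * b.x v := fun v => by
    rw [b.x_change, x_ofCoeffs_e1, y_ofCoeffs_e1]
    ring
  have hy : ∀ v, a.y v = tpow k (-m) * (p * b.y v - q * b.x v) := fun v => by
    rw [b.y_change, x_ofCoeffs_e0, y_ofCoeffs_e0]
    ring
  refine ⟨a, m, ?_, ?_⟩
  · symm
    rw [lat_eq_iff rfl, x_ofCoeffs_e0, y_ofCoeffs_e0, x_ofCoeffs_e1, y_ofCoeffs_e1]
    refine ⟨⟨hp1, ?_⟩, zero_mem _, ?_⟩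
    · have := mul_mem_fil (l := 0 - 0) hp1 h1 (by omega)
      convert this using 1
      field_simp
    · rw [tpow_mul_mem_fil, (hm _).2]
      omega
  · rw [lat_eq_iff (by omega), hx, hy, hx, hy]
    refine ⟨⟨?_, ?_⟩, ?_, ?_⟩
    · rw [mul_assoc, inv_mul_cancel₀ hp, mul_one, tpow_mem_fil]
      omega
    · rw [show p * b.y c.e0 - q * b.x c.e0 = 0 by simp only [p, q]; ring, mul_zero]
      exact zero_mem _
    · rw [mul_assoc, tpow_mul_mem_fil, mul_comm]
      exact fil_mono (by omega) h2
    · rw [show p * b.y c.e1 - q * b.x c.e1 = 1 from hdet, mul_one, tpow_mem_fil]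
      omega

/-- Cartan decomposition: two unimodular lattices have bases that differ by a diagonal matrix. -/
theorem exists_cartan (b c : UBasis ω) : ∃ (a : UBasis ω) (n : ℤ), 0 ≤ n ∧
    b.lat 0 0 = a.lat 0 0 ∧ c.lat 0 0 = a.lat (-n) n := by
  suffices h : ∃ (a : UBasis ω) (n : ℤ), b.lat 0 0 = a.lat 0 0 ∧ c.lat 0 0 = a.lat n (-n) by
    obtain ⟨a, n, h1, h2⟩ := h
    rcases le_total 0 n with hn | hn
    · exact ⟨a.swap, n, hn, by rw [lat_swap, h1], by rw [lat_swap, h2]⟩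
    · exact ⟨a, -n, by omega, h1, by rw [neg_neg, h2]⟩
  -- the entry of least order can be moved to the first row and column
  let f : Fin 4 → k⸨X⸩ := ![b.x c.e0, b.y c.e0, b.x c.e1, b.y c.e1]
  obtain ⟨i, hi⟩ := Finite.exists_min fun i => (f i).orderTop
  have hi0 : f i ≠ 0 := by
    intro h0
    have hall : ∀ j, f j = 0 := fun j => by
      have := hi j
      rw [h0, HahnSeries.orderTop_zero, top_le_iff, HahnSeries.orderTop_eq_top] at this
      exact this
    have h0 : b.x c.e0 = 0 := hall 0
    have h1 : b.y c.e0 = 0 := hall 1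
    have := b.det_eq c
    rw [h0, h1, zero_mul, zero_mul, sub_zero] at this
    exact zero_ne_one this
  have hdiv : ∀ j, f j * (f i)⁻¹ ∈ fil k 0 := by
    intro j
    obtain ⟨m, hm⟩ := exists_order hi0
    refine mul_mem_fil (m := m) (n := -m) ?_ ((hm _).2.2 le_rfl) (by omega)
    exact le_trans (mem_fil_iff_orderTop.1 ((hm m).1.2 le_rfl)) (hi j)
  have h0 := hdiv 0
  have h1 := hdiv 1
  have h2 := hdiv 2
  have h3 := hdiv 3
  fin_cases i
  · exact exists_cartan_of_dvd hi0 h1 h2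
  · obtain ⟨a, n, ha, hc⟩ := exists_cartan_of_dvd (b := b.swap) (c := c) (by rw [x_swap]; exact hi0)
      (by rw [x_swap, y_swap, neg_mul, neg_mem_iff]; exact h0)
      (by rw [x_swap, x_swap]; exact h3)
    exact ⟨a, n, by rw [← ha, lat_swap], hc⟩
  · obtain ⟨a, n, ha, hc⟩ := exists_cartan_of_dvd (b := b) (c := c.swap) (by rw [swap_e0]; exact hi0)
      (by rw [swap_e0]; exact h3)
      (by rw [swap_e0, swap_e1, map_neg, neg_mul, neg_mem_iff]; exact h0)
    exact ⟨a, n, ha, by rw [← hc, lat_swap]⟩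
  · obtain ⟨a, n, ha, hc⟩ := exists_cartan_of_dvd (b := b.swap) (c := c.swap)
      (by rw [swap_e0, x_swap]; exact hi0)
      (by rw [swap_e0, x_swap, y_swap, neg_mul, neg_mem_iff]; exact h2)
      (by rw [swap_e0, swap_e1, map_neg, x_swap, x_swap, neg_mul, neg_mem_iff]; exact h1)
    exact ⟨a, n, by rw [← ha, lat_swap], by rw [← hc, lat_swap]⟩

/-! ### Lines in the reduction of a lattice -/

theorem eq_lat_of_e0_mem {N : Submodule k⟦X⟧ V} (h1 : b.lat (m + 1) (n + 1) ≤ N)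
    (h2 : N < b.lat m n) (h : tpow k m • b.e0 ∈ N) : N = b.lat m (n + 1) := by
  refine le_antisymm (fun v hv => ?_) (lat_le_of_mem h (h1 tpow_e1_mem))
  have hv' := h2.le hv
  refine mem_lat.2 ⟨hv'.1, ?_⟩
  by_contra hn
  have hy0 : b.y v ≠ 0 := by
    intro h0
    exact hn (by rw [h0]; exact zero_mem _)
  obtain ⟨p, hp⟩ := mem_fil_zero_iff.1 (mul_mem_fil (l := 0) (tpow_mem_fil (k := k) (m := n).2 le_rfl)
    (inv_mem_fil_of_not_mem (m := n) hn) (by omega))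
  have h4 : b.x v • b.e0 ∈ N := by
    have : b.lat m (n + 1) ≤ N := lat_le_of_mem h (h1 tpow_e1_mem)
    refine this ?_
    rw [mem_lat, map_smul, map_smul, x_e0, y_e0, smul_eq_mul, mul_one, smul_zero]
    exact ⟨hv'.1, zero_mem _⟩
  have h5 := N.smul_mem p (N.sub_mem hv h4)
  have h6 : v - b.x v • b.e0 = b.y v • b.e1 := by rw [sub_eq_iff_eq_add, add_comm, b.eta]
  rw [h6, ← IsScalarTower.algebraMap_smul k⸨X⸩, hp, smul_smul, inv_mul_cancel_right₀ hy0] at h5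
  exact absurd (lat_le_of_mem h h5) (not_le_of_gt h2)

theorem eq_lat_of_e1_mem {N : Submodule k⟦X⟧ V} (h1 : b.lat (m + 1) (n + 1) ≤ N)
    (h2 : N < b.lat m n) (h : tpow k n • b.e1 ∈ N) : N = b.lat (m + 1) n := by
  rw [← lat_swap]
  rw [← lat_swap] at h1 h2
  exact eq_lat_of_e0_mem h1 h2 (by rwa [swap_e0])

/-- A line is a coordinate line, up to a unipotent change of basis that adds a multiple of `e₀` to
`e₁`. -/
theorem line_cases {N : Submodule k⟦X⟧ V} (h1 : b.lat (m + 1) (n + 1) < N)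
    (h2 : N < b.lat m n) : N = b.lat m (n + 1) ∨ ∃ x ∈ fil k (m - n),
      N = (b.ofCoeffs 1 0 x 1 (by ring)).lat (m + 1) n := by
  obtain ⟨v, hvN, hv⟩ := SetLike.exists_of_lt h1
  have hv' := h2.le hvN
  by_cases hy : b.y v ∈ fil k (n + 1)
  · left
    have hx : b.x v ∉ fil k (m + 1) := fun hx => hv ⟨hx, hy⟩
    have hx0 : b.x v ≠ 0 := by
      intro h0
      exact hx (by rw [h0]; exact zero_mem _)
    refine eq_lat_of_e0_mem h1.le h2 ?_
    obtain ⟨p, hp⟩ := mem_fil_zero_iff.1 (mul_mem_fil (l := 0)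
      (tpow_mem_fil (k := k) (m := m).2 le_rfl) (inv_mem_fil_of_not_mem hx) (by omega))
    have h4 : b.y v • b.e1 ∈ N := by
      refine h1.le ?_
      rw [mem_lat, map_smul, map_smul, x_e1, y_e1, smul_zero, smul_eq_mul, mul_one]
      exact ⟨zero_mem _, hy⟩
    have h5 := N.smul_mem p (N.sub_mem hvN h4)
    have h6 : v - b.y v • b.e1 = b.x v • b.e0 := by rw [sub_eq_iff_eq_add, b.eta]
    rwa [h6, ← IsScalarTower.algebraMap_smul k⸨X⸩, hp, smul_smul, inv_mul_cancel_right₀ hx0] at h5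
  · right
    have hy0 : b.y v ≠ 0 := by
      intro h0
      exact hy (by rw [h0]; exact zero_mem _)
    have hx : b.x v * (b.y v)⁻¹ ∈ fil k (m - n) :=
      mul_mem_fil hv'.1 (inv_mem_fil_of_not_mem hy) (by omega)
    refine ⟨_, hx, ?_⟩
    have e1 : (b.ofCoeffs 1 0 (b.x v * (b.y v)⁻¹) 1 (by ring)).lat m n = b.lat m n := by
      rw [lat_eq_iff rfl]
      simp [one_mem_fil, zero_mem, hx]
    have e2 : (b.ofCoeffs 1 0 (b.x v * (b.y v)⁻¹) 1 (by ring)).lat (m + 1) (n + 1) =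
        b.lat (m + 1) (n + 1) := by
      rw [lat_eq_iff rfl]
      simp [one_mem_fil, zero_mem, hx]
    refine eq_lat_of_e1_mem (e2 ▸ h1.le) (e1 ▸ h2) ?_
    obtain ⟨p, hp⟩ := mem_fil_zero_iff.1 (mul_mem_fil (l := 0)
      (tpow_mem_fil (k := k) (m := n).2 le_rfl) (inv_mem_fil_of_not_mem hy) (by omega))
    have h5 := N.smul_mem p hvN
    rw [← IsScalarTower.algebraMap_smul k⸨X⸩, hp] at h5
    convert h5 using 1
    apply b.ext_coord
    · simp
      ring
    · simp [hy0]

/-- The variant of `line_cases` with the roles of the two basis vectors exchanged. -/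
theorem line_cases' {N : Submodule k⟦X⟧ V} (h1 : b.lat (m + 1) (n + 1) < N)
    (h2 : N < b.lat m n) : N = b.lat (m + 1) n ∨ ∃ x ∈ fil k (n - m),
      N = (b.ofCoeffs 1 x 0 1 (by ring)).lat m (n + 1) := by
  rw [← lat_swap] at h1 h2
  rcases line_cases h1 h2 with h | ⟨x, hx, h⟩
  · left
    rw [h, lat_swap]
  · right
    refine ⟨-x, neg_mem hx, ?_⟩
    rw [h]
    rw [← lat_swap (b := b.ofCoeffs 1 (-x) 0 1 (by ring))]
    congr 1
    apply ext_vec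
    · rw [ofCoeffs_e0, swap_e0, swap_e1, swap_e0, ofCoeffs_e1]
      simp
    · rw [ofCoeffs_e1, swap_e0, swap_e1, swap_e1, ofCoeffs_e0]
      simp

theorem lat_succ_lt : b.lat m (n + 1) < b.lat m n := by
  refine lt_of_le_of_ne (lat_le_lat_iff.2 ⟨le_rfl, by omega⟩) ?_
  rw [ne_eq, lat_inj]
  omega

theorem lat_succ_lt' : b.lat (m + 1) n < b.lat m n := by
  rw [← lat_swap, ← lat_swap (m := n) (n := m)]
  exact lat_succ_lt

/-- Every Iwahori subgroup is the chamber `0` of an apartment. -/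
theorem isIwahori_iff (b : UBasis ω) {B : Subgroup (SpecialLinearGroup k⸨X⸩ V)} :
    IsIwahori ω B ↔ ∃ c : UBasis ω, B = c.chamber 0 := by
  constructor
  · rintro ⟨M, hM, N, h1, h2, rfl⟩
    obtain ⟨c, rfl⟩ := b.mem_unimodular_iff.1 hM
    rw [epsMul_lat] at h1
    rcases line_cases h1 h2 with h | ⟨x, hx, h⟩
    · exact ⟨c, by rw [h]; rfl⟩
    · refine ⟨(c.ofCoeffs 1 0 x 1 (by ring)).swap, ?_⟩
      rw [chamber, zero_add, vert_zero, vert_one, lat_swap, lat_swap, h]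
      congr 2
      symm
      rw [lat_eq_iff rfl]
      simp [one_mem_fil, zero_mem, fil_mono _ hx]
  · rintro ⟨c, rfl⟩
    refine ⟨c.lat 0 0, c.lat_mem_unimodular, c.lat 0 1, ?_, lat_succ_lt (n := 0), rfl⟩
    rw [epsMul_lat]
    exact lat_succ_lt' (m := 0)

theorem isIwahori_chamber (b : UBasis ω) (i : ℤ) : IsIwahori ω (b.chamber i) := by
  rw [b.isIwahori_iff]
  exact ⟨b.apt i, by rw [chamber_apt]; simp [wmul]⟩

/-! ### Common apartments -/

/-- Two chambers lie in a common apartment. The lattice of the second is in the positive direction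
from that of the first. -/
theorem exists_apartment (b c : UBasis ω) : ∃ (a : UBasis ω) (n : ℤ), 0 ≤ n ∧
    b.lat 0 0 = a.lat 0 0 ∧ c.lat 0 0 = a.lat (-n) n ∧
    (b.lat 0 1 = a.lat 0 1 ∨ b.lat 0 1 = a.lat 1 0) ∧
    (c.lat 0 1 = a.lat (-n) (n + 1) ∨ c.lat 0 1 = a.lat (-n + 1) n) := by
  obtain ⟨a, n, hn, h1, h2⟩ := exists_cartan b c
  have hbl : ∀ b : UBasis ω, b.lat 0 1 < b.lat 0 0 := fun b => lat_succ_lt (n := 0)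
  have hbe : ∀ b : UBasis ω, b.lat (0 + 1) (0 + 1) < b.lat 0 1 := fun b => lat_succ_lt' (m := 0)
  have hN1 : a.lat (0 + 1) (0 + 1) < b.lat 0 1 := by
    rw [← epsMul_lat, ← h1, epsMul_lat]
    exact hbe b
  have hN2 : b.lat 0 1 < a.lat 0 0 := by
    rw [← h1]
    exact hbl b
  -- first put the line of `b` into the apartment
  obtain ⟨a, h1, h2, h3⟩ : ∃ a : UBasis ω, b.lat 0 0 = a.lat 0 0 ∧ c.lat 0 0 = a.lat (-n) n ∧
      (b.lat 0 1 = a.lat 0 1 ∨ b.lat 0 1 = a.lat 1 0) := by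
    rcases line_cases hN1 hN2 with h | ⟨x, hx, h⟩
    · exact ⟨a, h1, h2, Or.inl h⟩
    · refine ⟨a.ofCoeffs 1 0 x 1 (by ring), ?_, ?_, Or.inr h⟩
      · rw [h1, eq_comm, lat_eq_iff rfl]
        simpa [one_mem_fil, zero_mem] using hx
      · rw [h2, eq_comm, lat_eq_iff rfl]
        simp only [x_ofCoeffs_e0, y_ofCoeffs_e0, x_ofCoeffs_e1, y_ofCoeffs_e1, one_mem_fil,
          zero_mem, true_and, and_true, sub_self, le_refl]
        exact fil_mono (by omega) hx
  have hM1 : a.lat (-n + 1) (n + 1) < c.lat 0 1 := by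
    rw [← epsMul_lat, ← h2, epsMul_lat]
    exact hbe c
  have hM2 : c.lat 0 1 < a.lat (-n) n := by
    rw [← h2]
    exact hbl c
  -- then the line of `c`; for equal lattices the first line is made that of the first basis vector
  rcases eq_or_ne n 0 with rfl | hn0
  · obtain ⟨a, h1, h2, h3⟩ : ∃ a : UBasis ω, b.lat 0 0 = a.lat 0 0 ∧ c.lat 0 0 = a.lat 0 0 ∧
        b.lat 0 1 = a.lat 0 1 := by
      rcases h3 with h3 | h3
      · exact ⟨a, h1, h2, h3⟩
      · exact ⟨a.swap, by rw [lat_swap, h1], by rw [lat_swap, h2]; rfl, by rw [lat_swap, h3]⟩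
    have hM1 : a.lat (0 + 1) (0 + 1) < c.lat 0 1 := by
      rw [← epsMul_lat, ← h2, epsMul_lat]
      exact hbe c
    have hM2 : c.lat 0 1 < a.lat 0 0 := by
      rw [← h2]
      exact hbl c
    rcases line_cases hM1 hM2 with h | ⟨x, hx, h⟩
    · exact ⟨a, 0, le_rfl, h1, h2, Or.inl h3, Or.inl h⟩
    · have e : ∀ i ≤ 1, 0 ≤ i → (a.ofCoeffs 1 0 x 1 (by ring)).lat 0 i = a.lat 0 i := by
        intro i hi hi'
        rw [lat_eq_iff rfl]
        simp only [x_ofCoeffs_e0, y_ofCoeffs_e0, x_ofCoeffs_e1, y_ofCoeffs_e1, one_mem_fil,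
          zero_mem, true_and, and_true, sub_self, le_refl]
        exact fil_mono (by omega) hx
      exact ⟨a.ofCoeffs 1 0 x 1 (by ring), 0, le_rfl, by rw [h1, e _ (by omega) le_rfl],
        by rw [neg_zero, h2, e _ (by omega) le_rfl], Or.inl (by rw [h3, e _ le_rfl (by omega)]),
        Or.inr h⟩
  · rcases line_cases' hM1 hM2 with h | ⟨x, hx, h⟩
    · exact ⟨a, n, hn, h1, h2, h3, Or.inr h⟩
    · -- this change of basis fixes all vertices up to the second lattice
      have e : ∀ i j, j - i ≤ 2 * n → (a.ofCoeffs 1 x 0 1 (by ring)).lat i j = a.lat i j := by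
        intro i j hij
        rw [lat_eq_iff rfl]
        simp only [x_ofCoeffs_e0, y_ofCoeffs_e0, x_ofCoeffs_e1, y_ofCoeffs_e1, one_mem_fil,
          zero_mem, true_and, and_true, sub_self, le_refl]
        exact fil_mono (by omega) hx
      refine ⟨a.ofCoeffs 1 x 0 1 (by ring), n, hn, ?_, ?_, ?_, Or.inl h⟩
      · rw [h1, e _ _ (by omega)]
      · rw [h2, e _ _ (by omega)]
      · rwa [e _ _ (by omega), e _ _ (by omega)]

/-! ### Lie algebras and lengths -/

theorem maps_lat_iff {a : V →ₗ[k⸨X⸩] V} : (∀ v ∈ b.lat m n, a v ∈ b.lat m n) ↔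
    (b.x (a b.e0) ∈ fil k 0 ∧ b.y (a b.e0) ∈ fil k (n - m)) ∧
    (b.x (a b.e1) ∈ fil k (m - n) ∧ b.y (a b.e1) ∈ fil k 0) := by
  constructor
  · intro h
    have h0 := h _ (tpow_e0_mem (b := b) (m := m) (n := n))
    have h1 := h _ (tpow_e1_mem (b := b) (m := m) (n := n))
    rw [map_smul, tpow_smul_lat, mem_lat, sub_self] at h0 h1
    exact ⟨h0, h1⟩
  · rintro ⟨⟨h1, h2⟩, h3, h4⟩ v ⟨hx, hy⟩
    have hx : b.x v ∈ fil k m := hx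
    have hy : b.y v ∈ fil k n := hy
    rw [mem_lat, ← b.eta v]
    simp only [map_add, map_smul, smul_eq_mul]
    exact ⟨add_mem (mul_mem_fil hx h1 (by omega)) (mul_mem_fil hy h3 (by omega)),
      add_mem (mul_mem_fil hx h2 (by omega)) (mul_mem_fil hy h4 (by omega))⟩

/-- Since the stable lattices are the multiples of two of them, two conditions suffice. -/
theorem mem_lie_chamber_zero {a : V →ₗ[k⸨X⸩] V} : a ∈ lie (b.chamber 0) ↔
    LinearMap.trace k⸨X⸩ V a = 0 ∧ (∀ v ∈ b.vert 0, a v ∈ b.vert 0) ∧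
      ∀ v ∈ b.vert 1, a v ∈ b.vert 1 := by
  refine and_congr_right fun _ => ⟨fun h => ⟨h _ (isStable_chamber_left 0),
    h _ (isStable_chamber_right 0)⟩, ?_⟩
  rintro ⟨h0, h1⟩ M hM
  rw [vert_zero, maps_lat_iff] at h0
  rw [vert_one, maps_lat_iff] at h1
  obtain ⟨i, rfl | rfl⟩ := stable_chamber hM
  · rw [maps_lat_iff]
    simpa using h0
  · rw [maps_lat_iff]
    simpa using h1

/-- The trace zero endomorphisms with integral diagonal whose lower left and upper right entries are
divisible by `ε^i` and `ε^j`. -/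
def IsBounded (b : UBasis ω) (i j : ℤ) (a : V →ₗ[k⸨X⸩] V) : Prop :=
  LinearMap.trace k⸨X⸩ V a = 0 ∧ b.x (a b.e0) ∈ fil k 0 ∧ b.y (a b.e1) ∈ fil k 0 ∧
    b.y (a b.e0) ∈ fil k i ∧ b.x (a b.e1) ∈ fil k j

theorem mem_lie_chamber {i : ℤ} {a : V →ₗ[k⸨X⸩] V} : a ∈ lie (b.chamber i) ↔
    b.IsBounded (i + 1) (-i) a := by
  have h1 : b.chamber i = (b.apt i).chamber 0 := by
    rw [chamber_apt]
    simp [wmul]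
  have h2 : (∀ v ∈ (b.apt i).vert 0, a v ∈ (b.apt i).vert 0) ∧
      (∀ v ∈ (b.apt i).vert 1, a v ∈ (b.apt i).vert 1) ↔
      (∀ v ∈ b.vert i, a v ∈ b.vert i) ∧ (∀ v ∈ b.vert (i + 1), a v ∈ b.vert (i + 1)) := by
    by_cases hi : Even i
    · rw [vert_apt_even hi, vert_apt_even hi, add_zero]
    · rw [vert_apt_odd hi, vert_apt_odd hi, sub_zero, add_sub_cancel_right, and_comm]
  rw [h1, mem_lie_chamber_zero, h2, vert, vert, maps_lat_iff, maps_lat_iff,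
    show (i + 1) / 2 - -(i / 2) = i by omega, show -(i / 2) - (i + 1) / 2 = -i by omega,
    show (i + 1 + 1) / 2 - -((i + 1) / 2) = i + 1 by omega,
    show -((i + 1) / 2) - (i + 1 + 1) / 2 = -i - 1 by omega]
  refine and_congr_right fun _ => ?_
  constructor
  · rintro ⟨⟨⟨h1, _⟩, h2, h3⟩, ⟨_, h4⟩, _⟩
    exact ⟨h1, h3, h4, h2⟩
  · rintro ⟨h1, h3, h4, h2⟩
    exact ⟨⟨⟨h1, fil_mono (by omega) h4⟩, h2, h3⟩, ⟨h1, h4⟩, fil_mono (by omega) h2, h3⟩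

theorem mem_lie_stab {a : V →ₗ[k⸨X⸩] V} : a ∈ lie (stab (b.lat 0 0)) ↔ b.IsBounded 0 0 a := by
  refine and_congr_right fun _ => ?_
  have h : (∀ M, IsStableLattice (stab (b.lat 0 0)) M → ∀ v ∈ M, a v ∈ M) ↔
      ∀ v ∈ b.lat 0 0, a v ∈ b.lat 0 0 := by
    refine ⟨fun h => h _ (isStable_stab 0), fun h M hM => ?_⟩
    obtain ⟨i, rfl⟩ := stable_stab hM
    rw [maps_lat_iff] at h ⊢
    simpa using h
  rw [h, maps_lat_iff, sub_self]
  tauto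

theorem trace_eq (b : UBasis ω) (a : V →ₗ[k⸨X⸩] V) :
    LinearMap.trace k⸨X⸩ V a = b.x (a b.e0) + b.y (a b.e1) := by
  rw [LinearMap.trace_eq_matrix_trace _ b.toBasis, Matrix.trace_fin_two]
  simp only [LinearMap.toMatrix_apply]
  rfl

/-- The dimension is counted in the only off-diagonal entry in which the two conditions differ. -/
theorem relDim_of_isBounded {Q Q' : Subgroup (SpecialLinearGroup k⸨X⸩ V)} {i j i' j' : ℤ}
    (h : ∀ a, a ∈ lie Q ↔ b.IsBounded i j a) (h' : ∀ a, a ∈ lie Q' ↔ b.IsBounded i' j' a)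
    (hij : (i ≤ i' ∧ j' ≤ j) ∨ (i' ≤ i ∧ j ≤ j')) :
    (relDim Q Q' : ℤ) = max (i' - i) (j' - j) := by
  rcases hij with ⟨hi, hj⟩ | ⟨hi, hj⟩
  · have : relDim Q Q' = (i' - i).toNat := by
      refine finrank_quotient_of_fil _
        { toFun := fun a : lie Q => b.y (a.1 b.e0)
          map_add' := fun a a' => by simp
          map_smul' := fun r a => by
            simp only [Submodule.coe_smul, LinearMap.smul_apply, RingHom.id_apply]
            rw [field_smul_eq, map_smul, smul_eq_mul, HahnSeries.C_mul_eq_smul] } i _ ?_ ?_ ?_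
      · exact fun a => ((h a.1).1 a.2).2.2.2.1
      · intro r hr
        refine ⟨⟨b.x.smulRight (r • b.e1), (h _).2 ⟨?_, ?_⟩⟩, ?_⟩
        · rw [b.trace_eq]
          simp
        · simp [zero_mem, hr]
        · simp
      · rintro ⟨a, ha⟩
        change (a ∈ lie Q ∧ a ∈ lie Q') ↔ b.y (a b.e0) ∈ _
        rw [h', Int.toNat_of_nonneg (by omega), add_sub_cancel]
        obtain ⟨h1, h2, h3, h4, h5⟩ := (h a).1 ha
        exact ⟨fun hh => hh.2.2.2.2.1, fun hh => ⟨ha, h1, h2, h3, hh, fil_mono hj h5⟩⟩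
    rw [this]
    omega
  · have : relDim Q Q' = (j' - j).toNat := by
      refine finrank_quotient_of_fil _
        { toFun := fun a : lie Q => b.x (a.1 b.e1)
          map_add' := fun a a' => by simp
          map_smul' := fun r a => by
            simp only [Submodule.coe_smul, LinearMap.smul_apply, RingHom.id_apply]
            rw [field_smul_eq, map_smul, smul_eq_mul, HahnSeries.C_mul_eq_smul] } j _ ?_ ?_ ?_
      · exact fun a => ((h a.1).1 a.2).2.2.2.2
      · intro r hr
        refine ⟨⟨b.y.smulRight (r • b.e0), (h _).2 ⟨?_, ?_⟩⟩, ?_⟩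
        · rw [b.trace_eq]
          simp
        · simp [zero_mem, hr]
        · simp
      · rintro ⟨a, ha⟩
        change (a ∈ lie Q ∧ a ∈ lie Q') ↔ b.x (a b.e1) ∈ _
        rw [h', Int.toNat_of_nonneg (by omega), add_sub_cancel]
        obtain ⟨h1, h2, h3, h4, h5⟩ := (h a).1 ha
        exact ⟨fun hh => hh.2.2.2.2.2, fun hh => ⟨ha, h1, h2, h3, fil_mono hi h4, hh⟩⟩
    rw [this]
    omega

/-- The length of a chamber is its distance from the chamber `0`. -/
theorem relDim_chamber (b : UBasis ω) (i : ℤ) : relDim (b.chamber 0) (b.chamber i) = i.natAbs := by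
  have := relDim_of_isBounded (b := b) (fun _ => mem_lie_chamber (i := 0))
    (fun _ => mem_lie_chamber (i := i)) (by omega)
  omega

/-- The dimension relative to a vertex instead of a chamber. It takes different values at `i` and
`-i`, for `i ≠ 0`. -/
theorem relDim_stab_chamber (b : UBasis ω) (i : ℤ) :
    (relDim (stab (b.lat 0 0)) (b.chamber i) : ℤ) = max (i + 1) (-i) := by
  have := relDim_of_isBounded (b := b) (fun _ => mem_lie_stab)
    (fun _ => mem_lie_chamber (i := i)) (by omega)
  omega

/-! ### The affine Weyl group as the set of chambers of an apartment -/

/-- The chambers of an apartment as Iwahori subgroups. -/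
noncomputable def iw (b : UBasis ω) (i : ℤ) : Iwahori ω := ⟨b.chamber i, b.isIwahori_chamber i⟩

/-- The element of the affine Weyl group that sends the chamber `0` of an apartment to the chamber
`i`. -/
noncomputable def w (b : UBasis ω) (i : ℤ) : Weyl ω := pos (b.iw 0) (b.iw i)

theorem pos_iw_eq (b c : UBasis ω) (i j : ℤ) : pos (b.iw i) (b.iw j) = pos (c.iw i) (c.iw j) := by
  obtain ⟨g, rfl⟩ := b.exists_map_eq c
  exact Quotient.sound ⟨g, conj_chamber g i, conj_chamber g j⟩

/-- Since `SL(V)` acts transitively on bases of volume `ω`, the element `w i` is independent of the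
basis. -/
theorem w_eq (b c : UBasis ω) (i : ℤ) : b.w i = c.w i := pos_iw_eq b c 0 i

theorem wmul_zero (i : ℤ) : wmul i 0 = i := by simp [wmul]

theorem iw_apt (b : UBasis ω) (i j : ℤ) : (b.apt i).iw j = b.iw (wmul i j) :=
  Subtype.ext (chamber_apt i j)

/-- The inverse for `wmul`. -/
def winv (i : ℤ) : ℤ := if Even i then -i else i

theorem wmul_winv (i j : ℤ) : wmul i (wmul (winv i) j) = j := by
  unfold wmul winv
  rcases Int.even_or_odd i with hi | hi
  · have : Even (-i) := hi.neg
    simp [hi, this]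
  · have : ¬ Even i := Int.not_even_iff_odd.2 hi
    simp [this]

theorem pos_iw (b : UBasis ω) (i j : ℤ) : pos (b.iw i) (b.iw j) = b.w (wmul (winv i) j) := by
  rw [b.w_eq (b.apt i), w, iw_apt, iw_apt, wmul_zero, wmul_winv]

theorem len_w (b : UBasis ω) (i : ℤ) : len (b.w i) = i.natAbs := b.relDim_chamber i

/-- The length of `w i` is `|i|`. An element of `SL(V)` that fixes the chamber `0` also fixes its
unimodular vertex, and `relDim_stab_chamber` then separates `i` from `-i`. -/
theorem w_injective (b : UBasis ω) : Function.Injective b.w := by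
  intro i j hij
  have h1 : i.natAbs = j.natAbs := by rw [← b.len_w, ← b.len_w, hij]
  obtain ⟨g, h2, h3⟩ := Quotient.exact hij
  have h2 : conj g (b.chamber 0) = b.chamber 0 := h2
  have h3 : conj g (b.chamber i) = b.chamber j := h3
  have h4 : (b.map g).lat 0 0 = b.lat 0 0 := by
    rw [conj_chamber] at h2
    exact (vert_eq_of_chamber_le h2.ge).1
  have h5 := relDim_conj g (stab (b.lat 0 0)) (b.chamber i)
  rw [h3, conj_stab, translate_lat, h4] at h5
  have h6 := b.relDim_stab_chamber i
  rw [← h5, b.relDim_stab_chamber j] at h6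
  omega

theorem exists_iw (b : UBasis ω) (B : Iwahori ω) : ∃ c : UBasis ω, B = c.iw 0 := by
  obtain ⟨c, hc⟩ := b.isIwahori_iff.1 B.2
  exact ⟨c, Subtype.ext hc⟩

/-- Two chambers whose lattices are at distance `2n`, in a common apartment. -/
theorem exists_apartment_chamber (b c : UBasis ω) : ∃ (a : UBasis ω) (n : ℤ), 0 ≤ n ∧
    b.lat 0 0 = a.lat 0 0 ∧ c.lat 0 0 = a.lat (-n) n ∧
    (b.iw 0 = a.iw 0 ∨ b.iw 0 = a.iw (-1)) ∧
    (c.iw 0 = a.iw (2 * n) ∨ c.iw 0 = a.iw (2 * n - 1)) := by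
  obtain ⟨a, n, hn, h1, h2, h3, h4⟩ := exists_apartment b c
  have key : ∀ (b : UBasis ω) (i : ℤ), b.lat 0 0 = a.vert i → b.lat 0 1 = a.vert (i + 1) →
      b.iw 0 = a.iw i := by
    intro b i h h'
    apply Subtype.ext
    change b.chamber 0 = a.chamber i
    rw [chamber, chamber, zero_add, vert_zero, vert_one, h, h']
  have key' : ∀ (b : UBasis ω) (i : ℤ), b.lat 0 0 = a.vert (i + 1) → b.lat 0 1 = a.vert i →
      b.iw 0 = a.iw i := by
    intro b i h h'
    apply Subtype.ext
    change b.chamber 0 = a.chamber i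
    rw [chamber, chamber, zero_add, vert_zero, vert_one, h, h', inf_comm]
  refine ⟨a, n, hn, h1, h2, ?_, ?_⟩
  · rcases h3 with h3 | h3
    · exact Or.inl (key _ _ h1 h3)
    · exact Or.inr (key' _ _ h1 h3)
  · rcases h4 with h4 | h4
    · exact Or.inl (key _ _ (by rw [vert_even, h2]) (by rw [vert_odd, h4]))
    · refine Or.inr (key' _ _ (by rw [sub_add_cancel, vert_even, h2]) ?_)
      rw [h4, show 2 * n - 1 = 2 * (n - 1) + 1 by ring, vert_odd]
      congr 1 <;> ring

/-- Any two Iwahori subgroups lie in a common apartment, in which the first is the chamber `0`. -/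
theorem exists_iw_pair (b : UBasis ω) (B B' : Iwahori ω) :
    ∃ (c : UBasis ω) (i : ℤ), B = c.iw 0 ∧ B' = c.iw i := by
  obtain ⟨c, rfl⟩ := b.exists_iw B
  obtain ⟨c', rfl⟩ := b.exists_iw B'
  obtain ⟨a, n, -, -, -, h1, h2⟩ := exists_apartment_chamber c c'
  have key : ∀ i, c.iw 0 = a.iw i → ∃ (d : UBasis ω) (j : ℤ), c.iw 0 = d.iw 0 ∧ c'.iw 0 = d.iw j := by
    intro i hi
    have h : ∀ j, a.iw j = (a.apt i).iw (wmul (winv i) j) := fun j => by rw [iw_apt, wmul_winv]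
    rcases h2 with h2 | h2
    · exact ⟨a.apt i, _, by rw [iw_apt, wmul_zero, hi], by rw [h2, h]⟩
    · exact ⟨a.apt i, _, by rw [iw_apt, wmul_zero, hi], by rw [h2, h]⟩
  rcases h1 with h1 | h1
  · exact key _ h1
  · exact key _ h1

/-- Every pair of Iwahori subgroups is in the position of two chambers of an apartment. -/
theorem w_surjective (b : UBasis ω) : Function.Surjective b.w := by
  intro u
  induction u using Quotient.inductionOn with
  | h p =>
    obtain ⟨c, i, h1, h2⟩ := b.exists_iw_pair p.1 p.2
    refine ⟨i, ?_⟩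
    change _ = pos p.1 p.2
    rw [h1, h2, b.w_eq c]
    rfl

/-- Three chambers lie in a common apartment if the middle one separates the others. -/
theorem exists_iw_triple (b : UBasis ω) (B B' B'' : Iwahori ω) {i j : ℤ}
    (hi : pos B' B = b.w i) (hj : pos B' B'' = b.w j) (hij : (i ≤ 0 ∧ 0 ≤ j) ∨ (j ≤ 0 ∧ 0 ≤ i)) :
    ∃ c : UBasis ω, B' = c.iw 0 ∧ B = c.iw i ∧ B'' = c.iw j := by
  wlog hle : i ≤ 0 ∧ 0 ≤ j generalizing B B'' i j
  · obtain ⟨c, h1, h2, h3⟩ := this B'' B hj hi hij.symm (by omega)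
    exact ⟨c, h1, h3, h2⟩
  obtain ⟨d, i', hd1, hd2⟩ := b.exists_iw_pair B' B
  obtain ⟨e, j', he1, he2⟩ := b.exists_iw_pair B' B''
  obtain rfl : i' = i := by
    apply b.w_injective
    rw [← hi, hd1, hd2, b.w_eq d]
    rfl
  obtain rfl : j' = j := by
    apply b.w_injective
    rw [← hj, he1, he2, b.w_eq e]
    rfl
  -- the two bases differ by an element of the Iwahori subgroup
  have hch : e.chamber 0 = d.chamber 0 := by
    have : e.iw 0 = d.iw 0 := by rw [← he1, hd1]
    exact congrArg Subtype.val this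
  obtain ⟨h0, h1⟩ := vert_eq_of_chamber_le hch.ge
  obtain ⟨⟨-, hq'⟩, hr', -⟩ := (lat_eq_iff rfl).1 h0.symm
  obtain ⟨⟨hp, hq⟩, hr, hs⟩ := (lat_eq_iff rfl).1 h1.symm
  simp only [sub_self, sub_zero, zero_sub] at hp hq hr hs hr' hq'
  have hdet := e.det_eq d
  have hxd := e.x_change d
  have hyd := e.y_change d
  set p := e.x d.e0
  set q := e.y d.e0
  set r := e.x d.e1
  set s := e.y d.e1
  have hs0 : s.coeff 0 ≠ 0 := by
    intro h
    have hs1 : s ∈ fil k 1 := mem_fil_one_iff.2 ⟨hs, h⟩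
    have h2 := sub_mem (mul_mem_fil (l := 1) hp hs1 (by omega))
      (mul_mem_fil (l := 1) hq hr' (by omega))
    rw [hdet, one_mem_fil] at h2
    omega
  have hsf : s ∉ fil k (0 + 1) := fun h => hs0 (mem_fil_one_iff.1 h).2
  have hsi := inv_mem_fil_of_not_mem hsf
  have hsne : s ≠ 0 := fun h => hs0 (by rw [h]; rfl)
  rw [neg_zero] at hsi
  -- the basis consisting of multiples of the first vector of `e` and the second of `d`
  let c : UBasis ω := e.ofCoeffs s⁻¹ 0 r s (by rw [inv_mul_cancel₀ hsne]; ring)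
  have hce : ∀ l, 0 ≤ l → c.chamber l = e.chamber l := by
    have : ∀ l, 0 ≤ l → c.vert l = e.vert l := by
      intro l hl
      rw [vert, vert, lat_eq_iff rfl]
      simp only [c, x_ofCoeffs_e0, y_ofCoeffs_e0, x_ofCoeffs_e1, y_ofCoeffs_e1, sub_self]
      exact ⟨⟨hsi, zero_mem _⟩, fil_mono (by omega) hr', hs⟩
    intro l hl
    rw [chamber, chamber, this l hl, this (l + 1) (by omega)]
  have hcd : ∀ l, l ≤ 0 → c.chamber l = d.chamber l := by
    have : ∀ l, l ≤ 1 → c.vert l = d.vert l := by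
      intro l hl
      rw [vert, vert, lat_eq_iff rfl, hxd, hyd, hxd, hyd]
      simp only [c, x_ofCoeffs_e0, y_ofCoeffs_e0, x_ofCoeffs_e1, y_ofCoeffs_e1, sub_self]
      refine ⟨⟨?_, ?_⟩, ?_, ?_⟩
      · rw [mul_zero, sub_zero, mul_inv_cancel₀ hsne]
        exact one_mem_fil.2 le_rfl
      · rw [mul_zero, zero_sub, neg_mem_iff]
        exact mul_mem_fil hq hsi (by omega)
      · rw [mul_comm, sub_self]
        exact zero_mem _
      · rw [hdet]
        exact one_mem_fil.2 le_rfl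
    intro l hl
    rw [chamber, chamber, this l (by omega), this (l + 1) (by omega)]
  refine ⟨c, ?_, ?_, ?_⟩
  · rw [hd1]
    exact Subtype.ext (hcd 0 le_rfl).symm
  · rw [hd2]
    exact Subtype.ext (hcd _ hle.1).symm
  · rw [he2]
    exact Subtype.ext (hce _ hle.2).symm

end Apartments

/-! ### The infinite dihedral group structure -/

theorem wmul_assoc (i j l : ℤ) : wmul (wmul i j) l = wmul i (wmul j l) := by
  unfold wmul
  simp only [Int.even_iff]
  split_ifs <;> omega

theorem zero_wmul (i : ℤ) : wmul 0 i = i := by simp [wmul]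

theorem winv_wmul (i : ℤ) : wmul (winv i) i = 0 := by
  unfold wmul winv
  simp only [Int.even_iff]
  split_ifs <;> omega

/-- The index set `ℤ` of the chambers of an apartment with the group law `wmul`. -/
structure Alcove where
  idx : ℤ

theorem Alcove.ext' {x y : Alcove} (h : x.idx = y.idx) : x = y := by
  cases x
  cases y
  exact congrArg Alcove.mk h

instance : Mul Alcove := ⟨fun x y => ⟨wmul x.idx y.idx⟩⟩
instance : One Alcove := ⟨⟨0⟩⟩
instance : Inv Alcove := ⟨fun x => ⟨winv x.idx⟩⟩

instance : Group Alcove := Group.ofLeftAxioms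
  (fun x y z => Alcove.ext' (wmul_assoc x.idx y.idx z.idx))
  (fun x => Alcove.ext' (by change wmul 0 x.idx = x.idx; exact zero_wmul x.idx))
  (fun x => Alcove.ext' (by change wmul (winv x.idx) x.idx = 0; exact winv_wmul x.idx))

/-- The elements of the affine Weyl group are in bijection with the chambers of an apartment. -/
noncomputable def wEquiv (b : UBasis ω) : Alcove ≃ Weyl ω :=
  Equiv.ofBijective (fun x => b.w x.idx)
    ⟨fun _ _ h => Alcove.ext' (b.w_injective h), fun u => by
      obtain ⟨i, hi⟩ := b.w_surjective u
      exact ⟨⟨i⟩, hi⟩⟩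

/-- The group structure on the affine Weyl group. -/
noncomputable abbrev weylGroup (b : UBasis ω) : Group (Weyl ω) := b.wEquiv.symm.group

/-- In the group structure transported from `Alcove`, the products of the elements `w i` are given
by `wmul`. -/
theorem weylGroup_mul (b : UBasis ω) (i j : ℤ) :
    b.weylGroup.mul (b.w i) (b.w j) = b.w (wmul i j) := by
  have h : ∀ i, b.wEquiv.symm (b.w i) = ⟨i⟩ := fun i => b.wEquiv.symm_apply_apply ⟨i⟩
  change b.wEquiv (b.wEquiv.symm (b.w i) * b.wEquiv.symm (b.w j)) = _
  rw [h, h]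
  rfl

theorem mem_simples_iff (b : UBasis ω) {u : Weyl ω} :
    u ∈ simples ω ↔ u = b.w 1 ∨ u = b.w (-1) := by
  obtain ⟨i, rfl⟩ := b.w_surjective u
  change len (b.w i) = 1 ↔ _
  rw [len_w, b.w_injective.eq_iff, b.w_injective.eq_iff]
  omega

theorem pos_swap (b : UBasis ω) {B B' : Iwahori ω} {i : ℤ} (h : pos B' B = b.w i) :
    pos B B' = b.w (winv i) := by
  obtain ⟨c, j, rfl, rfl⟩ := b.exists_iw_pair B' B
  rw [b.w_eq c] at h
  obtain rfl := c.w_injective h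
  rw [pos_iw, wmul_zero, b.w_eq c]

section Law

variable [Group (Weyl ω)] {b : UBasis ω}

/-- Here and below, the hypothesis `h` says that the given group structure on the affine Weyl group
is the one transported from the group law `wmul` on the chambers. -/
theorem w_zero_eq_one (h : ∀ i j, b.w i * b.w j = b.w (wmul i j)) : b.w 0 = 1 := by
  have := h 0 0
  rw [zero_wmul] at this
  exact mul_eq_left.1 this

theorem inv_w (h : ∀ i j, b.w i * b.w j = b.w (wmul i j)) (i : ℤ) :
    (b.w i)⁻¹ = b.w (winv i) := by
  rw [inv_eq_iff_mul_eq_one, ← w_zero_eq_one h, h]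
  congr 1
  simpa [wmul_zero] using wmul_winv i 0

theorem simple_mul_self (h : ∀ i j, b.w i * b.w j = b.w (wmul i j)) {s : Weyl ω}
    (hs : s ∈ simples ω) : s * s = 1 := by
  rw [← w_zero_eq_one h]
  rcases b.mem_simples_iff.1 hs with rfl | rfl <;> rw [h] <;> rfl

/-- A word without repetitions of consecutive letters, in the two simple reflections, has its
length as the distance between the chambers it connects. -/
theorem exists_index_of_isChain (h : ∀ i j, b.w i * b.w j = b.w (wmul i j))
    {M : CoxeterMatrix (simples ω)} {W : Type*} [Group W] (cs : CoxeterSystem M W)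
    (φ : W →* Weyl ω) (hφ : ∀ s, φ (cs.simple s) = s) (l : List (simples ω))
    (hl : l.IsChain (· ≠ ·)) : ∃ i : ℤ, φ (cs.wordProd l) = b.w i ∧ i.natAbs = l.length ∧
      (∀ s ∈ l.head?, (s : Weyl ω) = b.w 1 → 0 < i) ∧
      ∀ s ∈ l.head?, (s : Weyl ω) = b.w (-1) → i < 0 := by
  induction l with
  | nil => exact ⟨0, by simp [w_zero_eq_one h], rfl, by simp, by simp⟩
  | cons s l ih =>
    obtain ⟨i, h1, h2, h3, h4⟩ := ih hl.tail
    have hne : b.w 1 ≠ b.w (-1) := fun h => by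
      have := b.w_injective h
      omega
    rw [cs.wordProd_cons, map_mul, hφ, h1, List.length_cons]
    have hhead : ∀ t ∈ l.head?, t ≠ s := by
      intro t ht hts
      rw [List.isChain_cons] at hl
      exact hl.1 t ht hts.symm
    rcases b.mem_simples_iff.1 s.2 with hs | hs
    · have hi : i ≤ 0 := by
        rcases l with - | ⟨t, l⟩
        · simp at h2
          omega
        · refine (h4 t rfl ?_).le
          rcases b.mem_simples_iff.1 t.2 with ht | ht
          · exact absurd (Subtype.ext (ht.trans hs.symm)) (hhead t rfl)
          · exact ht
      refine ⟨1 - i, ?_, by omega, ?_, ?_⟩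
      · rw [hs, h]
        rfl
      · intros
        omega
      · rintro t ht hts
        obtain rfl : s = t := by simpa using ht
        exact absurd (hs.symm.trans hts) hne
    · have hi : 0 ≤ i := by
        rcases l with - | ⟨t, l⟩
        · simp at h2
          omega
        · refine (h3 t rfl ?_).le
          rcases b.mem_simples_iff.1 t.2 with ht | ht
          · exact ht
          · exact absurd (Subtype.ext (ht.trans hs.symm)) (hhead t rfl)
      refine ⟨-1 - i, ?_, by omega, ?_, ?_⟩
      · rw [hs, h]
        rfl
      · rintro t ht hts
        obtain rfl : s = t := by simpa using ht
        exact absurd (hts.symm.trans hs) hne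
      · intros
        omega

theorem isChain_of_isReduced {B W : Type*} [Group W] {M : CoxeterMatrix B}
    (cs : CoxeterSystem M W) (l : List B) (hl : cs.IsReduced l) : l.IsChain (· ≠ ·) := by
  induction l with
  | nil => exact List.IsChain.nil
  | cons s l ih =>
    rw [List.isChain_cons]
    refine ⟨?_, ih (by simpa using hl.drop 1)⟩
    rintro t ht rfl
    rcases l with - | ⟨t, l⟩
    · simp at ht
    · obtain rfl : t = s := by simpa using ht
      have h1 : cs.length (cs.wordProd (t :: t :: l)) = (t :: t :: l).length := hl
      rw [cs.wordProd_cons, cs.wordProd_cons, cs.simple_mul_simple_cancel_left] at h1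
      have := cs.length_wordProd_le l
      simp at h1
      omega

/-- The affine Weyl group is the Coxeter group of its simple reflections. The homomorphism from the
abstract Coxeter group is injective because, by `exists_index_of_isChain`, a nonempty reduced word
moves the chamber `0`. -/
theorem exists_coxeterSystem (h : ∀ i j, b.w i * b.w j = b.w (wmul i j)) :
    ∃ (m : CoxeterMatrix (simples ω)) (cs : CoxeterSystem m (Weyl ω)),
      (∀ s, cs.simple s = s) ∧ ∀ w, cs.length w = len w := by
  classical
  -- the Coxeter matrix of the infinite dihedral group, where the entry `0` imposes no relation
  let m : CoxeterMatrix (simples ω) :=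
    { M := fun s t => if s = t then 1 else 0
      isSymm := by
        ext s t
        exact if_congr eq_comm rfl rfl
      diagonal := by simp
      off_diagonal := fun s t hst => by simp [hst] }
  let cs := m.toCoxeterSystem
  have hlift : m.IsLiftable (fun s : simples ω => (s : Weyl ω)) := by
    intro s t
    by_cases hst : s = t
    · subst hst
      rw [simple_mul_self h s.2, one_pow]
    · have : m s t = 0 := if_neg hst
      rw [this, pow_zero]
  let φ : m.Group →* Weyl ω := cs.lift ⟨_, hlift⟩
  have hφ : ∀ s, φ (cs.simple s) = s := fun s => cs.lift_apply_simple hlift s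
  have hinj : Function.Injective φ := by
    rw [injective_iff_map_eq_one]
    intro x hx
    obtain ⟨l, hl, rfl⟩ := cs.exists_isReduced x
    obtain ⟨i, h1, h2, -⟩ := exists_index_of_isChain h cs φ hφ l (isChain_of_isReduced cs l hl)
    rw [hx, ← w_zero_eq_one h] at h1
    obtain rfl := b.w_injective h1
    have : l = [] := List.length_eq_zero_iff.1 (by simpa using h2.symm)
    rw [this, cs.wordProd_nil]
  have hsurj : Function.Surjective φ := by
    intro u
    obtain ⟨i, rfl⟩ := b.w_surjective u
    have hp : b.w 1 ∈ φ.range := ⟨_, hφ ⟨b.w 1, b.mem_simples_iff.2 (Or.inl rfl)⟩⟩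
    have hm : b.w (-1) ∈ φ.range := ⟨_, hφ ⟨b.w (-1), b.mem_simples_iff.2 (Or.inr rfl)⟩⟩
    change b.w i ∈ φ.range
    have key : ∀ i : ℤ, b.w i ∈ φ.range → b.w (i + 1) ∈ φ.range ∧ b.w (i - 1) ∈ φ.range := by
      intro i hi
      have h1 := mul_mem hi hp
      have h2 := mul_mem hi hm
      rw [h] at h1 h2
      by_cases he : Even i
      · simp only [wmul, if_pos he] at h1 h2
        exact ⟨h1, h2⟩
      · simp only [wmul, if_neg he, sub_neg_eq_add] at h1 h2
        exact ⟨h2, h1⟩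
    induction i using Int.induction_on with
    | zero => rw [w_zero_eq_one h]; exact one_mem _
    | succ i ih => exact (key _ ih).1
    | pred i ih => exact (key _ ih).2
  let e : m.Group ≃* Weyl ω := MulEquiv.ofBijective φ ⟨hinj, hsurj⟩
  have hs : ∀ s, (cs.map e).simple s = s := fun s => hφ s
  refine ⟨m, cs.map e, hs, fun u => ?_⟩
  obtain ⟨l, hl, rfl⟩ := (cs.map e).exists_isReduced u
  obtain ⟨i, h1, h2, -⟩ := exists_index_of_isChain h (cs.map e) (MonoidHom.id _) hs l
    (isChain_of_isReduced _ l hl)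
  rw [hl.eq, ← h2, ← len_w b i, ← h1]
  rfl

/-- The group law `wmul` makes positions multiplicative and gives a Coxeter group. -/
theorem isWeylGroup_of_mul (h : ∀ i j, b.w i * b.w j = b.w (wmul i j)) :
    IsWeylGroup ω (inferInstance : Group (Weyl ω)) where
  orderOf_simple s hs := by
    refine orderOf_eq_prime (by rw [pow_two, simple_mul_self h hs]) ?_
    rintro rfl
    have : len (b.w 0) = 1 := by
      rw [w_zero_eq_one h]
      exact hs
    rw [len_w] at this
    simp at this
  pos_mul B B' B'' hlen := by
    obtain ⟨i, hi⟩ := b.w_surjective (pos B' B)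
    obtain ⟨j, hj⟩ := b.w_surjective (pos B' B'')
    rw [b.pos_swap hi.symm, ← hj, h] at hlen ⊢
    rw [len_w, len_w, len_w] at hlen
    obtain ⟨c, rfl, rfl, rfl⟩ := b.exists_iw_triple B B' B'' hi.symm hj.symm (by
      unfold wmul winv at hlen
      simp only [Int.even_iff] at hlen
      split_ifs at hlen <;> omega)
    rw [pos_iw, b.w_eq c]
  coxeter := exists_coxeterSystem h

/-- The axioms determine the products by simple elements: the length goes up when a chamber
farther away is reached, because otherwise a product that is already known would be repeated. -/
theorem mul_eq_of_isWeylGroup (b : UBasis ω) (hW : IsWeylGroup ω (inferInstance : Group (Weyl ω)))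
    (i j : ℤ) : b.w i * b.w j = b.w (wmul i j) := by
  obtain ⟨m, cs, hs, hl⟩ := hW.coxeter
  have h0 : b.w 0 = 1 := by
    rw [← cs.length_eq_zero_iff, hl, len_w]
    rfl
  have hsimple : ∀ σ : ℤ, σ.natAbs = 1 → b.w σ ∈ simples ω := fun σ hσ => by
    rw [b.mem_simples_iff]
    rcases Int.natAbs_eq σ with h | h <;> rw [hσ] at h <;> simp [h]
  have hsq : ∀ σ : ℤ, σ.natAbs = 1 → b.w σ * b.w σ = 1 := fun σ hσ => by
    have := cs.simple_mul_simple_self ⟨_, hsimple σ hσ⟩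
    rwa [hs] at this
  have hinvol : ∀ i σ : ℤ, σ.natAbs = 1 → wmul (wmul i σ) σ = i := by
    intro i σ hσ
    unfold wmul
    simp only [Int.even_iff]
    split_ifs <;> omega
  -- one of the two simple steps from `i ≠ 0` leads towards `0`, and the other one away from it
  have hstep : ∀ i : ℤ, i ≠ 0 → ∃ i' τ : ℤ, i'.natAbs + 1 = i.natAbs ∧ τ.natAbs = 1 ∧
      wmul i' τ = i ∧ ∀ σ : ℤ, σ.natAbs = 1 → σ ≠ τ → (wmul i σ).natAbs = i.natAbs + 1 := by
    intro i hi
    rcases lt_or_gt_of_ne hi with h | h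
    · rcases Int.even_or_odd' i with ⟨l, rfl | rfl⟩
      · refine ⟨2 * l + 1, 1, by omega, rfl, ?_, fun σ hσ hne => ?_⟩ <;>
          · unfold wmul
            simp only [Int.even_iff]
            split_ifs <;> omega
      · refine ⟨2 * l + 1 + 1, -1, by omega, rfl, ?_, fun σ hσ hne => ?_⟩ <;>
          · unfold wmul
            simp only [Int.even_iff]
            split_ifs <;> omega
    · rcases Int.even_or_odd' i with ⟨l, rfl | rfl⟩
      · refine ⟨2 * l - 1, -1, by omega, rfl, ?_, fun σ hσ hne => ?_⟩ <;>
          · unfold wmul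
            simp only [Int.even_iff]
            split_ifs <;> omega
      · refine ⟨2 * l + 1 - 1, 1, by omega, rfl, ?_, fun σ hσ hne => ?_⟩ <;>
          · unfold wmul
            simp only [Int.even_iff]
            split_ifs <;> omega
  -- products with simple elements, by induction on the length of the first factor
  have hmul : ∀ n : ℕ, ∀ i : ℤ, i.natAbs = n → ∀ σ : ℤ, σ.natAbs = 1 →
      b.w i * b.w σ = b.w (wmul i σ) := by
    intro n
    induction n with
    | zero =>
      intro i hi σ hσ
      obtain rfl : i = 0 := by omega
      rw [h0, one_mul, zero_wmul]
    | succ n ih =>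
      intro i hi σ hσ
      obtain ⟨i', τ, h1, h2, h3, h4⟩ := hstep i (by omega)
      have h5 := ih i' (by omega) τ h2
      rw [h3] at h5
      by_cases hστ : σ = τ
      · subst hστ
        rw [← h5, mul_assoc, hsq σ hσ, mul_one, ← h3, hinvol _ _ hσ]
      · have h6 := cs.length_mul_simple (b.w i) ⟨_, hsimple σ hσ⟩
        rw [hs, hl, hl, len_w] at h6
        rcases h6 with h6 | h6
        · have h7 := hW.pos_mul (b.iw 0) (b.iw i) (b.iw (wmul i σ))
          have h8 : pos (b.iw i) (b.iw (wmul i σ)) = b.w σ := by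
            rw [pos_iw, ← wmul_assoc, winv_wmul, zero_wmul]
          rw [h8] at h7
          change len (b.w i * b.w σ) = len (b.w i) + len (b.w σ) →
            b.w (wmul i σ) = b.w i * b.w σ at h7
          rw [len_w, len_w, hσ] at h7
          exact (h7 h6).symm
        · exfalso
          -- a shorter product `w j` would give `w i = w j * w σ`, a product that is already known
          obtain ⟨j, hj⟩ := b.w_surjective (b.w i * b.w σ)
          change len (b.w i * b.w σ) + 1 = _ at h6
          rw [← hj, len_w] at h6
          have h7 := ih j (by omega) σ hσ
          rw [hj, mul_assoc, hsq σ hσ, mul_one] at h7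
          have h8 := b.w_injective h7
          have h9 := h4 σ hσ hστ
          rw [h8, hinvol _ _ hσ] at h9
          rw [h8] at h6
          omega
  -- the general case, by writing the second factor as a product of simple elements
  have hfull : ∀ n : ℕ, ∀ j : ℤ, j.natAbs = n → ∀ i, b.w i * b.w j = b.w (wmul i j) := by
    intro n
    induction n with
    | zero =>
      intro j hj i
      obtain rfl : j = 0 := by omega
      rw [h0, mul_one, wmul_zero]
    | succ n ih =>
      intro j hj i
      obtain ⟨j', τ, h1, h2, h3, -⟩ := hstep j (by omega)
      rw [← h3, ← hmul _ j' rfl τ h2, ← mul_assoc, ih j' (by omega), hmul _ _ rfl τ h2, wmul_assoc]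
  exact hfull _ j rfl i

end Law

/-- There is exactly one group structure on `W'` with the required properties. -/
theorem existsUnique_isWeylGroup (b : UBasis ω) : ∃! grp : Group (Weyl ω), IsWeylGroup ω grp := by
  refine ⟨b.weylGroup, @isWeylGroup_of_mul _ _ _ _ _ _ _ _ _ _ b.weylGroup b b.weylGroup_mul,
    fun grp h => ?_⟩
  have h1 := @mul_eq_of_isWeylGroup _ _ _ _ _ _ _ _ _ _ grp b h
  apply Group.ext
  funext u v
  obtain ⟨i, rfl⟩ := b.w_surjective u
  obtain ⟨j, rfl⟩ := b.w_surjective v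
  exact (h1 i j).trans (b.weylGroup_mul i j).symm

/-! ### Relative codimension -/

/-- If `M ∩ N` is the vertex that is `n` steps away in a coordinate direction, then `dim M / (M ∩ N)
= n`. -/
theorem codim_eq {b : UBasis ω} {N : Submodule k⟦X⟧ V} {n : ℕ} (h : b.lat 0 0 ⊓ N = b.lat 0 n) :
    codim (b.lat 0 0) N = n := by
  rw [codim, h]
  have e := (Submodule.Quotient.restrictScalarsEquiv k
    ((b.lat 0 n).submoduleOf (b.lat 0 0))).finrank_eq
  rw [← e]
  refine finrank_quotient_of_fil _
    { toFun := fun v : b.lat 0 0 => b.y v.1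
      map_add' := fun v v' => by simp
      map_smul' := fun r v => by
        have : ((r • v : b.lat 0 0) : V) = r • (v : V) := rfl
        rw [this, field_smul_eq, map_smul, smul_eq_mul, HahnSeries.C_mul_eq_smul, RingHom.id_apply] }
    0 n (fun v => v.2.2) (fun c hc => ⟨⟨c • b.e1, ?_⟩, ?_⟩) ?_
  · rw [mem_lat]
    simp [zero_mem, hc]
  · simp
  · intro v
    have hv : b.x v.1 ∈ fil k 0 := v.2.1
    change v.1 ∈ b.lat 0 n ↔ b.y v.1 ∈ fil k (0 + n)
    rw [mem_lat, zero_add]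
    exact and_iff_right hv

theorem codim_lat (b : UBasis ω) (n : ℕ) : codim (b.lat 0 0) (b.lat (-n) n) = n := by
  apply codim_eq
  rw [lat_inf]
  congr 1 <;> omega

/-- Reflection of an apartment that exchanges the vertices `0` and `2n`. -/
theorem exists_reflect (b : UBasis ω) (n : ℤ) : ∃ c : UBasis ω, ∀ i, c.vert i = b.vert (2 * n - i) :=
  ⟨b.apt (2 * n - 1), fun i => by
    rw [vert_apt_odd (by rw [Int.not_even_iff_odd]; exact ⟨n - 1, by ring⟩)]
    congr 1
    ring⟩

theorem codim_lat' (b : UBasis ω) (n : ℕ) : codim (b.lat (-n) n) (b.lat 0 0) = n := by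
  obtain ⟨c, hc⟩ := b.exists_reflect n
  have h1 := hc 0
  have h2 := hc (2 * n)
  rw [sub_zero, vert_even, vert_zero] at h1
  rw [sub_self, vert_even, vert_zero] at h2
  rw [← h1, ← h2, codim_lat]

/-! ### Bruhat order and relative positions -/

section Law

variable [Group (Weyl ω)] {b : UBasis ω}

theorem eq_or_len_lt_of_bruhatLE {u v : Weyl ω} (h : BruhatLE u v) : u = v ∨ len u < len v := by
  induction h with
  | refl => exact Or.inl rfl
  | tail _ h ih =>
    right
    rcases ih with rfl | ih
    · exact h.1
    · exact ih.trans h.1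

theorem bruhatLE_antisymm {u v : Weyl ω} (h : BruhatLE u v) (h' : BruhatLE v u) : u = v := by
  rcases eq_or_len_lt_of_bruhatLE h with h | h
  · exact h
  · rcases eq_or_len_lt_of_bruhatLE h' with h' | h'
    · exact h'.symm
    · omega

/-- In the infinite dihedral group the elements of odd length are the reflections, so the Bruhat
order compares any two elements of different lengths. -/
theorem bruhatLE_of_lt (h : ∀ i j, b.w i * b.w j = b.w (wmul i j)) {i j : ℤ}
    (hij : i.natAbs < j.natAbs) : BruhatLE (b.w i) (b.w j) := by
  have hrefl : ∀ l : ℤ, ¬ Even l → ∃ x, ∃ s ∈ simples ω, b.w l = x * s * x⁻¹ := by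
    intro l hl
    rw [Int.not_even_iff] at hl
    rcases (by omega : l % 4 = 1 ∨ l % 4 = 3) with h4 | h4
    · refine ⟨b.w (2 * (l / 4)), b.w 1, b.mem_simples_iff.2 (Or.inl rfl), ?_⟩
      rw [inv_w h, h, h]
      congr 1
      unfold wmul winv
      simp only [Int.even_iff]
      split_ifs <;> omega
    · refine ⟨b.w (2 * (l / 4 + 1)), b.w (-1), b.mem_simples_iff.2 (Or.inr rfl), ?_⟩
      rw [inv_w h, h, h]
      congr 1
      unfold wmul winv
      simp only [Int.even_iff]
      split_ifs <;> omega
  have hodd : ∀ i j : ℤ, i.natAbs < j.natAbs → ¬ Even (i + j) → BruhatLE (b.w i) (b.w j) := by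
    intro i j hij ho
    obtain ⟨x, s, hs, hx⟩ := hrefl (wmul (winv i) j) (by
      rw [Int.even_iff] at ho ⊢
      unfold wmul winv
      simp only [Int.even_iff]
      split_ifs <;> omega)
    refine Relation.ReflTransGen.single ⟨by rw [len_w, len_w]; exact hij, x, s, hs, ?_⟩
    rw [← hx, h, wmul_winv]
  by_cases he : Even (i + j)
  · rw [Int.even_iff] at he
    refine Relation.ReflTransGen.trans (hodd i (i.natAbs + 1) (by omega) ?_)
      (hodd (i.natAbs + 1) j (by omega) ?_) <;>
    · rw [Int.even_iff]
      omega
  · exact hodd i j hij he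

theorem IsPos.unique {P Q : Subgroup (SpecialLinearGroup k⸨X⸩ V)} {u v : Weyl ω}
    (hu : IsPos P Q u) (hv : IsPos P Q v) : u = v := by
  obtain ⟨hu1, B, B', h1, h2, rfl⟩ := hu
  obtain ⟨hv1, C, C', h3, h4, rfl⟩ := hv
  exact bruhatLE_antisymm (hu1 _ _ h3 h4) (hv1 _ _ h1 h2)

theorem isPos_iwahori (B B' : Iwahori ω) (b : UBasis ω) : IsPos B.1 B'.1 (pos B B') := by
  have key : ∀ C D : Iwahori ω, C.1 ≤ D.1 → C = D := by
    intro C D h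
    obtain ⟨c, rfl⟩ := b.exists_iw C
    obtain ⟨d, rfl⟩ := b.exists_iw D
    exact Subtype.ext (chamber_eq_of_le h)
  refine ⟨fun C C' h h' => ?_, B, B', le_rfl, le_rfl, rfl⟩
  rw [key _ _ h, key _ _ h']
  exact Relation.ReflTransGen.refl

end Law

/-- The positions of the chambers at two vertices at distance `2n`. -/
theorem pos_cases {a : UBasis ω} {n : ℕ} {B B' : Iwahori ω} (hB : B.1 ≤ stab (a.lat 0 0))
    (hB' : B'.1 ≤ stab (a.lat (-n) n)) (b : UBasis ω) : ∃ j : ℤ, pos B B' = b.w j ∧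
      (j = 2 * n - 1 ∨ j = 2 * n ∨ j = -(2 * n) ∨ j = -(2 * n) - 1) := by
  obtain ⟨c, rfl⟩ := a.exists_iw B
  obtain ⟨d, rfl⟩ := a.exists_iw B'
  have h1 := lat_eq_of_chamber_le hB
  have h2 : a.lat (-n) n = d.lat 0 0 := by
    have e : a.lat (-n) n = (a.apt (2 * n)).lat 0 0 := by
      rw [← vert_zero, vert_apt_even (even_two_mul _), add_zero, vert_even]
    rw [e]
    rw [e] at hB'
    exact lat_eq_of_chamber_le hB'
  obtain ⟨a', n', hn', h3, h4, h5, h6⟩ := exists_apartment_chamber c d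
  lift n' to ℕ using hn'
  obtain rfl : n' = n := by
    rw [← a'.codim_lat n', ← h3, ← h4, ← h1, ← h2, a.codim_lat]
  have hw : ∀ i, b.w i = a'.w i := b.w_eq a'
  simp only [hw]
  rcases h5 with h5 | h5 <;> rcases h6 with h6 | h6 <;> rw [h5, h6, pos_iw]
  · exact ⟨_, rfl, by unfold wmul winv; simp⟩
  · exact ⟨_, rfl, by unfold wmul winv; simp⟩
  · refine ⟨_, rfl, ?_⟩
    unfold wmul winv
    simp only [Int.even_iff]
    split_ifs <;> omega
  · refine ⟨_, rfl, ?_⟩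
    unfold wmul winv
    simp only [Int.even_iff]
    split_ifs <;> omega

theorem chamber_zero_le (a : UBasis ω) : (a.iw 0).1 ≤ stab (a.lat 0 0) := inf_le_left

theorem chamber_neg_one_le (a : UBasis ω) : (a.iw (-1)).1 ≤ stab (a.lat 0 0) := inf_le_right

theorem chamber_le (a : UBasis ω) (n : ℤ) : (a.iw (2 * n - 1)).1 ≤ stab (a.lat (-n) n) := by
  rw [← vert_even]
  refine inf_le_right.trans ?_
  rw [sub_add_cancel]

section Law

variable [Group (Weyl ω)] {b : UBasis ω}

/-- A vertex is in the trivial position to itself. -/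
theorem isPos_stab_self (h : ∀ i j, b.w i * b.w j = b.w (wmul i j)) (a : UBasis ω) :
    IsPos (stab (a.lat 0 0)) (stab (a.lat 0 0)) (b.w 0) := by
  refine ⟨fun B B' hB hB' => ?_, a.iw 0, a.iw 0, a.chamber_zero_le, a.chamber_zero_le, b.w_eq a 0 ▸ rfl⟩
  obtain ⟨j, hj, -⟩ := pos_cases (n := 0) hB (by simpa using hB') b
  rw [hj]
  rcases eq_or_ne j 0 with rfl | hj0
  · exact Relation.ReflTransGen.refl
  · exact bruhatLE_of_lt h (by omega)

/-- The closest chambers at two vertices at distance `2n` are at distance `2n - 1`. -/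
theorem isPos_stab (h : ∀ i j, b.w i * b.w j = b.w (wmul i j)) (a : UBasis ω) {n : ℕ}
    (hn : 0 < n) : IsPos (stab (a.lat 0 0)) (stab (a.lat (-n) n)) (b.w (2 * n - 1)) := by
  refine ⟨fun B B' hB hB' => ?_, a.iw 0, a.iw (2 * n - 1), a.chamber_zero_le, a.chamber_le n,
    b.w_eq a _ ▸ rfl⟩
  obtain ⟨j, hj, hj'⟩ := pos_cases hB hB' b
  rw [hj]
  rcases eq_or_ne j (2 * n - 1) with rfl | hj0
  · exact Relation.ReflTransGen.refl
  · exact bruhatLE_of_lt h (by omega)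

end Law

/-- The chambers at the vertex `0` are at distance at most one, and in an apartment they are the
chambers `0` and `-1`. -/
theorem type_stab (a b : UBasis ω) : type ω (stab (a.lat 0 0)) = {b.w (-1)} := by
  ext s
  rw [Set.mem_singleton_iff]
  constructor
  · rintro ⟨hs, B, B', hB, hB', rfl⟩
    obtain ⟨j, hj, hj'⟩ := pos_cases (n := 0) hB (by simpa using hB') b
    rw [hj] at hs ⊢
    change len _ = 1 at hs
    rw [len_w] at hs
    congr 1
    omega
  · rintro rfl
    refine ⟨b.mem_simples_iff.2 (Or.inr rfl), a.iw 0, a.iw (-1), a.chamber_zero_le,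
      a.chamber_neg_one_le, b.w_eq a _ ▸ rfl⟩

/-! ### Sequences -/

section Law

variable [Group (Weyl ω)] {b : UBasis ω}

/-- The constant sequence with `Jₙ = J` and `wₙ = 1`, where `J = {w (-1)}` is the type of `P`. -/
noncomputable def seqZero (b : UBasis ω) : ℕ → Set (Weyl ω) × Weyl ω :=
  fun _ => ({b.w (-1)}, b.w 0)

/-- The sequence with `J₀ = {w (-1)}`, `w₀ = w (2n - 1)`, and `Jₘ = ∅`, `wₘ = w j` for `m > 0`. It
lies in `𝒯(J₀)` for `n > 0` if `j` is `2n - 1` or `2n`. -/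
noncomputable def seqPos (b : UBasis ω) (n : ℕ) (j : ℤ) : ℕ → Set (Weyl ω) × Weyl ω
  | 0 => ({b.w (-1)}, b.w (2 * n - 1))
  | _ + 1 => (∅, b.w j)

theorem inter_ad_zero (h : ∀ i j, b.w i * b.w j = b.w (wmul i j)) :
    {b.w (-1)} ∩ ad (b.w 0) {b.w (-1)} = {b.w (-1)} := by
  rw [ad, Set.image_singleton, w_zero_eq_one h]
  simp

/-- Distinct reflections in an infinite dihedral group do not commute. -/
theorem inter_ad_pos (h : ∀ i j, b.w i * b.w j = b.w (wmul i j)) {n : ℕ} (hn : 0 < n) :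
    {b.w (-1)} ∩ ad (b.w (2 * n - 1)) {b.w (-1)} = ∅ := by
  rw [ad, Set.image_singleton, inv_w h, h, h, Set.singleton_inter_eq_empty, Set.mem_singleton_iff]
  intro he
  have := b.w_injective he
  unfold wmul winv at this
  simp only [Int.even_iff] at this
  split_ifs at this <;> omega

/-- The double cosets of the subgroup of order two generated by `w (-1)`, and their shortest
elements. -/
theorem mem_minReps_iff (h : ∀ i j, b.w i * b.w j = b.w (wmul i j)) {i : ℤ} :
    b.w i ∈ minReps {b.w (-1)} {b.w (-1)} ↔ i = 0 ∨ ∃ n : ℕ, 0 < n ∧ i = 2 * n - 1 := by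
  change ((∀ s ∈ ({b.w (-1)} : Set (Weyl ω)), _) ∧ ∀ s ∈ ({b.w (-1)} : Set (Weyl ω)), _) ↔ _
  simp only [Set.mem_singleton_iff, forall_eq, h, len_w]
  constructor
  · rintro ⟨h1, h2⟩
    by_cases h0 : i = 0
    · exact Or.inl h0
    · right
      refine ⟨((i + 1) / 2).toNat, ?_, ?_⟩ <;>
      · unfold wmul at h1 h2
        simp only [Int.even_iff] at h1 h2
        split_ifs at h1 h2 <;> omega
  · rintro (rfl | ⟨n, hn, rfl⟩)
    · exact ⟨by decide, by decide⟩
    · unfold wmul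
      simp only [Int.even_iff]
      split_ifs <;> omega

theorem eq_of_mem_closure (h : ∀ i j, b.w i * b.w j = b.w (wmul i j)) {y : Weyl ω}
    (hy : y ∈ Subgroup.closure {b.w (-1)}) : y = b.w 0 ∨ y = b.w (-1) := by
  have hs : b.w (-1) * b.w (-1) = 1 := simple_mul_self h (b.mem_simples_iff.2 (Or.inr rfl))
  rw [w_zero_eq_one h]
  induction hy using Subgroup.closure_induction with
  | mem x hx => exact Or.inr hx
  | one => exact Or.inl rfl
  | mul x y _ _ hx hy => rcases hx with rfl | rfl <;> rcases hy with rfl | rfl <;> simp [hs]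
  | inv x _ hx =>
    rcases hx with rfl | rfl
    · simp
    · exact Or.inr (inv_eq_of_mul_eq_one_right hs)

/-- The sequences in `𝒯(J)`, for `J` the type of a maximal parahoric subgroup. -/
theorem mem_sequences_iff (h : ∀ i j, b.w i * b.w j = b.w (wmul i j))
    {t : ℕ → Set (Weyl ω) × Weyl ω} : t ∈ sequences {b.w (-1)} ↔
    t = b.seqZero ∨ ∃ n : ℕ, 0 < n ∧ (t = b.seqPos n (2 * n - 1) ∨ t = b.seqPos n (2 * n)) := by
  constructor
  · rintro ⟨h0, h1, h2, h3⟩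
    obtain ⟨i, hi⟩ := b.w_surjective (t 0).2
    have h4 := h2 0
    rw [h0, ← hi, mem_minReps_iff h] at h4
    rcases h4 with rfl | ⟨n, hn, rfl⟩
    · left
      have key : ∀ m, t m = ({b.w (-1)}, b.w 0) := by
        intro m
        induction m with
        | zero => exact Prod.ext h0 hi.symm
        | succ m ih =>
          have hJ : (t (m + 1)).1 = {b.w (-1)} := by rw [h1, ih, inter_ad_zero h]
          refine Prod.ext hJ ?_
          obtain ⟨y, hy, hy'⟩ := h3 m
          rw [ih] at hy hy'
          have h5 := h2 (m + 1)
          rcases eq_of_mem_closure h hy with rfl | rfl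
          · rw [hy', h, zero_wmul]
          · rw [hJ, hy', h, mem_minReps_iff h, zero_wmul] at h5
            omega
      exact funext key
    · right
      refine ⟨n, hn, ?_⟩
      have hJ : ∀ m, (t (m + 1)).1 = ∅ := by
        intro m
        induction m with
        | zero => rw [h1, h0, ← hi, inter_ad_pos h hn]
        | succ m ih => rw [h1, ih, Set.empty_inter]
      have hw : ∀ m, (t (m + 1)).2 = (t 1).2 := by
        intro m
        induction m with
        | zero => rfl
        | succ m ih =>
          obtain ⟨y, hy, hy'⟩ := h3 (m + 1)
          rw [hJ, Subgroup.closure_empty, Subgroup.mem_bot] at hy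
          rw [hy', hy, mul_one, ih]
      have key : ∀ j, (t 1).2 = b.w j → t = b.seqPos n j := by
        intro j hj
        funext m
        cases m with
        | zero => exact Prod.ext h0 hi.symm
        | succ m => exact Prod.ext (hJ m) ((hw m).trans hj)
      obtain ⟨y, hy, hy'⟩ := h3 0
      rw [h0] at hy
      rw [← hi] at hy'
      rcases eq_of_mem_closure h hy with rfl | rfl
      · left
        rw [h, wmul_zero] at hy'
        exact key _ hy'
      · right
        apply key
        rw [hy', h]
        congr 1
        unfold wmul
        simp only [Int.even_iff]
        split_ifs <;> omega
  · have hempty : ∀ u : Weyl ω, u ∈ minReps ∅ ∅ := fun u => ⟨by simp, by simp⟩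
    rintro (rfl | ⟨n, hn, ht⟩)
    · exact ⟨rfl, fun _ => (inter_ad_zero h).symm, fun _ => (mem_minReps_iff h).2 (Or.inl rfl),
        fun _ => ⟨1, one_mem _, (mul_one _).symm⟩⟩
    · have key : ∀ j, (∃ y ∈ Subgroup.closure {b.w (-1)}, b.w j = b.w (2 * n - 1) * y) →
          b.seqPos n j ∈ sequences {b.w (-1)} := by
        intro j hj
        refine ⟨rfl, fun m => ?_, fun m => ?_, fun m => ?_⟩
        · cases m with
          | zero => exact (inter_ad_pos h hn).symm
          | succ m => exact (Set.empty_inter _).symm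
        · cases m with
          | zero => exact (mem_minReps_iff h).2 (Or.inr ⟨n, hn, rfl⟩)
          | succ m => exact hempty _
        · cases m with
          | zero => exact hj
          | succ m => exact ⟨1, one_mem _, (mul_one _).symm⟩
      rcases ht with rfl | rfl
      · exact key _ ⟨1, one_mem _, (mul_one _).symm⟩
      · refine key _ ⟨b.w (-1), Subgroup.subset_closure rfl, ?_⟩
        rw [h]
        congr 1
        unfold wmul
        simp only [Int.even_iff]
        split_ifs <;> omega

theorem HasSequence.unique {P : Subgroup (SpecialLinearGroup k⸨X⸩ V)}
    {g : SpecialLinearGroup k⸨X⸩ V} {t t' : ℕ → Set (Weyl ω) × Weyl ω}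
    (h : HasSequence P g t) (h' : HasSequence P g t') : t = t' := by
  have h2 : ∀ m, (t m).2 = (t' m).2 := fun m => IsPos.unique (h.2.2 m) (h'.2.2 m)
  funext m
  refine Prod.ext ?_ (h2 m)
  induction m with
  | zero => rw [h.1, h'.1]
  | succ m ih => rw [h.2.1, h'.2.1, ih, h2]

end Law

section Reduction

variable {b : UBasis ω}

/-! ### Prounipotent radicals -/

/-- The successive quotients for the stabilizer of `L` are the quotients `ε^i L / ε^(i+1) L`. -/
theorem step_stab {M N : Submodule k⟦X⟧ V} (h : IsStableStep (stab (b.lat 0 0)) N M) :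
    ∃ i, M = b.lat i i ∧ N = b.lat (i + 1) (i + 1) := by
  obtain ⟨hN, hM, hlt, hbt⟩ := h
  obtain ⟨i, rfl⟩ := stable_stab hM
  obtain ⟨j, rfl⟩ := stable_stab hN
  have h1 := lat_le_lat_iff.1 hlt.le
  have h2 : i ≠ j := fun h => hlt.ne (by rw [h])
  rcases hbt _ (isStable_stab (i + 1)) (lat_le_lat_iff.2 (by omega)) (lat_le_lat_iff.2 (by omega))
    with h3 | h3
  · exact ⟨i, rfl, h3.symm⟩
  · have := lat_inj.1 h3
    omega

/-- The successive quotients for an Iwahori subgroup are those of the chain formed by the multiples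
of its two vertices. -/
theorem step_chamber {M N : Submodule k⟦X⟧ V} (h : IsStableStep (b.chamber 0) N M) :
    ∃ i, (M = b.lat i i ∧ N = b.lat i (i + 1)) ∨
      (M = b.lat i (i + 1) ∧ N = b.lat (i + 1) (i + 1)) := by
  obtain ⟨hN, hM, hlt, hbt⟩ := h
  obtain ⟨i, rfl | rfl⟩ := stable_chamber hM
  · refine ⟨i, Or.inl ⟨rfl, ?_⟩⟩
    have h1 : N ≤ b.lat i (i + 1) := by
      obtain ⟨j, rfl | rfl⟩ := stable_chamber hN
      · have h1 := lat_le_lat_iff.1 hlt.le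
        have h2 : i ≠ j := fun h => hlt.ne (by rw [h])
        exact lat_le_lat_iff.2 (by omega)
      · have h1 := lat_le_lat_iff.1 hlt.le
        exact lat_le_lat_iff.2 (by omega)
    rcases hbt _ (isStable_chamber_right i) h1 (lat_le_lat_iff.2 (by omega)) with h3 | h3
    · exact h3.symm
    · have := lat_inj.1 h3
      omega
  · refine ⟨i, Or.inr ⟨rfl, ?_⟩⟩
    have h1 : N ≤ b.lat (i + 1) (i + 1) := by
      obtain ⟨j, rfl | rfl⟩ := stable_chamber hN
      · have h1 := lat_le_lat_iff.1 hlt.le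
        exact lat_le_lat_iff.2 (by omega)
      · have h1 := lat_le_lat_iff.1 hlt.le
        have h2 : i ≠ j := fun h => hlt.ne (by rw [h])
        exact lat_le_lat_iff.2 (by omega)
    rcases hbt _ (isStable_chamber_left (i + 1)) h1 (lat_le_lat_iff.2 (by omega)) with h3 | h3
    · exact h3.symm
    · have := lat_inj.1 h3
      omega

theorem isStableStep_stab (b : UBasis ω) :
    IsStableStep (stab (b.lat 0 0)) (b.lat 1 1) (b.lat 0 0) := by
  refine ⟨isStable_stab 1, isStable_stab 0, ?_, fun M hM h1 h2 => ?_⟩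
  · refine lt_of_le_of_ne (lat_le_lat_iff.2 (by omega)) ?_
    rw [ne_eq, lat_inj]
    omega
  · obtain ⟨i, rfl⟩ := stable_stab hM
    rw [lat_le_lat_iff] at h1 h2
    rw [lat_inj, lat_inj]
    omega

/-- Two elements of `Q` with the same action on the successive quotients of the chain of stable
lattices differ by an element of the prounipotent radical. -/
theorem mem_radical_of_sub {Q : Subgroup (SpecialLinearGroup k⸨X⸩ V)}
    {g h : SpecialLinearGroup k⸨X⸩ V} (hg : g ∈ Q) (hh : h ∈ Q)
    (H : ∀ N M, IsStableStep Q N M → ∀ v ∈ M, g.1 v - h.1 v ∈ N) : h⁻¹ * g ∈ radical Q := by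
  refine ⟨Q.mul_mem (Q.inv_mem hh) hg, fun N M hNM v hv => ?_⟩
  have h1 : (h⁻¹).1 (g.1 v - h.1 v) ∈ translate h⁻¹ N := ⟨_, H N M hNM v hv, rfl⟩
  rw [hNM.1.2 _ (Q.inv_mem hh), map_sub] at h1
  have h2 : (h⁻¹).1 (h.1 v) = v := h.1.symm_apply_apply v
  rw [h2] at h1
  exact h1

/-- Two elements of the stabilizer of a lattice that agree modulo `ε` differ by an element of the
prounipotent radical. -/
theorem mem_radical_stab_of_sub {g h : SpecialLinearGroup k⸨X⸩ V} (hg : g ∈ stab (b.lat 0 0))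
    (hh : h ∈ stab (b.lat 0 0)) (h0 : g.1 b.e0 - h.1 b.e0 ∈ b.lat 1 1)
    (h1 : g.1 b.e1 - h.1 b.e1 ∈ b.lat 1 1) : h⁻¹ * g ∈ radical (stab (b.lat 0 0)) := by
  refine mem_radical_of_sub hg hh fun N M hNM v hv => ?_
  obtain ⟨i, rfl, rfl⟩ := step_stab hNM
  have e : g.1 v - h.1 v = b.x v • (g.1 b.e0 - h.1 b.e0) + b.y v • (g.1 b.e1 - h.1 b.e1) := by
    conv_lhs => rw [← b.eta v]
    simp only [map_add, map_smul, smul_sub]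
    abel
  rw [e, mem_lat]
  simp only [map_add, map_smul, smul_eq_mul]
  exact ⟨add_mem (mul_mem_fil hv.1 h0.1 le_rfl) (mul_mem_fil hv.2 h1.1 le_rfl),
    add_mem (mul_mem_fil hv.1 h0.2 le_rfl) (mul_mem_fil hv.2 h1.2 le_rfl)⟩

/-- Two elements of an Iwahori subgroup with congruent diagonal entries modulo `ε` differ by an
element of its prounipotent radical. -/
theorem mem_radical_chamber_of_sub {g h : SpecialLinearGroup k⸨X⸩ V} (hg : g ∈ b.chamber 0)
    (hh : h ∈ b.chamber 0) (h0 : g.1 b.e0 - h.1 b.e0 ∈ b.lat 1 1)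
    (h1 : g.1 b.e1 - h.1 b.e1 ∈ b.lat 0 1) : h⁻¹ * g ∈ radical (b.chamber 0) := by
  refine mem_radical_of_sub hg hh fun N M hNM v hv => ?_
  have e : g.1 v - h.1 v = b.x v • (g.1 b.e0 - h.1 b.e0) + b.y v • (g.1 b.e1 - h.1 b.e1) := by
    conv_lhs => rw [← b.eta v]
    simp only [map_add, map_smul, smul_sub]
    abel
  obtain ⟨i, ⟨rfl, rfl⟩ | ⟨rfl, rfl⟩⟩ := step_chamber hNM
  all_goals
    rw [e, mem_lat]
    simp only [map_add, map_smul, smul_eq_mul]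
    exact ⟨add_mem (mul_mem_fil hv.1 h0.1 (by omega)) (mul_mem_fil hv.2 h1.1 (by omega)),
      add_mem (mul_mem_fil hv.1 h0.2 (by omega)) (mul_mem_fil hv.2 h1.2 (by omega))⟩

theorem sub_mem_of_mem_radical {g : SpecialLinearGroup k⸨X⸩ V}
    (hg : g ∈ radical (stab (b.lat 0 0))) {v : V} (hv : v ∈ b.lat 0 0) : g.1 v - v ∈ b.lat 1 1 :=
  hg.2 _ _ b.isStableStep_stab v hv

theorem e0_mem (b : UBasis ω) : b.e0 ∈ b.lat 0 0 := by
  simp [mem_lat, one_mem_fil, zero_mem]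

theorem e1_mem (b : UBasis ω) : b.e1 ∈ b.lat 0 0 := by
  simp [mem_lat, one_mem_fil, zero_mem]

/-! ### The operation `P^Q` -/

theorem sub_C_coeff_mem {c : k⸨X⸩} (hc : c ∈ fil k 0) : c - HahnSeries.C (c.coeff 0) ∈ fil k 1 := by
  rw [mem_fil_one_iff]
  exact ⟨sub_mem hc (C_mem_fil _), by simp⟩

/-- The reduction modulo `ε` of an element of an Iwahori subgroup has invertible diagonal entries,
inverse to each other. -/
theorem coeff_mul_coeff {g : SpecialLinearGroup k⸨X⸩ V} (hg : g ∈ b.chamber 0) :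
    (b.x (g.1 b.e0)).coeff 0 * (b.y (g.1 b.e1)).coeff 0 = 1 := by
  obtain ⟨hp, hq, hr, hs⟩ := mem_chamber.1 hg
  have hd := b.det_eq (b.map g)
  rw [map_e0, map_e1] at hd
  have h1 := congrArg (fun c : k⸨X⸩ => c.coeff 0) hd
  have h2 : (b.y (g.1 b.e0) * b.x (g.1 b.e1)).coeff 0 = 0 :=
    mem_fil_iff.1 (mul_mem_fil (l := 1) hq hr (by omega)) 0 (by omega)
  simp only [HahnSeries.coeff_sub] at h1
  rw [h2, sub_zero, coeff_zero_mul hp hs] at h1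
  simpa using h1

/-- For two vertices at distance `2n > 0`, the subgroup `P^Q` is the Iwahori subgroup of the line in
`L / εL` that points towards the second vertex. An element of it is congruent modulo `ε` to an upper
triangular matrix with constant entries, which fixes both vertices. -/
theorem proj_stab (a : UBasis ω) {n : ℕ} (hn : 0 < n) :
    proj (stab (a.lat 0 0)) (stab (a.lat (-n) n)) = a.chamber 0 := by
  apply le_antisymm
  · refine sup_le ?_ ?_
    · intro g hg
      have h1 := mem_stab_lat.1 hg.1
      have h2 := mem_stab_lat.1 hg.2
      rw [mem_chamber]
      exact ⟨h1.1.1, fil_mono (by omega) h2.1.2, by simpa using h1.2.1, h1.2.2⟩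
    · intro g hg
      have h1 := mem_stab_lat.1 hg.1
      have h2 := sub_mem_of_mem_radical hg a.e0_mem
      have h3 : a.y (g.1 a.e0) ∈ fil k 1 := by simpa using h2.2
      rw [mem_chamber]
      exact ⟨h1.1.1, h3, by simpa using h1.2.1, h1.2.2⟩
  · intro g hg
    have hg0 : g ∈ stab (a.lat 0 0) := hg.1
    have hpd := coeff_mul_coeff hg
    obtain ⟨hp, hq, hr, hs⟩ := mem_chamber.1 hg
    rw [neg_zero] at hr
    -- the upper triangular element with constant coefficients congruent to `g`
    let h := a.elt (HahnSeries.C ((a.x (g.1 a.e0)).coeff 0)) 0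
      (HahnSeries.C ((a.x (g.1 a.e1)).coeff 0)) (HahnSeries.C ((a.y (g.1 a.e1)).coeff 0))
      (by rw [← map_mul, hpd, map_one, zero_mul, sub_zero])
    have hh0 : h ∈ stab (a.lat 0 0) := by
      rw [mem_stab_lat]
      simp only [h, elt_e0, elt_e1, map_add, map_smul, x_e0, x_e1, y_e0, y_e1, smul_eq_mul, mul_one,
        mul_zero, add_zero, zero_add, C_mem_fil, zero_mem, sub_self, and_self]
    have hhn : h ∈ stab (a.lat (-n) n) := by
      rw [mem_stab_lat]
      simp only [h, elt_e0, elt_e1, map_add, map_smul, x_e0, x_e1, y_e0, y_e1, smul_eq_mul, mul_one,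
        mul_zero, add_zero, zero_add, C_mem_fil, zero_mem, true_and, and_true]
      exact fil_mono (by omega) (C_mem_fil _)
    rw [← mul_inv_cancel_left h g]
    refine Subgroup.mul_mem _ (Subgroup.mem_sup_left ⟨hh0, hhn⟩) (Subgroup.mem_sup_right ?_)
    refine mem_radical_stab_of_sub hg0 hh0 ?_ ?_
    · rw [mem_lat]
      simp only [h, elt_e0, map_sub, map_add, map_smul, x_e0, x_e1, y_e0, y_e1, smul_eq_mul,
        mul_one, mul_zero, add_zero, sub_zero]
      exact ⟨sub_C_coeff_mem hp, hq⟩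
    · rw [mem_lat]
      simp only [h, elt_e1, map_sub, map_add, map_smul, x_e0, x_e1, y_e0, y_e1, smul_eq_mul,
        mul_one, mul_zero, add_zero, zero_add]
      exact ⟨sub_C_coeff_mem hr, sub_C_coeff_mem hs⟩

/-- Two chambers of an apartment are fixed by all diagonal matrices with constant entries, and these
represent `B / U_B`. -/
theorem proj_chamber (a : UBasis ω) (i : ℤ) : proj (a.chamber 0) (a.chamber i) = a.chamber 0 := by
  apply le_antisymm
  · exact sup_le inf_le_left fun g hg => hg.1
  · intro g hg
    have hpd := coeff_mul_coeff hg
    obtain ⟨hp, hq, hr, hs⟩ := mem_chamber.1 hg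
    rw [neg_zero] at hr
    -- the diagonal element with constant coefficients congruent to `g`
    let h := a.elt (HahnSeries.C ((a.x (g.1 a.e0)).coeff 0)) 0
      0 (HahnSeries.C ((a.y (g.1 a.e1)).coeff 0))
      (by rw [← map_mul, hpd, map_one, zero_mul, sub_zero])
    have hh : ∀ j, h ∈ a.chamber j := by
      intro j
      rw [mem_chamber]
      simp only [h, elt_e0, elt_e1, map_add, map_smul, x_e0, x_e1, y_e0, y_e1, smul_eq_mul, mul_one,
        mul_zero, add_zero, zero_add, C_mem_fil, zero_mem, and_self]
    rw [← mul_inv_cancel_left h g]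
    refine Subgroup.mul_mem _ (Subgroup.mem_sup_left ⟨hh 0, hh i⟩) (Subgroup.mem_sup_right ?_)
    refine mem_radical_chamber_of_sub hg (hh 0) ?_ ?_
    · rw [mem_lat]
      simp only [h, elt_e0, map_sub, map_add, map_smul, x_e0, x_e1, y_e0, y_e1, smul_eq_mul,
        mul_one, mul_zero, add_zero, sub_zero]
      exact ⟨sub_C_coeff_mem hp, hq⟩
    · rw [mem_lat]
      simp only [h, elt_e1, map_sub, map_add, map_smul, x_e0, x_e1, y_e0, y_e1, smul_eq_mul,
        mul_one, mul_zero, add_zero, zero_add, sub_zero]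
      exact ⟨hr, sub_C_coeff_mem hs⟩

theorem proj_iwahori (b : UBasis ω) (B B' : Iwahori ω) : proj B.1 B'.1 = B.1 := by
  obtain ⟨c, i, rfl, rfl⟩ := b.exists_iw_pair B B'
  exact c.proj_chamber i

theorem proj_self (Q : Subgroup (SpecialLinearGroup k⸨X⸩ V)) : proj Q Q = Q :=
  le_antisymm (sup_le inf_le_left fun _ hg => hg.1) (le_sup_of_le_left (le_inf le_rfl le_rfl))

/-! ### The sequence attached to an element -/

section Law

variable [Group (Weyl ω)]

/-- For `gL = L` nothing changes in any step. -/
theorem hasSequence_zero (h : ∀ i j, b.w i * b.w j = b.w (wmul i j)) (a : UBasis ω)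
    {g : SpecialLinearGroup k⸨X⸩ V} (hg : translate g (a.lat 0 0) = a.lat 0 0) :
    HasSequence (stab (a.lat 0 0)) g b.seqZero := by
  have hc : conj g (stab (a.lat 0 0)) = stab (a.lat 0 0) := by rw [conj_stab, hg]
  have hc' : conj g⁻¹ (stab (a.lat 0 0)) = stab (a.lat 0 0) := by
    conv_lhs => rw [← hc, ← conj_mul, inv_mul_cancel, conj_one]
  have hP : ∀ m, parahoricSeq (stab (a.lat 0 0)) g m = stab (a.lat 0 0) := by
    intro m
    induction m with
    | zero => rfl
    | succ m ih => rw [parahoricSeq, ih, hc, proj_self, hc']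
  refine ⟨(type_stab a b).symm, fun _ => (inter_ad_zero h).symm, fun m => ?_⟩
  rw [hP, hc]
  exact isPos_stab_self h a

/-- For `gL ≠ L`, the first step replaces `P` by the Iwahori subgroup determined by the line in
`L / εL` that `g` maps to the direction from `gL` to `L`, and later steps change nothing. -/
theorem hasSequence_pos (h : ∀ i j, b.w i * b.w j = b.w (wmul i j)) (a : UBasis ω) {n : ℕ}
    (hn : 0 < n) {g : SpecialLinearGroup k⸨X⸩ V}
    (hg : translate g (a.lat (-n) n) = a.lat 0 0) :
    HasSequence (stab (a.lat (-n) n)) g (b.seqPos n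
      (open Classical in if translate g (a.lat (-n + 1) n) = a.lat 0 1 then 2 * n - 1 else 2 * n)) := by
  have hg' : translate g⁻¹ (a.lat 0 0) = a.lat (-n) n := by
    rw [← hg, ← translate_mul, inv_mul_cancel, translate_one]
  let c := a.map g⁻¹
  have hc : ∀ i j, c.lat i j = translate g⁻¹ (a.lat i j) := fun i j => (translate_lat _).symm
  have hcj : conj g⁻¹ (a.iw 0).1 = (c.iw 0).1 := conj_chamber _ _
  have hcj' : conj g (c.iw 0).1 = (a.iw 0).1 := by
    rw [← hcj, ← conj_mul, mul_inv_cancel, conj_one]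
  -- the second parahoric subgroup is an Iwahori subgroup, and it is repeated forever
  have hP : ∀ m, parahoricSeq (stab (a.lat (-n) n)) g (m + 1) = (c.iw 0).1 := by
    intro m
    induction m with
    | zero =>
      rw [parahoricSeq, parahoricSeq, conj_stab, hg, proj_stab a hn]
      exact hcj
    | succ m ih => rw [parahoricSeq, ih, hcj', proj_iwahori a, hcj]
  refine ⟨(?_ : {b.w (-1)} = _), fun m => ?_, fun m => ?_⟩
  · rw [← vert_even, ← add_zero (2 * (n : ℤ)), ← vert_apt_even (even_two_mul _), vert_zero,
      type_stab]
  · cases m with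
    | zero => exact (inter_ad_pos h hn).symm
    | succ m => exact (Set.empty_inter _).symm
  · cases m with
    | zero =>
      rw [parahoricSeq, conj_stab, hg]
      exact isPos_stab h a hn
    | succ m =>
      rw [hP, hcj']
      change IsPos _ _ (b.w _)
      -- an apartment that contains the lines of both Iwahori subgroups
      obtain ⟨d, n', hn', h1, h2, h3, h4⟩ := exists_apartment a c
      rw [hc, hg'] at h2
      lift n' to ℕ using hn'
      obtain rfl : n' = n := by
        rw [← d.codim_lat n', ← h1, ← h2, a.codim_lat]
      -- the lines that point from one lattice towards the other do not depend on the apartment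
      have h5 : a.lat 0 1 = d.lat 0 1 := by
        rcases h3 with h3 | h3
        · exact h3
        · exfalso
          have h6 : a.lat 0 0 ⊓ a.lat (-n') n' ≤ a.lat 0 1 := by
            rw [lat_inf, lat_le_lat_iff]
            omega
          rw [h1, h2, h3, lat_inf, lat_le_lat_iff] at h6
          omega
      have h6 : a.lat (-n' + 1) n' = d.lat (-n' + 1) n' := by
        have key : ∀ a : UBasis ω, a.lat (-n' + 1) n' =
            (a.lat 0 0 ⊓ a.lat (-n') n') ⊔ epsMul (a.lat (-n') n') := by
          intro a
          rw [lat_inf, epsMul_lat]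
          refine le_antisymm (lat_le_of_mem (Submodule.mem_sup_right tpow_e0_mem)
            (Submodule.mem_sup_left ?_)) (sup_le (lat_le_lat_iff.2 (by omega))
              (lat_le_lat_iff.2 (by omega)))
          rw [mem_lat, map_smul, map_smul]
          simp only [x_e1, y_e1, smul_eq_mul, mul_one, mul_zero, zero_mem, true_and, tpow_mem_fil]
          omega
        rw [key, key, h1, h2]
      have h7 : a.iw 0 = d.iw 0 := Subtype.ext (chamber_eq_of_vert h1 h5)
      have h8 := isPos_iwahori (a.iw 0) (c.iw 0) b
      convert h8 using 1
      by_cases hL : translate g (a.lat (-n' + 1) n') = a.lat 0 1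
      · rw [if_pos hL]
        have h9 : c.lat 0 1 = d.lat (-n' + 1) n' := by
          rw [hc, ← hL, ← translate_mul, inv_mul_cancel, translate_one, h6]
        have h10 : c.iw 0 = d.iw (2 * n' - 1) := by
          apply Subtype.ext
          change c.chamber 0 = d.chamber (2 * n' - 1)
          rw [chamber, chamber, zero_add, vert_zero, vert_one, hc, hg', h2, h9, inf_comm,
            sub_add_cancel, vert_even, show 2 * (n' : ℤ) - 1 = 2 * (n' - 1) + 1 by ring, vert_odd]
          congr 3 <;> ring
        rw [h7, h10, b.w_eq d]
        rfl
      · rw [if_neg hL]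
        have h9 : c.lat 0 1 = d.lat (-n') (n' + 1) := by
          rcases h4 with h4 | h4
          · exact h4
          · exfalso
            apply hL
            rw [h6, ← h4, hc, ← translate_mul, mul_inv_cancel, translate_one]
        have h10 : c.iw 0 = d.iw (2 * n') := by
          apply Subtype.ext
          change c.chamber 0 = d.chamber (2 * n')
          rw [chamber, chamber, zero_add, vert_zero, vert_one, hc, hg', h2, h9, vert_even, vert_odd]
        rw [h7, h10, b.w_eq d]
        rfl

end Law

end Reduction

end UBasis

/-! ### Volume preserving isomorphisms of reductions -/

theorem mk_eq_mk_iff {M : Submodule k⟦X⟧ V} {v w : M} :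
    (Submodule.Quotient.mk v : Red M) = Submodule.Quotient.mk w ↔ (v : V) - w ∈ epsMul M := by
  rw [Submodule.Quotient.eq]
  rfl

/-- The element `y` of `Y` is the pair `(gL, ḡ)`, where `ḡ` is induced by `g`. -/
def Represents {L : Submodule k⟦X⟧ V} (g : SpecialLinearGroup k⸨X⸩ V) (y : LatticePair ω L) :
    Prop :=
  y.lat = translate g L ∧ ∀ (v : L) (w : y.lat), (w : V) = g.1 v →
    y.iso (Submodule.Quotient.mk v) = Submodule.Quotient.mk w

/-- An element of `SL(V)` represents at most one element of `Y`. -/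
theorem Represents.eq {L : Submodule k⟦X⟧ V} {g : SpecialLinearGroup k⸨X⸩ V}
    {y y' : LatticePair ω L} (h : Represents g y) (h' : Represents g y') : y = y' := by
  obtain ⟨M, hM, f, hf⟩ := y
  obtain ⟨M', hM', f', hf'⟩ := y'
  obtain ⟨h1 : M = _, h2⟩ := h
  obtain ⟨h1' : M' = _, h2'⟩ := h'
  subst h1 h1'
  congr
  ext ξ
  obtain ⟨v, rfl⟩ := Submodule.Quotient.mk_surjective _ ξ
  exact (h2 v ⟨g.1 v, v, v.2, rfl⟩ rfl).trans (h2' v ⟨g.1 v, v, v.2, rfl⟩ rfl).symm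

theorem Represents.sub_mem {L : Submodule k⟦X⟧ V} {g h : SpecialLinearGroup k⸨X⸩ V}
    {y : LatticePair ω L} (hg : Represents g y) (hh : Represents h y) {v : V} (hv : v ∈ L) :
    g.1 v - h.1 v ∈ epsMul y.lat := by
  have h1 : g.1 v ∈ y.lat := by
    rw [hg.1]
    exact ⟨v, hv, rfl⟩
  have h2 : h.1 v ∈ y.lat := by
    rw [hh.1]
    exact ⟨v, hv, rfl⟩
  exact mk_eq_mk_iff.1 ((hg.2 ⟨v, hv⟩ ⟨_, h1⟩ rfl).symm.trans (hh.2 ⟨v, hv⟩ ⟨_, h2⟩ rfl))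

theorem C_mem_fil_one_iff {p : k} : (HahnSeries.C p : k⸨X⸩) ∈ fil k 1 ↔ p = 0 := by
  constructor
  · intro hp
    have := mem_fil_iff.1 hp 0 (by omega)
    simpa using this
  · rintro rfl
    rw [map_zero]
    exact zero_mem _

namespace UBasis

variable {b : UBasis ω}

theorem exists_lat_eq (hV : Module.finrank k⸨X⸩ V = 2) (hω : ω ≠ 0) {L : Submodule k⟦X⟧ V}
    (hL : L ∈ unimodularLattices ω) : ∃ b : UBasis ω, L = b.lat 0 0 := by
  obtain ⟨e, he⟩ := hL
  obtain ⟨b, hb, -, -⟩ := exists_of_latBasis hV hω e he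
  exact ⟨b, hb⟩

/-- Two elements of `SL(V)` have the same class modulo the prounipotent radical of the stabilizer
of a lattice if and only if they have the same effect on the lattice and on its reduction. -/
theorem inv_mul_mem_radical_iff {g h : SpecialLinearGroup k⸨X⸩ V} {d : UBasis ω}
    (hh : translate h (b.lat 0 0) = d.lat 0 0) : h⁻¹ * g ∈ radical (stab (b.lat 0 0)) ↔
    translate g (b.lat 0 0) = d.lat 0 0 ∧
      g.1 b.e0 - h.1 b.e0 ∈ d.lat 1 1 ∧ g.1 b.e1 - h.1 b.e1 ∈ d.lat 1 1 := by
  have h11 : translate h (b.lat 1 1) = d.lat 1 1 := by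
    have e : ∀ c : UBasis ω, c.lat 1 1 = epsMul (c.lat 0 0) := fun c => by rw [epsMul_lat, zero_add]
    rw [translate_lat, e, ← translate_lat, hh, e]
  have hinv : ∀ v : V, (h⁻¹ * g).1 v - v ∈ b.lat 1 1 ↔ g.1 v - h.1 v ∈ d.lat 1 1 := by
    intro v
    have e1 : h.1 ((h⁻¹ * g).1 v) = g.1 v := h.1.apply_symm_apply (g.1 v)
    rw [← e1, ← map_sub, ← h11, mem_translate]
    constructor
    · exact fun hv => ⟨_, hv, rfl⟩
    · rintro ⟨w, hw, hw'⟩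
      rwa [← h.1.injective hw']
  rw [← hinv, ← hinv]
  have hs : h⁻¹ * g ∈ stab (b.lat 0 0) ↔ translate g (b.lat 0 0) = d.lat 0 0 := by
    change translate _ _ = _ ↔ _
    rw [← hh, translate_mul]
    constructor
    · intro h1
      conv_rhs => rw [← h1]
      rw [← translate_mul, mul_inv_cancel, translate_one]
    · intro h1
      rw [h1, ← translate_mul, inv_mul_cancel, translate_one]
  rw [← hs]
  constructor
  · exact fun h1 => ⟨h1.1, sub_mem_of_mem_radical h1 b.e0_mem, sub_mem_of_mem_radical h1 b.e1_mem⟩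
  · rintro ⟨h1, h2, h3⟩
    have := mem_radical_stab_of_sub h1 (one_mem _) h2 h3
    rwa [inv_one, one_mul] at this

/-- The vectors of `b` reduce to a basis of the reduction of the lattice they span. -/
theorem exists_redBasis (b : UBasis ω) : ∃ r : Module.Basis (Fin 2) k (Red (b.lat 0 0)),
    r 0 = Submodule.Quotient.mk ⟨b.e0, b.e0_mem⟩ ∧ r 1 = Submodule.Quotient.mk ⟨b.e1, b.e1_mem⟩ := by
  set E0 : Red (b.lat 0 0) := Submodule.Quotient.mk ⟨b.e0, b.e0_mem⟩
  set E1 : Red (b.lat 0 0) := Submodule.Quotient.mk ⟨b.e1, b.e1_mem⟩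
  have key : ∀ (v : b.lat 0 0) (p q : k), (Submodule.Quotient.mk v : Red (b.lat 0 0)) =
      p • E0 + q • E1 ↔ b.x v - HahnSeries.C p ∈ fil k 1 ∧ b.y v - HahnSeries.C q ∈ fil k 1 := by
    intro v p q
    have h1 : p • E0 + q • E1 =
        Submodule.Quotient.mk (p • ⟨b.e0, b.e0_mem⟩ + q • ⟨b.e1, b.e1_mem⟩) := rfl
    rw [h1, mk_eq_mk_iff, epsMul_lat, zero_add, mem_lat]
    simp only [Submodule.coe_add, Submodule.coe_smul_of_tower, field_smul_eq, map_sub, map_add,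
      map_smul, x_e0, x_e1, y_e0, y_e1, smul_eq_mul, mul_one, mul_zero, add_zero, zero_add]
  have hli : LinearIndependent k ![E0, E1] := by
    rw [LinearIndependent.pair_iff]
    intro p q hpq
    have h1 := (key 0 p q).1 (by rw [hpq]; rfl)
    simp only [Submodule.coe_zero, map_zero, zero_sub, neg_mem_iff] at h1
    exact ⟨C_mem_fil_one_iff.1 h1.1, C_mem_fil_one_iff.1 h1.2⟩
  refine ⟨Module.Basis.mk hli ?_, by rw [Module.Basis.mk_apply]; rfl,
    by rw [Module.Basis.mk_apply]; rfl⟩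
  rintro ξ -
  obtain ⟨v, rfl⟩ := Submodule.Quotient.mk_surjective _ ξ
  rw [(key v _ _).2 ⟨sub_C_coeff_mem v.2.1, sub_C_coeff_mem v.2.2⟩]
  exact add_mem (Submodule.smul_mem _ _ (Submodule.subset_span ⟨0, rfl⟩))
    (Submodule.smul_mem _ _ (Submodule.subset_span ⟨1, rfl⟩))

/-- The element of `SL(V)` that maps the basis `b` to the basis with constant coordinates
`p, q` and `r, s` in terms of `d`. -/
theorem exists_const (b d : UBasis ω) {p q r s : k} (h : p * s - q * r = 1) :
    ∃ g : SpecialLinearGroup k⸨X⸩ V, translate g (b.lat 0 0) = d.lat 0 0 ∧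
      g.1 b.e0 = (HahnSeries.C p : k⸨X⸩) • d.e0 + (HahnSeries.C q : k⸨X⸩) • d.e1 ∧
      g.1 b.e1 = (HahnSeries.C r : k⸨X⸩) • d.e0 + (HahnSeries.C s : k⸨X⸩) • d.e1 := by
  have h' : (HahnSeries.C p * HahnSeries.C s - HahnSeries.C q * HahnSeries.C r : k⸨X⸩) = 1 := by
    rw [← map_mul, ← map_mul, ← map_sub, h, map_one]
  obtain ⟨g, hg⟩ := b.exists_map_eq (d.ofCoeffs _ _ _ _ h')
  refine ⟨g, ?_, ?_, ?_⟩
  · rw [translate_lat, hg, lat_eq_iff rfl]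
    simp only [x_ofCoeffs_e0, x_ofCoeffs_e1, y_ofCoeffs_e0, y_ofCoeffs_e1, sub_zero, C_mem_fil,
      and_self]
  · rw [← map_e0, hg, ofCoeffs_e0]
  · rw [← map_e1, hg, ofCoeffs_e1]

end UBasis

variable {L : Submodule k⟦X⟧ V}

/-- Every element of `SL(V)` induces an element of `Y`. -/
theorem exists_represents (hV : Module.finrank k⸨X⸩ V = 2) (hω : ω ≠ 0)
    (hL : L ∈ unimodularLattices ω) (g : SpecialLinearGroup k⸨X⸩ V) :
    ∃ y : LatticePair ω L, Represents g y := by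
  let f : L ≃ₗ[k⟦X⟧] translate g L := (g.1.restrictScalars k⟦X⟧).submoduleMap L
  have hwedge : ∀ e : Module.Basis (Fin 2) k⟦X⟧ L,
      exteriorPower.ιMulti k⸨X⸩ 2 (fun i => (e i : V)) = ω →
      exteriorPower.ιMulti k⸨X⸩ 2 (fun i => (e.map f i : V)) = ω := by
    intro e he
    obtain ⟨b, -, h0, h1⟩ := UBasis.exists_of_latBasis hV hω e he
    rw [iMulti_pair (g.1 b.e0) (g.1 b.e1), b.wedge_map, b.vol']
    · rw [Module.Basis.map_apply, ← h0]
      rfl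
    · rw [Module.Basis.map_apply, ← h1]
      rfl
  let φ : Red L ≃ₗ[k⟦X⟧] Red (translate g L) := Submodule.Quotient.equiv _ _ f (by
    ext w
    constructor
    · rintro ⟨v, ⟨u, hu, hu'⟩, rfl⟩
      refine ⟨g.1 u, ⟨u, hu, rfl⟩, ?_⟩
      change (PowerSeries.X : k⟦X⟧) • (g.1.restrictScalars k⟦X⟧) u = g.1 v
      rw [← map_smul]
      exact congrArg g.1 hu'
    · rintro ⟨_, ⟨u, hu, rfl⟩, hu'⟩
      refine ⟨⟨(PowerSeries.X : k⟦X⟧) • u, L.smul_mem _ hu⟩, ⟨u, hu, rfl⟩, Subtype.ext ?_⟩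
      exact ((g.1.restrictScalars k⟦X⟧).map_smul PowerSeries.X u).trans hu')
  refine ⟨⟨translate g L, ?_, φ.restrictScalars k, ?_⟩, rfl, ?_⟩
  · obtain ⟨e, he⟩ := hL
    exact ⟨e.map f, hwedge e he⟩
  · rintro _ ⟨e, he, rfl⟩
    refine ⟨e.map f, hwedge e he, ?_⟩
    rw [exteriorPower.map_apply_ιMulti]
    rfl
  · rintro v ⟨_, hw⟩ rfl
    rfl

open UBasis in
/-- Every element of `Y` is induced by an element of `SL(V)`: the matrix of the isomorphism of
reductions, in bases of volume `ω`, has determinant one, and it lifts to a matrix with constant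
entries. -/
theorem Represents.exists (hV : Module.finrank k⸨X⸩ V = 2) (hω : ω ≠ 0)
    (hL : L ∈ unimodularLattices ω) (y : LatticePair ω L) :
    ∃ g : SpecialLinearGroup k⸨X⸩ V, Represents g y := by
  obtain ⟨e, he⟩ := hL
  obtain ⟨b, rfl, h0, h1⟩ := UBasis.exists_of_latBasis hV hω e he
  obtain ⟨M, hM, f, hf⟩ := y
  obtain ⟨e', he', hη⟩ := hf _ ⟨e, he, rfl⟩
  obtain ⟨d, rfl, h0', h1'⟩ := UBasis.exists_of_latBasis hV hω e' he'
  rw [exteriorPower.map_apply_ιMulti] at hη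
  obtain ⟨ρ, hρ0, hρ1⟩ := d.exists_redBasis
  obtain ⟨ρ', hρ'0, hρ'1⟩ := b.exists_redBasis
  have E0 : e 0 = ⟨b.e0, b.e0_mem⟩ := Subtype.ext h0
  have E1 : e 1 = ⟨b.e1, b.e1_mem⟩ := Subtype.ext h1
  have E0' : e' 0 = ⟨d.e0, d.e0_mem⟩ := Subtype.ext h0'
  have E1' : e' 1 = ⟨d.e1, d.e1_mem⟩ := Subtype.ext h1'
  have hexp : ∀ ξ, ∃ p q : k, ξ = p • ρ 0 + q • ρ 1 := fun ξ =>
    ⟨ρ.repr ξ 0, ρ.repr ξ 1, by conv_lhs => rw [← ρ.sum_repr ξ, Fin.sum_univ_two]⟩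
  obtain ⟨p, q, hpq⟩ := hexp (f (ρ' 0))
  obtain ⟨r, s, hrs⟩ := hexp (f (ρ' 1))
  -- preservation of the induced volume elements
  have hdet : p * s - q * r = 1 := by
    refine wedge_basis_smul_eq ρ ?_
    rw [iMulti_pair (ρ 0) (ρ 1) _ rfl rfl, one_smul, ← wedge_comb, ← hpq, ← hrs]
    refine (iMulti_pair _ _ _ ?_ ?_).symm.trans (hη.trans (iMulti_pair _ _ _ ?_ ?_))
    · rw [hρ'0, ← E0]
      rfl
    · rw [hρ'1, ← E1]
      rfl
    · rw [hρ0, ← E0']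
    · rw [hρ1, ← E1']
  obtain ⟨g, hg, hg0, hg1⟩ := b.exists_const d hdet
  obtain ⟨⟨M', hM', f', hf'⟩, hy1, hy2⟩ := exists_represents hV hω ⟨e, he⟩ g
  obtain rfl : M' = d.lat 0 0 := hy1.trans hg
  have hC : ∀ p q : k, p • ρ 0 + q • ρ 1 =
      Submodule.Quotient.mk (p • ⟨d.e0, d.e0_mem⟩ + q • ⟨d.e1, d.e1_mem⟩) := fun p q => by
    rw [hρ0, hρ1]
    rfl
  have hff : f = f' := by
    refine ρ'.ext' fun i => ?_
    fin_cases i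
    · refine hpq.trans ((hC p q).trans ?_)
      rw [Fin.zero_eta, hρ'0]
      refine (hy2 _ _ ?_).symm
      rw [hg0]
      exact congrArg₂ (· + ·) (field_smul_eq p d.e0) (field_smul_eq q d.e1)
    · refine hrs.trans ((hC r s).trans ?_)
      rw [Fin.mk_one, hρ'1]
      refine (hy2 _ _ ?_).symm
      rw [hg1]
      exact congrArg₂ (· + ·) (field_smul_eq r d.e0) (field_smul_eq s d.e1)
  subst hff
  exact ⟨g, hy1, hy2⟩

/-! ### The first step from one lattice towards another -/

theorem codim_self (M : Submodule k⟦X⟧ V) : codim M M = 0 := by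
  have : Subsingleton (M ⧸ (M ⊓ M).submoduleOf M) := by
    rw [Submodule.Quotient.subsingleton_iff, inf_idem]
    exact Submodule.submoduleOf_self M
  exact Module.finrank_zero_of_subsingleton

namespace UBasis

/-- In an apartment through two unimodular lattices, the first step from one towards the other is
the neighbouring vertex between them. -/
theorem isFirstStep_iff (a : UBasis ω) {n : ℕ} (hn : 0 < n) {N : Submodule k⟦X⟧ V} :
    IsFirstStep (a.lat 0 0) (a.lat (-n) n) N ↔ N = a.lat 0 1 := by
  constructor
  · rintro ⟨hN, h1, h2, h3⟩
    have he0 : ∀ c ∈ fil k 0, c • a.e0 ∈ N := fun c hc => by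
      refine h1 ⟨?_, ?_⟩ <;> rw [SetLike.mem_coe, mem_lat] <;>
        simp only [map_smul, x_e0, y_e0, smul_eq_mul, mul_one, mul_zero, zero_mem, and_true]
      · exact hc
      · exact fil_mono (by omega) hc
    obtain ⟨p, hp⟩ := exists_coord_fil hN a a.e1 (Or.inr a.y_e1)
    have hNp : N = a.lat 0 p := by
      ext v
      rw [mem_lat, ← hp]
      have hv : ∀ hx : a.x v ∈ fil k 0, a.y v • a.e1 ∈ N ↔ v ∈ N := fun hx => by
        conv_rhs => rw [← a.eta v]
        exact (N.add_mem_iff_right (he0 _ hx)).symm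
      exact ⟨fun h => ⟨(h2 h).1, (hv (h2 h).1).2 h⟩, fun h => (hv h.1).1 h.2⟩
    subst hNp
    have hp0 : 0 ≤ p := (lat_le_lat_iff.1 h2).2
    lift p to ℕ using hp0
    rw [codim_eq (n := p) (inf_eq_right.2 h2)] at h3
    rw [h3, Nat.cast_one]
  · rintro rfl
    have h : a.lat 0 1 ≤ a.lat 0 0 := lat_le_lat_iff.2 (by omega)
    refine ⟨isLattice_lat, ?_, h, codim_eq (n := 1) (inf_eq_right.2 h)⟩
    rw [lat_inf, lat_le_lat_iff]
    omega

theorem isFirstStep_symm_iff (a : UBasis ω) {n : ℕ} (hn : 0 < n) {N : Submodule k⟦X⟧ V} :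
    IsFirstStep (a.lat (-n) n) (a.lat 0 0) N ↔ N = a.lat (-n + 1) n := by
  obtain ⟨c, hc⟩ := a.exists_reflect n
  have h0 : c.lat 0 0 = a.lat (-n) n := by rw [← vert_zero, hc, sub_zero, vert_even]
  have h1 : c.lat 0 1 = a.lat (-n + 1) n := by
    rw [← vert_one, hc, show 2 * (n : ℤ) - 1 = 2 * (n - 1) + 1 by ring, vert_odd]
    congr 1 <;> ring
  have h2 : c.lat (-n) n = a.lat 0 0 := by rw [← vert_even, hc, sub_self, vert_zero]
  rw [← h0, ← h1, ← h2]
  exact c.isFirstStep_iff hn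

end UBasis

section FirstStep

variable {g : SpecialLinearGroup k⸨X⸩ V} {y : LatticePair ω L}

/-- The isomorphism induced by `g` maps the line of `N` to the line of `gN`. -/
theorem Represents.image_lineOf (h : Represents g y) {N : Submodule k⟦X⟧ V} (hN : N ≤ L) :
    y.iso '' lineOf L N = lineOf y.lat (translate g N) := by
  have hmem : ∀ v ∈ L, g.1 v ∈ y.lat := fun v hv => by
    rw [h.1]
    exact ⟨v, hv, rfl⟩
  ext ξ
  constructor
  · rintro ⟨_, ⟨v, hv, rfl⟩, rfl⟩
    exact ⟨⟨g.1 v, hmem v v.2⟩, ⟨v, hv, rfl⟩, (h.2 _ _ rfl).symm⟩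
  · rintro ⟨w, ⟨v, hv, hw⟩, rfl⟩
    exact ⟨_, ⟨⟨v, hN hv⟩, hv, rfl⟩, h.2 _ _ hw.symm⟩

/-- The lattices between `εM` and `M` correspond to subspaces of `M / εM`. -/
theorem lineOf_inj {M N N' : Submodule k⟦X⟧ V} (h1 : epsMul M ≤ N) (h2 : N ≤ M)
    (h1' : epsMul M ≤ N') (h2' : N' ≤ M) : lineOf M N = lineOf M N' ↔ N = N' := by
  refine ⟨fun h => ?_, fun h => by rw [h]⟩
  have key : ∀ N N' : Submodule k⟦X⟧ V, epsMul M ≤ N' → N ≤ M → lineOf M N ⊆ lineOf M N' →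
      N ≤ N' := by
    intro N N' h1 h2 h v hv
    obtain ⟨w, hw, hvw⟩ := h ⟨⟨v, h2 hv⟩, hv, rfl⟩
    have := N'.sub_mem hw (h1 (mk_eq_mk_iff.1 hvw))
    rwa [sub_sub_cancel] at this
  exact le_antisymm (key N N' h1' h2 h.subset) (key N' N h1 h2' h.symm.subset)

open UBasis in
/-- In an apartment through `L` and `gL`, the two lines that define `Y'ₙ` and `Y''ₙ` agree if and
only if `g` maps the first step from `L` to `gL` to the first step from `gL` to `L`. -/
theorem Represents.mem_layers_iff (h : Represents g y) {a : UBasis ω} {n : ℕ} (hn : 0 < n)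
    (hL : L = a.lat (-n) n) (hg : translate g L = a.lat 0 0) (m : ℕ) :
    (y ∈ layer ω L m ↔ m = n) ∧
    (y ∈ layerEq ω L m ↔ m = n ∧ translate g (a.lat (-n + 1) n) = a.lat 0 1) ∧
    (y ∈ layerNe ω L m ↔ m = n ∧ translate g (a.lat (-n + 1) n) ≠ a.lat 0 1) := by
  subst hL
  have hy : y.lat = a.lat 0 0 := h.1.trans hg
  have hlayer : y ∈ layer ω (a.lat (-n) n) m ↔ m = n := by
    change codim _ _ = m ↔ _
    rw [hy, codim_lat', eq_comm]
  have hle : a.lat (-n + 1) n ≤ a.lat (-n) n := lat_le_lat_iff.2 (by omega)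
  have hgle : translate g (a.lat (-n + 1) n) ≤ a.lat 0 0 := hg ▸ Submodule.map_mono hle
  have hge : epsMul (a.lat 0 0) ≤ translate g (a.lat (-n + 1) n) := by
    rw [← hg, translate_lat, translate_lat, epsMul_lat]
    exact lat_le_lat_iff.2 (by omega)
  have hline : y.iso '' lineOf (a.lat (-n) n) (a.lat (-n + 1) n) = lineOf y.lat (a.lat 0 1) ↔
      translate g (a.lat (-n + 1) n) = a.lat 0 1 := by
    rw [h.image_lineOf hle, hy, lineOf_inj hge hgle]
    · rw [epsMul_lat]
      exact lat_le_lat_iff.2 (by omega)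
    · exact lat_le_lat_iff.2 (by omega)
  have h1 : ∀ N, IsFirstStep (a.lat (-n) n) y.lat N ↔ N = a.lat (-n + 1) n := fun N => by
    rw [hy, isFirstStep_symm_iff a hn]
  have h2 : ∀ N, IsFirstStep y.lat (a.lat (-n) n) N ↔ N = a.lat 0 1 := fun N => by
    rw [hy, isFirstStep_iff a hn]
  refine ⟨hlayer, ?_, ?_⟩
  · rw [← hlayer, ← hline]
    refine and_congr_right fun _ => ?_
    simp only [h1, h2, ↓existsAndEq, true_and]
  · rw [← hlayer, ne_eq, ← hline]
    refine and_congr_right fun _ => ?_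
    simp only [h1, h2, ↓existsAndEq, true_and, ne_eq]

open UBasis in
/-- The form of `Represents.mem_layers_iff` for an apartment whose vertex `0` is `L`. -/
theorem Represents.mem_layers_iff' (h : Represents g y) {c : UBasis ω} {n : ℕ} (hn : 0 < n)
    (hL : L = c.lat 0 0) (hg : translate g L = c.lat (-n) n) (m : ℕ) :
    (y ∈ layer ω L m ↔ m = n) ∧
    (y ∈ layerEq ω L m ↔ m = n ∧ translate g (c.lat 0 1) = c.lat (-n + 1) n) ∧
    (y ∈ layerNe ω L m ↔ m = n ∧ translate g (c.lat 0 1) ≠ c.lat (-n + 1) n) := by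
  obtain ⟨a, ha⟩ := c.exists_reflect n
  have key : ∀ a : UBasis ω, a.vert (2 * n - 1) = a.lat (-n + 1) n := fun a => by
    rw [show 2 * (n : ℤ) - 1 = 2 * (n - 1) + 1 by ring, vert_odd]
    congr 1 <;> ring
  have h0 : a.lat 0 0 = c.lat (-n) n := by rw [← vert_zero, ha, sub_zero, vert_even]
  have h1 : a.lat 0 1 = c.lat (-n + 1) n := by rw [← vert_one, ha, key]
  have h2 : a.lat (-n) n = c.lat 0 0 := by rw [← vert_even, ha, sub_self, vert_zero]
  have h3 : a.lat (-n + 1) n = c.lat 0 1 := by rw [← key, ha, sub_sub_cancel, vert_one]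
  rw [← h1, ← h3]
  exact h.mem_layers_iff hn (hL.trans h2.symm) (hg.trans h0.symm) m

theorem Represents.mem_layer_iff_of_eq (h : Represents g y) (hg : translate g L = L) (m : ℕ) :
    y ∈ layer ω L m ↔ m = 0 := by
  change codim _ _ = m ↔ _
  rw [h.1, hg, codim_self, eq_comm]

open UBasis in
/-- Either `gL = L`, or there is an apartment through the two lattices in which `gL` is the vertex
`0` and `L` is the vertex `2n` with `n > 0`. -/
theorem exists_apartment_translate (hV : Module.finrank k⸨X⸩ V = 2) (hω : ω ≠ 0)
    (hL : L ∈ unimodularLattices ω) (g : SpecialLinearGroup k⸨X⸩ V) : translate g L = L ∨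
    ∃ (a : UBasis ω) (n : ℕ), 0 < n ∧ L = a.lat (-n) n ∧ translate g L = a.lat 0 0 := by
  obtain ⟨b, rfl⟩ := exists_lat_eq hV hω hL
  obtain ⟨a, n, hn, h1, h2⟩ := exists_cartan (b.map g) b
  lift n to ℕ using hn
  rw [translate_lat]
  rcases n.eq_zero_or_pos with rfl | hn
  · left
    rw [h1, h2, Nat.cast_zero, neg_zero]
  · exact Or.inr ⟨a, n, hn, h2, h1⟩

end FirstStep

open UBasis in
/-- Two elements of `SL(V)` represent the same element of `Y` if and only if they have the same
class modulo `U_P`. -/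
theorem Represents.iff_inv_mul_mem {b : UBasis ω} {g h : SpecialLinearGroup k⸨X⸩ V}
    {y : LatticePair ω L} (hg : Represents g y) (hL : L = b.lat 0 0) :
    Represents h y ↔ g⁻¹ * h ∈ radical (stab L) := by
  subst hL
  have he : epsMul y.lat = (b.map g).lat 1 1 := by
    rw [hg.1, translate_lat, epsMul_lat, zero_add]
  constructor
  · intro hh
    rw [inv_mul_mem_radical_iff (translate_lat g), ← he]
    exact ⟨by rw [← translate_lat, ← hg.1, hh.1], hh.sub_mem hg b.e0_mem, hh.sub_mem hg b.e1_mem⟩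
  · intro hr
    refine ⟨?_, fun v w hw => ?_⟩
    · have h1 : translate (g⁻¹ * h) (b.lat 0 0) = b.lat 0 0 := hr.1
      rw [hg.1]
      conv_lhs => rw [← h1]
      rw [← translate_mul, mul_inv_cancel_left]
    · have hv : g.1 v ∈ y.lat := by
        rw [hg.1]
        exact ⟨v, v.2, rfl⟩
      rw [hg.2 v ⟨_, hv⟩ rfl, mk_eq_mk_iff, he, ← translate_lat, ← neg_mem_iff, neg_sub, hw]
      refine ⟨_, sub_mem_of_mem_radical hr v.2, ?_⟩
      change g.1 ((g⁻¹).1 (h.1 v) - v) = _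
      rw [map_sub]
      exact congrArg (· - g.1 v) (g.1.apply_symm_apply (h.1 v))

/-- The bijection between `SL(V) / U_P` and `Y`. -/
theorem exists_equiv (hV : Module.finrank k⸨X⸩ V = 2) (hω : ω ≠ 0)
    (hL : L ∈ unimodularLattices ω) :
    ∃ Φ : (SpecialLinearGroup k⸨X⸩ V ⧸ radical (stab L)) ≃ LatticePair ω L,
      ∀ g : SpecialLinearGroup k⸨X⸩ V, Represents g (Φ g) := by
  choose y hy using exists_represents hV hω hL
  obtain ⟨b, rfl⟩ := UBasis.exists_lat_eq hV hω hL
  let f : (SpecialLinearGroup k⸨X⸩ V ⧸ radical (stab (b.lat 0 0))) → LatticePair ω (b.lat 0 0) :=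
    Quotient.lift (s := QuotientGroup.leftRel _) y fun g h hgh =>
      (((hy g).iff_inv_mul_mem rfl).2 (QuotientGroup.leftRel_apply.1 hgh)).eq (hy h)
  refine ⟨Equiv.ofBijective f ⟨?_, fun z => ?_⟩, hy⟩
  · intro g h
    induction g using QuotientGroup.induction_on with | H g => ?_
    induction h using QuotientGroup.induction_on with | H h => ?_
    intro hgh
    have h1 : Represents h (y g) := (show y g = y h from hgh) ▸ hy h
    exact QuotientGroup.eq.2 (((hy g).iff_inv_mul_mem rfl).1 h1)
  · obtain ⟨g, hg⟩ := Represents.exists hV hω hL z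
    exact ⟨g, (hy g).eq hg⟩

/-! ### The partition into pieces -/

/-- The sets `Y₀`, `Y'ₙ` and `Y''ₙ` with `n > 0`: `none` is the index of `Y₀`, and `(m, true)` and
`(m, false)` are those of `Y'ₘ₊₁` and `Y''ₘ₊₁`. -/
def stratum (ω : ⋀[LaurentSeries k]^2 V) (L : Submodule k⟦X⟧ V) :
    Option (ℕ × Bool) → Set (LatticePair ω L)
  | none => layer ω L 0
  | some (m, true) => layerEq ω L (m + 1)
  | some (m, false) => layerNe ω L (m + 1)

theorem range_stratum : Set.range (stratum ω L) = {layer ω L 0} ∪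
    {S | ∃ n > 0, S = layerEq ω L n} ∪ {S | ∃ n > 0, S = layerNe ω L n} := by
  ext S
  constructor
  · rintro ⟨_ | ⟨m, _ | _⟩, rfl⟩
    · exact Or.inl (Or.inl rfl)
    · exact Or.inr ⟨m + 1, m.succ_pos, rfl⟩
    · exact Or.inl (Or.inr ⟨m + 1, m.succ_pos, rfl⟩)
  · rintro ((rfl | ⟨n, hn, rfl⟩) | ⟨n, hn, rfl⟩)
    · exact ⟨none, rfl⟩
    · obtain ⟨m, rfl⟩ := Nat.exists_eq_add_one.2 hn
      exact ⟨some (m, true), rfl⟩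
    · obtain ⟨m, rfl⟩ := Nat.exists_eq_add_one.2 hn
      exact ⟨some (m, false), rfl⟩

namespace UBasis

/-- The element of `𝒯(J)` that indexes the piece corresponding to `stratum ω L i`. -/
noncomputable def seqOf (b : UBasis ω) : Option (ℕ × Bool) → ℕ → Set (Weyl ω) × Weyl ω
  | none => b.seqZero
  | some (m, true) => b.seqPos (m + 1) (2 * ((m + 1 : ℕ) : ℤ) - 1)
  | some (m, false) => b.seqPos (m + 1) (2 * ((m + 1 : ℕ) : ℤ))

theorem seqOf_injective (b : UBasis ω) : Function.Injective b.seqOf := by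
  intro i j hij
  have h1 := congrArg Prod.snd (congrFun hij 1)
  rcases i with _ | ⟨m, _ | _⟩ <;> rcases j with _ | ⟨m', _ | _⟩
  all_goals
    have h2 := b.w_injective h1
    first
      | rfl
      | exfalso; omega
      | obtain rfl : m = m' := by omega
        rfl

end UBasis

/-- Every element of `Y` lies in exactly one stratum, and the sequence attached to a representative
is the one that has the same index. -/
theorem Represents.exists_stratum (hV : Module.finrank k⸨X⸩ V = 2) (hω : ω ≠ 0)
    (hL : L ∈ unimodularLattices ω) {g : SpecialLinearGroup k⸨X⸩ V} {y : LatticePair ω L}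
    (h : Represents g y) : ∃ i, (∀ j, y ∈ stratum ω L j ↔ j = i) ∧
      ∀ [Group (Weyl ω)] (b : UBasis ω), (∀ i j, b.w i * b.w j = b.w (UBasis.wmul i j)) →
        HasSequence (stab L) g (b.seqOf i) := by
  rcases exists_apartment_translate hV hω hL g with hg | ⟨a, n, hn, rfl, hg⟩
  · refine ⟨none, ?_, ?_⟩
    · rintro (_ | ⟨m, _ | _⟩)
      · exact iff_of_true ((h.mem_layer_iff_of_eq hg 0).2 rfl) rfl
      · refine iff_of_false (fun hy => ?_) (by simp)
        have := (h.mem_layer_iff_of_eq hg _).1 hy.1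
        omega
      · refine iff_of_false (fun hy => ?_) (by simp)
        have := (h.mem_layer_iff_of_eq hg _).1 hy.1
        omega
    · intro _ b hb
      obtain ⟨a, rfl⟩ := UBasis.exists_lat_eq hV hω hL
      exact UBasis.hasSequence_zero hb a hg
  · obtain ⟨m, rfl⟩ := Nat.exists_eq_add_one.2 hn
    have key := h.mem_layers_iff hn rfl hg
    by_cases hline : translate g (a.lat (-(m + 1 : ℕ) + 1) (m + 1 : ℕ)) = a.lat 0 1
    · refine ⟨some (m, true), ?_, ?_⟩
      · rintro (_ | ⟨m', _ | _⟩)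
        · exact (key 0).1.trans (iff_of_false (by omega) (by simp))
        · exact (key (m' + 1)).2.2.trans (iff_of_false (fun h => h.2 hline) (by simp))
        · exact (key (m' + 1)).2.1.trans (by rw [and_iff_left hline]; simp)
      · intro _ b hb
        have := UBasis.hasSequence_pos hb a hn hg
        rwa [if_pos hline] at this
    · refine ⟨some (m, false), ?_, ?_⟩
      · rintro (_ | ⟨m', _ | _⟩)
        · exact (key 0).1.trans (iff_of_false (by omega) (by simp))
        · exact (key (m' + 1)).2.2.trans (by rw [and_iff_left hline]; simp)
        · exact (key (m' + 1)).2.1.trans (iff_of_false (fun h => hline h.2) (by simp))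
      · intro _ b hb
        have := UBasis.hasSequence_pos hb a hn hg
        rwa [if_neg hline] at this

namespace UBasis

/-- The basis `ε⁻ⁿ e₀`, `εⁿ e₁`. -/
noncomputable def scale (c : UBasis ω) (n : ℕ) : UBasis ω :=
  c.ofCoeffs (tpow k (-n)) 0 0 (tpow k n) (by
    rw [mul_comm, tpow_mul_neg, zero_mul, sub_zero])

theorem lat_scale (c : UBasis ω) (n : ℕ) (i j : ℤ) :
    (c.scale n).lat i j = c.lat (i - n) (j + n) := by
  rw [lat_eq_iff (by ring)]
  simp only [scale, x_ofCoeffs_e0, y_ofCoeffs_e0, x_ofCoeffs_e1, y_ofCoeffs_e1, tpow_mem_fil,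
    zero_mem, and_true, true_and]
  omega

/-- If `g` maps the lattice of `c` to the vertex `2n`, the condition that separates `Y'ₙ` from
`Y''ₙ` is the vanishing of the first entry of the reduction of the matrix of `g` in the bases `c`
and `c.scale n`. -/
theorem translate_lat_eq_scale_iff {c : UBasis ω} {n : ℕ} {g : SpecialLinearGroup k⸨X⸩ V}
    (hg : translate g (c.lat 0 0) = (c.scale n).lat 0 0) :
    translate g (c.lat 0 1) = c.lat (-n + 1) n ↔ (c.scale n).x (g.1 c.e0) ∈ fil k 1 := by
  have h1 : c.lat (-n + 1) n = (c.scale n).lat 1 0 := by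
    rw [lat_scale]
    congr 1 <;> ring
  rw [translate_lat, lat_eq_iff rfl, map_e0, map_e1] at hg
  rw [h1, translate_lat, lat_eq_iff (by ring), map_e0, map_e1]
  simp only [sub_zero, sub_self] at hg ⊢
  exact ⟨fun h => h.1.1, fun h => ⟨⟨h, hg.1.2⟩, hg.2.1, fil_mono (by omega) hg.2.2⟩⟩

end UBasis

open UBasis in
theorem stratum_nonempty (hV : Module.finrank k⸨X⸩ V = 2) (hω : ω ≠ 0)
    (hL : L ∈ unimodularLattices ω) (i : Option (ℕ × Bool)) : (stratum ω L i).Nonempty := by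
  obtain ⟨c, rfl⟩ := UBasis.exists_lat_eq hV hω hL
  rcases i with _ | ⟨m, β⟩
  · obtain ⟨y, hy⟩ := exists_represents hV hω hL 1
    exact ⟨y, (hy.mem_layer_iff_of_eq (translate_one _) 0).2 rfl⟩
  · -- the reduction of `g` is the identity or a quarter turn, in coordinates adapted to `L`, `gL`
    obtain ⟨p, q, hpq, hp⟩ : ∃ p q : k, p * p - q * (-q) = 1 ∧ (p = 0 ↔ β = true) := by
      cases β
      · exact ⟨1, 0, by simp, by simp⟩
      · exact ⟨0, 1, by simp, by simp⟩
    obtain ⟨g, hg, hg0, -⟩ := c.exists_const (c.scale (m + 1)) hpq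
    obtain ⟨y, hy⟩ := exists_represents hV hω hL g
    have hg' : translate g (c.lat 0 0) = c.lat (-(m + 1 : ℕ)) (m + 1 : ℕ) := by
      rw [hg, lat_scale, zero_sub, zero_add]
    have key := hy.mem_layers_iff' m.succ_pos rfl hg' (m + 1)
    have hx : (c.scale (m + 1)).x (g.1 c.e0) ∈ fil k 1 ↔ β = true := by
      rw [hg0, ← hp]
      simp only [map_add, map_smul, x_e0, x_e1, smul_eq_mul, mul_one, mul_zero, add_zero,
        C_mem_fil_one_iff]
    rw [ne_eq, translate_lat_eq_scale_iff hg, hx] at key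
    refine ⟨y, ?_⟩
    cases β
    · exact key.2.2.2 ⟨rfl, by simp⟩
    · exact key.2.1.2 ⟨rfl, rfl⟩

theorem isPartition_strata (hV : Module.finrank k⸨X⸩ V = 2) (hω : ω ≠ 0)
    (hL : L ∈ unimodularLattices ω) : Setoid.IsPartition (Set.range (stratum ω L)) := by
  refine ⟨?_, fun y => ?_⟩
  · rintro ⟨i, hi⟩
    exact (stratum_nonempty hV hω hL i).ne_empty hi
  · obtain ⟨g, hg⟩ := Represents.exists hV hω hL y
    obtain ⟨i, hi, -⟩ := hg.exists_stratum hV hω hL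
    refine ⟨stratum ω L i, ⟨⟨i, rfl⟩, (hi i).2 rfl⟩, ?_⟩
    rintro _ ⟨⟨j, rfl⟩, hj⟩
    rw [(hi j).1 hj]

theorem stratum_injective (hV : Module.finrank k⸨X⸩ V = 2) (hω : ω ≠ 0)
    (hL : L ∈ unimodularLattices ω) : Function.Injective (stratum ω L) := by
  intro i j hij
  obtain ⟨y, hy⟩ := stratum_nonempty hV hω hL i
  obtain ⟨g, hg⟩ := Represents.exists hV hω hL y
  obtain ⟨l, hl, -⟩ := hg.exists_stratum hV hω hL
  rw [(hl i).1 hy, (hl j).1 (hij ▸ hy)]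

/-- The pieces are the strata: `𝒯(J)` consists of the sequences `seqOf i`, and
`Represents.exists_stratum` identifies the piece of `seqOf i` with `stratum ω L i`. -/
theorem bijOn_pieces (hV : Module.finrank k⸨X⸩ V = 2) (hω : ω ≠ 0)
    (hL : L ∈ unimodularLattices ω)
    {Φ : (SpecialLinearGroup k⸨X⸩ V ⧸ radical (stab L)) ≃ LatticePair ω L}
    (hΦ : ∀ g : SpecialLinearGroup k⸨X⸩ V, Represents g (Φ g)) [grp : Group (Weyl ω)]
    (hW : IsWeylGroup ω grp) :
    Set.BijOn (fun t => Φ '' piece (stab L) t) (sequences (type ω (stab L)))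
      (Set.range (stratum ω L)) := by
  obtain ⟨b, hb⟩ := UBasis.exists_lat_eq hV hω hL
  have hlaw := b.mul_eq_of_isWeylGroup hW
  have hseq : ∀ t, t ∈ sequences (type ω (stab L)) ↔ ∃ i, b.seqOf i = t := by
    intro t
    rw [hb, UBasis.type_stab b b, UBasis.mem_sequences_iff hlaw]
    constructor
    · rintro (rfl | ⟨n, hn, rfl | rfl⟩)
      · exact ⟨none, rfl⟩
      · obtain ⟨m, rfl⟩ := Nat.exists_eq_add_one.2 hn
        exact ⟨some (m, true), rfl⟩
      · obtain ⟨m, rfl⟩ := Nat.exists_eq_add_one.2 hn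
        exact ⟨some (m, false), rfl⟩
    · rintro ⟨_ | ⟨m, _ | _⟩, rfl⟩
      · exact Or.inl rfl
      · exact Or.inr ⟨m + 1, m.succ_pos, Or.inr rfl⟩
      · exact Or.inr ⟨m + 1, m.succ_pos, Or.inl rfl⟩
  have hpiece : ∀ i, Φ '' piece (stab L) (b.seqOf i) = stratum ω L i := by
    intro i
    ext y
    constructor
    · rintro ⟨_, ⟨g, rfl, hg⟩, rfl⟩
      obtain ⟨j, hj, hj'⟩ := (hΦ g).exists_stratum hV hω hL
      rw [hj]
      exact b.seqOf_injective (UBasis.HasSequence.unique hg (hj' b hlaw))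
    · intro hy
      obtain ⟨g, hg⟩ := Represents.exists hV hω hL y
      obtain ⟨j, hj, hj'⟩ := hg.exists_stratum hV hω hL
      obtain rfl := (hj i).1 hy
      exact ⟨g, ⟨g, rfl, hj' b hlaw⟩, (hΦ g).eq hg⟩
  refine ⟨fun t ht => ?_, fun t ht t' ht' h => ?_, ?_⟩
  · obtain ⟨i, rfl⟩ := (hseq t).1 ht
    exact ⟨i, (hpiece i).symm⟩
  · obtain ⟨i, rfl⟩ := (hseq t).1 ht
    obtain ⟨j, rfl⟩ := (hseq t').1 ht'
    change Φ '' _ = Φ '' _ at h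
    rw [hpiece, hpiece] at h
    rw [stratum_injective hV hω hL h]
  · rintro _ ⟨i, rfl⟩
    exact ⟨b.seqOf i, (hseq _).2 ⟨i, rfl⟩, hpiece i⟩

/-! ### Counting points over a finite field -/

section Matrices

/-- Determinant one matrices with vanishing first entry. -/
noncomputable def slZeroEquiv (k : Type*) [Field k] :
    {m : Matrix.SpecialLinearGroup (Fin 2) k | m.1 0 0 = 0} ≃ kˣ × k where
  toFun m := (Units.mkOfMulEqOne (m.1.1 0 1) (-m.1.1 1 0) (by
    have h1 := m.1.2
    have h2 : m.1.1 0 0 = 0 := m.2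
    rw [Matrix.det_fin_two, h2] at h1
    linear_combination h1), m.1.1 1 1)
  invFun z := ⟨⟨!![0, (z.1 : k); -(z.1⁻¹ : kˣ), z.2], by simp [Matrix.det_fin_two]⟩, rfl⟩
  left_inv m := by
    have h2 : m.1.1 0 0 = 0 := m.2
    ext i j
    fin_cases i <;> fin_cases j <;> simp [h2, Units.mkOfMulEqOne]
  right_inv z := by
    ext <;> simp [Units.mkOfMulEqOne]

/-- Determinant one matrices with invertible first entry. -/
noncomputable def slNeEquiv (k : Type*) [Field k] :
    {m : Matrix.SpecialLinearGroup (Fin 2) k | m.1 0 0 ≠ 0} ≃ kˣ × k × k where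
  toFun m := (Units.mk0 (m.1.1 0 0) m.2, m.1.1 0 1, m.1.1 1 0)
  invFun z := ⟨⟨!![(z.1 : k), z.2.1; z.2.2, (z.1⁻¹ : kˣ) * (1 + z.2.1 * z.2.2)], by
    rw [Matrix.det_fin_two]
    simp⟩, z.1.ne_zero⟩
  left_inv m := by
    have h1 := m.1.2
    have h2 : m.1.1 0 0 ≠ 0 := m.2
    rw [Matrix.det_fin_two] at h1
    ext i j
    fin_cases i <;> fin_cases j <;> simp
    field_simp
    linear_combination -h1
  right_inv z := by
    ext <;> simp

theorem ncard_sl_zero (k : Type*) [Field k] [Finite k] :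
    {m : Matrix.SpecialLinearGroup (Fin 2) k | m.1 0 0 = 0}.ncard =
      (Nat.card k - 1) * Nat.card k := by
  rw [← Nat.card_coe_set_eq, Nat.card_congr (slZeroEquiv k), Nat.card_prod, Nat.card_units]

theorem ncard_sl_ne (k : Type*) [Field k] [Finite k] :
    {m : Matrix.SpecialLinearGroup (Fin 2) k | m.1 0 0 ≠ 0}.ncard =
      (Nat.card k - 1) * Nat.card k ^ 2 := by
  rw [← Nat.card_coe_set_eq, Nat.card_congr (slNeEquiv k), Nat.card_prod, Nat.card_prod,
    Nat.card_units, sq]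

theorem card_sl (k : Type*) [Field k] [Finite k] :
    Nat.card (Matrix.SpecialLinearGroup (Fin 2) k) = Nat.card k * (Nat.card k ^ 2 - 1) := by
  rw [← Set.ncard_add_ncard_compl {m : Matrix.SpecialLinearGroup (Fin 2) k | m.1 0 0 = 0},
    ncard_sl_zero, show {m : Matrix.SpecialLinearGroup (Fin 2) k | m.1 0 0 = 0}ᶜ =
      {m | m.1 0 0 ≠ 0} from rfl, ncard_sl_ne]
  obtain ⟨r, hr⟩ := Nat.exists_eq_add_one.2 (Nat.card_pos (α := k))
  rw [hr, show (r + 1) ^ 2 - 1 = r * (r + 2) from Nat.sub_eq_of_eq_add (by ring),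
    Nat.add_sub_cancel]
  ring

end Matrices

open UBasis in
/-- A family of bases of `L` whose `n`-th vertices are all the lattices at distance `n` from `L`
gives coordinates on `Yₙ`. -/
theorem exists_layer_coordinates (hV : Module.finrank k⸨X⸩ V = 2) (hω : ω ≠ 0)
    (hL : L ∈ unimodularLattices ω) {ι : Type*} (c : ι → UBasis ω) (n : ℕ)
    (hc : ∀ i, L = (c i).lat 0 0) (hinj : Function.Injective fun i => (c i).lat (-n) n)
    (hsurj : ∀ M ∈ unimodularLattices ω, codim L M = n → ∃ i, M = (c i).lat (-n) n) :
    ∃ F : ι × Matrix.SpecialLinearGroup (Fin 2) k → LatticePair ω L, Function.Injective F ∧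
      F '' Set.univ = layer ω L n ∧ (0 < n →
        F '' (Set.univ ×ˢ {m | m.1 0 0 = 0}) = layerEq ω L n ∧
        F '' (Set.univ ×ˢ {m | m.1 0 0 ≠ 0}) = layerNe ω L n) := by
  -- the matrix `m` induces an isomorphism in the bases `c i` of `L` and `(c i).scale n` of `L'`
  have hex : ∀ z : ι × Matrix.SpecialLinearGroup (Fin 2) k, ∃ (y : LatticePair ω L)
      (g : SpecialLinearGroup k⸨X⸩ V), Represents g y ∧
      translate g L = ((c z.1).scale n).lat 0 0 ∧
      g.1 (c z.1).e0 = (HahnSeries.C (z.2.1 0 0) : k⸨X⸩) • ((c z.1).scale n).e0 +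
        (HahnSeries.C (z.2.1 0 1) : k⸨X⸩) • ((c z.1).scale n).e1 ∧
      g.1 (c z.1).e1 = (HahnSeries.C (z.2.1 1 0) : k⸨X⸩) • ((c z.1).scale n).e0 +
        (HahnSeries.C (z.2.1 1 1) : k⸨X⸩) • ((c z.1).scale n).e1 := by
    intro z
    obtain ⟨g, h1, h2, h3⟩ := (c z.1).exists_const ((c z.1).scale n)
      (p := z.2.1 0 0) (q := z.2.1 0 1) (r := z.2.1 1 0) (s := z.2.1 1 1)
      (by rw [← Matrix.det_fin_two]; exact z.2.2)
    obtain ⟨y, hy⟩ := exists_represents hV hω hL g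
    exact ⟨y, g, hy, by rw [hc z.1, h1], h2, h3⟩
  choose F g hF hgL hg0 hg1 using hex
  have hscale : ∀ i, ((c i).scale n).lat 0 0 = (c i).lat (-n) n := fun i => by
    rw [lat_scale, zero_sub, zero_add]
  have hlat : ∀ z, (F z).lat = (c z.1).lat (-n) n := fun z => by
    rw [(hF z).1, hgL, hscale]
  have hlayer : ∀ z, F z ∈ layer ω L n := fun z => by
    change codim _ _ = _
    rw [hlat, hc z.1, codim_lat]
  have hFinj : Function.Injective F := by
    rintro ⟨i, m⟩ ⟨j, m'⟩ h
    obtain rfl : i = j := hinj (by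
      change (c i).lat (-n) n = (c j).lat (-n) n
      rw [← hlat (i, m), ← hlat (j, m'), h])
    have h11 : epsMul (F (i, m)).lat = ((c i).scale n).lat 1 1 := by
      rw [(hF _).1, hgL, epsMul_lat, zero_add]
    have hrep : Represents (g (i, m')) (F (i, m)) := h ▸ hF (i, m')
    have hsub : ∀ v ∈ L, (g (i, m)).1 v - (g (i, m')).1 v ∈ ((c i).scale n).lat 1 1 :=
      fun v hv => h11 ▸ (hF (i, m)).sub_mem hrep hv
    have h0 := hsub (c i).e0 (hc i ▸ (c i).e0_mem)
    have h1 := hsub (c i).e1 (hc i ▸ (c i).e1_mem)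
    rw [hg0, hg0, mem_lat] at h0
    rw [hg1, hg1, mem_lat] at h1
    simp only [map_sub, map_add, map_smul, x_e0, x_e1, y_e0, y_e1, smul_eq_mul, mul_one, mul_zero,
      add_zero, zero_add] at h0 h1
    simp only [← map_sub, C_mem_fil_one_iff, sub_eq_zero] at h0 h1
    refine Prod.ext rfl (Matrix.SpecialLinearGroup.ext _ _ fun a b => ?_)
    fin_cases a <;> fin_cases b
    exacts [h0.1, h0.2, h1.1, h1.2]
  have hrange : F '' Set.univ = layer ω L n := by
    ext y
    constructor
    · rintro ⟨z, -, rfl⟩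
      exact hlayer z
    · intro hy
      obtain ⟨i, hi⟩ := hsurj y.lat y.lat_mem hy
      obtain ⟨h, hh⟩ := Represents.exists hV hω hL y
      have hhL : translate h L = ((c i).scale n).lat 0 0 := by rw [hscale, ← hi, hh.1]
      have hhc : translate h ((c i).lat 0 0) = ((c i).scale n).lat 0 0 := by rw [← hc i, hhL]
      have hcoef := hhc
      rw [translate_lat, lat_eq_iff rfl, map_e0, map_e1] at hcoef
      simp only [sub_zero] at hcoef
      obtain ⟨⟨hp, hq⟩, hr, hs⟩ := hcoef
      have hdet := ((c i).scale n).det_eq ((c i).map h)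
      rw [map_e0, map_e1] at hdet
      have hdet0 := congrArg (fun c : k⸨X⸩ => c.coeff 0) hdet
      simp only [HahnSeries.coeff_sub, coeff_zero_mul hp hs, coeff_zero_mul hq hr] at hdet0
      -- the reduction of `h` modulo `ε`
      let m : Matrix.SpecialLinearGroup (Fin 2) k :=
        ⟨!![(((c i).scale n).x (h.1 (c i).e0)).coeff 0, (((c i).scale n).y (h.1 (c i).e0)).coeff 0;
          (((c i).scale n).x (h.1 (c i).e1)).coeff 0, (((c i).scale n).y (h.1 (c i).e1)).coeff 0],
          by rw [Matrix.det_fin_two_of, hdet0]; simp⟩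
      refine ⟨(i, m), trivial, (hF (i, m)).eq ?_⟩
      have hC : ∀ c ∈ fil k 0, HahnSeries.C (c.coeff 0) - c ∈ fil k 1 := fun c hc => by
        rw [← neg_mem_iff, neg_sub]
        exact sub_C_coeff_mem hc
      rw [hh.iff_inv_mul_mem (hc i), hc i, inv_mul_mem_radical_iff hhc, ← hc i, hg0, hg1, mem_lat,
        mem_lat]
      simp only [map_sub, map_add, map_smul, x_e0, x_e1, y_e0, y_e1, smul_eq_mul, mul_one,
        mul_zero, add_zero, zero_add]
      exact ⟨hgL _, ⟨hC _ hp, hC _ hq⟩, hC _ hr, hC _ hs⟩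
  refine ⟨F, hFinj, hrange, fun hn => ?_⟩
  have key : ∀ z, (F z ∈ layerEq ω L n ↔ z.2.1 0 0 = 0) ∧
      (F z ∈ layerNe ω L n ↔ z.2.1 0 0 ≠ 0) := by
    intro z
    have h1 := (hF z).mem_layers_iff' hn (hc z.1) (by rw [hgL, hscale]) n
    have h2 : translate (g z) ((c z.1).lat 0 0) = ((c z.1).scale n).lat 0 0 := by
      rw [← hc, hgL]
    rw [ne_eq, translate_lat_eq_scale_iff h2, hg0] at h1
    simp only [map_add, map_smul, x_e0, x_e1, smul_eq_mul, mul_one, mul_zero, add_zero,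
      C_mem_fil_one_iff, true_and] at h1
    exact h1.2
  constructor
  · ext y
    constructor
    · rintro ⟨z, hz, rfl⟩
      exact (key z).1.2 hz.2
    · intro hy
      obtain ⟨z, -, rfl⟩ := hrange.superset hy.1
      exact ⟨z, ⟨trivial, (key z).1.1 hy⟩, rfl⟩
  · ext y
    constructor
    · rintro ⟨z, hz, rfl⟩
      exact (key z).2.2 hz.2
    · intro hy
      obtain ⟨z, -, rfl⟩ := hrange.superset hy.1
      exact ⟨z, ⟨trivial, (key z).2.1 hy⟩, rfl⟩

namespace UBasis

/-- Bases of the lattice of `b` whose first vector is `e₀ + t e₁` with a polynomial `t` of degree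
less than `2n`, or `t e₀ + e₁` with a polynomial `t` of degree less than `2n` and constant term
zero. -/
noncomputable def direction (b : UBasis ω) (n : ℕ) :
    (Fin (2 * n) → k) ⊕ (Fin (2 * n - 1) → k) → UBasis ω
  | Sum.inl u => b.ofCoeffs 1 (ofFun 0 u) 0 1 (by ring)
  | Sum.inr u => b.ofCoeffs (ofFun 1 u) 1 (-1) 0 (by ring)

theorem lat_direction (b : UBasis ω) (n : ℕ) (i : (Fin (2 * n) → k) ⊕ (Fin (2 * n - 1) → k)) :
    b.lat 0 0 = (b.direction n i).lat 0 0 := by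
  symm
  rw [lat_eq_iff rfl]
  rcases i with u | u <;>
    simp only [direction, x_ofCoeffs_e0, y_ofCoeffs_e0, x_ofCoeffs_e1, y_ofCoeffs_e1, sub_zero,
      one_mem_fil, zero_mem, neg_mem_iff, le_refl, and_true, true_and]
  · exact ofFun_mem_fil 0 u
  · exact fil_mono (by omega) (ofFun_mem_fil 1 u)

theorem eq_of_ofFun_sub_mem {a : ℤ} {n : ℕ} {u u' : Fin n → k}
    (h : ofFun a u - ofFun a u' ∈ fil k (a + n)) : u = u' := by
  rw [← window_eq_zero_iff (sub_mem (ofFun_mem_fil _ _) (ofFun_mem_fil _ _)), map_sub,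
    window_ofFun, window_ofFun, sub_eq_zero] at h
  exact h

theorem ofFun_window_sub_mem {a : ℤ} {n : ℕ} {c : k⸨X⸩} (hc : c ∈ fil k a) :
    ofFun a (window a n c) - c ∈ fil k (a + n) := by
  rw [← window_eq_zero_iff (sub_mem (ofFun_mem_fil _ _) hc), map_sub, window_ofFun, sub_self]

/-- The lattice determines the first basis vector up to units and modulo `ε^(2n)`, and hence the
polynomial. -/
theorem direction_injective (b : UBasis ω) {n : ℕ} (hn : 0 < n) :
    Function.Injective fun i => (b.direction n i).lat (-n) n := by
  intro i j h
  have h1 := ((lat_eq_iff rfl).1 h.symm).1.2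
  rw [b.y_change] at h1
  have hone : (1 : k⸨X⸩) ∉ fil k 1 := by
    rw [one_mem_fil]
    omega
  rcases i with u | u <;> rcases j with u' | u' <;>
    simp only [direction, x_ofCoeffs_e0, y_ofCoeffs_e0, one_mul, mul_one] at h1
  · rw [eq_of_ofFun_sub_mem (fil_mono (by omega) h1)]
  · have h2 := mul_mem_fil (l := 1) (ofFun_mem_fil 0 u) (ofFun_mem_fil 1 u') (by omega)
    exact absurd (by simpa using add_mem (fil_mono (m := 1) (by omega) h1) h2) hone
  · have h2 := mul_mem_fil (l := 1) (ofFun_mem_fil 1 u) (ofFun_mem_fil 0 u') (by omega)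
    exact absurd (by simpa using sub_mem h2 (fil_mono (m := 1) (by omega) h1)) hone
  · rw [eq_of_ofFun_sub_mem (fil_mono (by omega) h1)]

/-- A lattice at distance `n` is determined by the class modulo `ε^(2n)` of a primitive vector of
the lattice of `b`, up to units, and one of the two coordinates of that vector is a unit. -/
theorem direction_surjective (b : UBasis ω) {n : ℕ} (hn : 0 < n) {M : Submodule k⟦X⟧ V}
    (hM : M ∈ unimodularLattices ω) (h : codim (b.lat 0 0) M = n) :
    ∃ i, M = (b.direction n i).lat (-n) n := by
  obtain ⟨d, rfl⟩ := b.mem_unimodular_iff.1 hM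
  obtain ⟨a, n', hn', h1, h2⟩ := exists_cartan b d
  lift n' to ℕ using hn'
  obtain rfl : n' = n := by rw [← h, h1, h2, codim_lat]
  rw [h2]
  suffices hs : ∃ i, (b.direction n' i).y a.e0 ∈ fil k (2 * n') by
    obtain ⟨i, hi⟩ := hs
    refine ⟨i, (lat_eq_iff rfl).2 ?_⟩
    have h3 := (lat_eq_iff rfl).1 (h1.symm.trans (b.lat_direction n' i))
    simp only [sub_zero] at h3
    exact ⟨⟨fil_mono (by omega) h3.1.1, fil_mono (by omega) hi⟩, fil_mono (by omega) h3.2.1,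
      fil_mono (by omega) h3.2.2⟩
  have h3 := (lat_eq_iff rfl).1 h1.symm
  simp only [sub_zero] at h3
  obtain ⟨⟨hp, hq⟩, hr, hs⟩ := h3
  have hdet := b.det_eq a
  -- a coordinate of the first vector of `a` that is a unit can be divided out
  by_cases hp1 : b.x a.e0 ∈ fil k 1
  · have hq1 : b.y a.e0 ∉ fil k 1 := fun hq1 => by
      have h4 := sub_mem (mul_mem_fil (l := 1) hp1 hs (by omega))
        (mul_mem_fil (l := 1) hq1 hr (by omega))
      rw [hdet, one_mem_fil] at h4
      omega
    have hq0 : b.y a.e0 ≠ 0 := fun h0 => hq1 (h0 ▸ zero_mem _)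
    have hz : b.x a.e0 * (b.y a.e0)⁻¹ ∈ fil k 1 :=
      mul_mem_fil hp1 (inv_mem_fil_of_not_mem (m := 0) hq1) (by omega)
    refine ⟨Sum.inr (window 1 (2 * n' - 1) (b.x a.e0 * (b.y a.e0)⁻¹)), ?_⟩
    rw [b.y_change]
    simp only [direction, x_ofCoeffs_e0, y_ofCoeffs_e0, one_mul]
    have h4 := ofFun_window_sub_mem (n := 2 * n' - 1) hz
    have h5 := mul_mem_fil (l := 2 * n') h4 hq (by omega)
    rwa [sub_mul, inv_mul_cancel_right₀ hq0] at h5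
  · have hp0 : b.x a.e0 ≠ 0 := fun h0 => hp1 (h0 ▸ zero_mem _)
    have hz : b.y a.e0 * (b.x a.e0)⁻¹ ∈ fil k 0 :=
      mul_mem_fil hq (inv_mem_fil_of_not_mem (m := 0) hp1) (by omega)
    refine ⟨Sum.inl (window 0 (2 * n') (b.y a.e0 * (b.x a.e0)⁻¹)), ?_⟩
    rw [b.y_change]
    simp only [direction, x_ofCoeffs_e0, y_ofCoeffs_e0, one_mul]
    have h4 := ofFun_window_sub_mem (n := 2 * n') hz
    have h5 := mul_mem_fil (l := 2 * n') h4 hp (by omega)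
    rwa [sub_mul, inv_mul_cancel_right₀ hp0, ← neg_mem_iff, neg_sub] at h5

end UBasis

open UBasis in
/-- The set `Y₀` is a copy of `SL₂(k)`. -/
theorem finite_and_ncard_layer_zero [Finite k] (hV : Module.finrank k⸨X⸩ V = 2) (hω : ω ≠ 0)
    (hL : L ∈ unimodularLattices ω) : (layer ω L 0).Finite ∧
      (layer ω L 0).ncard = Nat.card k * (Nat.card k ^ 2 - 1) := by
  have : Finite (Matrix.SpecialLinearGroup (Fin 2) k) := Subtype.finite
  obtain ⟨b, rfl⟩ := UBasis.exists_lat_eq hV hω hL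
  obtain ⟨F, hF, h1, -⟩ := exists_layer_coordinates hV hω hL (fun _ : Unit => b) 0 (fun _ => rfl)
    (Function.injective_of_subsingleton _) (fun M hM h => by
      obtain ⟨d, rfl⟩ := b.mem_unimodular_iff.1 hM
      obtain ⟨a, n, hn, h1, h2⟩ := exists_cartan b d
      lift n to ℕ using hn
      obtain rfl : n = 0 := by rw [← h, h1, h2, codim_lat]
      refine ⟨(), ?_⟩
      rw [h2, Nat.cast_zero, neg_zero, h1])
  rw [← h1]
  refine ⟨Set.toFinite _, ?_⟩
  rw [Set.ncard_image_of_injective _ hF, Set.ncard_univ, Nat.card_prod, Nat.card_unique, one_mul,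
    card_sl]

open UBasis in
/-- There are `q^(2n) + q^(2n-1)` lattices at distance `n`, and over each of them the two strata
correspond to the matrices in `SL₂(k)` whose first entry is zero or nonzero. -/
theorem finite_and_ncard_layers [Finite k] (hV : Module.finrank k⸨X⸩ V = 2) (hω : ω ≠ 0)
    (hL : L ∈ unimodularLattices ω) {n : ℕ} (hn : 0 < n) :
    (layerEq ω L n).Finite ∧
      (layerEq ω L n).ncard = Nat.card k ^ (2 * n) * (Nat.card k ^ 2 - 1) ∧
      (layerNe ω L n).Finite ∧
      (layerNe ω L n).ncard = Nat.card k ^ (2 * n + 1) * (Nat.card k ^ 2 - 1) := by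
  have : Finite (Matrix.SpecialLinearGroup (Fin 2) k) := Subtype.finite
  obtain ⟨b, rfl⟩ := UBasis.exists_lat_eq hV hω hL
  obtain ⟨F, hF, -, h2⟩ := exists_layer_coordinates hV hω hL (b.direction n) n (b.lat_direction n)
    (b.direction_injective hn) (fun M hM h => b.direction_surjective hn hM h)
  rw [← (h2 hn).1, ← (h2 hn).2]
  obtain ⟨r, hr⟩ := Nat.exists_eq_add_one.2 (Nat.card_pos (α := k))
  obtain ⟨l, rfl⟩ := Nat.exists_eq_add_one.2 hn
  -- with `q = r + 1` the truncated subtractions disappear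
  have hq : (r + 1) ^ 2 - 1 = r * (r + 2) := Nat.sub_eq_of_eq_add (by ring)
  refine ⟨Set.toFinite _, ?_, Set.toFinite _, ?_⟩
  · rw [Set.ncard_image_of_injective _ hF, Set.ncard_prod, Set.ncard_univ, Nat.card_sum,
      Nat.card_fun, Nat.card_fun, ncard_sl_zero, Nat.card_fin, Nat.card_fin, hr, hq,
      show 2 * (l + 1) - 1 = 2 * l + 1 by omega, Nat.add_sub_cancel]
    ring
  · rw [Set.ncard_image_of_injective _ hF, Set.ncard_prod, Set.ncard_univ, Nat.card_sum,
      Nat.card_fun, Nat.card_fun, ncard_sl_ne, Nat.card_fin, Nat.card_fin, hr, hq,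
      show 2 * (l + 1) - 1 = 2 * l + 1 by omega, Nat.add_sub_cancel]
    ring

/-! ### The group `SL(V)` and the subgroup `P` -/

namespace UBasis

/-- Over a field with an element `a ≠ 0` such that `a ^ 2 ≠ 1`, the group `SL₂` is perfect; here `a
= ε`. -/
theorem commutator_eq_top (b : UBasis ω) : commutator (SpecialLinearGroup k⸨X⸩ V) = ⊤ := by
  have ha : tpow k 1 ^ 2 ≠ 1 := by
    intro h
    rw [sq, ← tpow_add] at h
    have h1 : tpow k (1 + 1) ∈ fil k 1 := tpow_mem_fil.2 (by omega)
    rw [h, one_mem_fil] at h1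
    omega
  have h := congrArg (Subgroup.map (Matrix.SpecialLinearGroup.toLin_equiv b.toBasis).toMonoidHom)
    (Matrix.SL2.commutator_eq_top (tpow_ne_zero 1) ha)
  rw [Subgroup.map_top_of_surjective _ (MulEquiv.surjective _)] at h
  rw [← h, commutator, commutator, Subgroup.map_commutator,
    Subgroup.map_top_of_surjective _ (MulEquiv.surjective _)]

theorem isParahoric_stab (b : UBasis ω) : IsParahoric ω (stab (b.lat 0 0)) := by
  refine ⟨⟨_, b.isIwahori_chamber 0, chamber_zero_le_stab⟩, fun h => ?_⟩
  -- a diagonal element with entries `ε⁻¹`, `ε` moves the lattice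
  have h1 : b.elt (tpow k (-1)) 0 0 (tpow k 1) (by
      rw [mul_comm, tpow_mul_neg, zero_mul, sub_zero]) ∈ stab (b.lat 0 0) := h ▸ trivial
  have h2 := (mem_stab_lat.1 h1).1.1
  simp only [elt_e0, map_add, map_smul, x_e0, x_e1, smul_eq_mul, mul_one, mul_zero, add_zero,
    tpow_mem_fil] at h2
  omega

end UBasis

end
end LoopSL2

theorem mainTheorem5 {k : Type*} [Field k] {V : Type*} [AddCommGroup V] [Module k V]
    [Module (PowerSeries k) V] [Module (LaurentSeries k) V]
    [IsScalarTower k (PowerSeries k) V] [IsScalarTower (PowerSeries k) (LaurentSeries k) V]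
    (hV : Module.finrank (LaurentSeries k) V = 2)
    (ω : ⋀[LaurentSeries k]^2 V) (hω : ω ≠ 0)
    (L : Submodule (PowerSeries k) V) (hL : L ∈ LoopSL2.unimodularLattices ω) :
    commutator (SpecialLinearGroup (LaurentSeries k) V) = ⊤ ∧
    LoopSL2.IsParahoric ω (LoopSL2.stab L) ∧
    (∃! grp : Group (LoopSL2.Weyl ω), LoopSL2.IsWeylGroup ω grp) ∧
    (∃ Φ : (SpecialLinearGroup (LaurentSeries k) V ⧸ LoopSL2.radical (LoopSL2.stab L)) ≃
        LoopSL2.LatticePair ω L,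
      (∀ g : SpecialLinearGroup (LaurentSeries k) V,
        (Φ g).lat = LoopSL2.translate g L ∧
        ∀ (x : L) (y : (Φ g).lat), (y : V) = g x →
          (Φ g).iso (Submodule.Quotient.mk x) = Submodule.Quotient.mk y) ∧
      ∀ grp : Group (LoopSL2.Weyl ω), LoopSL2.IsWeylGroup ω grp →
        Set.BijOn (fun t => Φ '' LoopSL2.piece (LoopSL2.stab L) t)
          (LoopSL2.sequences (LoopSL2.type ω (LoopSL2.stab L)))
          ({LoopSL2.layer ω L 0} ∪ {S | ∃ n > 0, S = LoopSL2.layerEq ω L n} ∪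
            {S | ∃ n > 0, S = LoopSL2.layerNe ω L n})) ∧
    Setoid.IsPartition
      ({LoopSL2.layer ω L 0} ∪ {S | ∃ n > 0, S = LoopSL2.layerEq ω L n} ∪
        {S | ∃ n > 0, S = LoopSL2.layerNe ω L n}) ∧
    (Finite k →
      (LoopSL2.layer ω L 0).Finite ∧
      (LoopSL2.layer ω L 0).ncard = Nat.card k * (Nat.card k ^ 2 - 1) ∧
      ∀ n > 0,
        (LoopSL2.layerEq ω L n).Finite ∧
        (LoopSL2.layerEq ω L n).ncard = Nat.card k ^ (2 * n) * (Nat.card k ^ 2 - 1) ∧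
        (LoopSL2.layerNe ω L n).Finite ∧
        (LoopSL2.layerNe ω L n).ncard = Nat.card k ^ (2 * n + 1) * (Nat.card k ^ 2 - 1)) := by
  obtain ⟨b, hb⟩ := LoopSL2.UBasis.exists_lat_eq hV hω hL
  obtain ⟨Φ, hΦ⟩ := LoopSL2.exists_equiv hV hω hL
  rw [← LoopSL2.range_stratum]
  exact ⟨b.commutator_eq_top, hb ▸ b.isParahoric_stab, b.existsUnique_isWeylGroup,
    ⟨Φ, hΦ, fun grp hW => LoopSL2.bijOn_pieces hV hω hL hΦ hW⟩,
    LoopSL2.isPartition_strata hV hω hL,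
    fun _ => ⟨(LoopSL2.finite_and_ncard_layer_zero hV hω hL).1,
      (LoopSL2.finite_and_ncard_layer_zero hV hω hL).2, fun n hn => LoopSL2.finite_and_ncard_layers hV hω hL hn⟩⟩
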